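/- Let $D \ge 3$, let $b$ be a prime power, and let $U$ be a finite-dimensional vector space over the field $\mathbb F_b$ with a nondegenerate form of one of the six types below, with parameter $e$: - $C_D(b)$: $\dim U = 2D$, symplectic, $e = 1$; - $B_D(b)$: $\dim U = 2D+1$, quadratic, $e = 1$; - $D_D(b)$: $\dim U = 2D$, quadratic of Witt index $D$, $e = 0$; - ${}^2D_{D+1}(b)$: $\dim U = 2D+2$, quadratic of Witt index $D$, $e = 2$; - ${}^2A_{2D}(q)$: $\dim U = 2D+1$, Hermitean, $b = q^2$, $e = 3/2$; - ${}^2A_{2D-1}(q)$: $\dim U = 2D$, Hermitean, $b = q^2$, $e = 1/2$. Let $\Gamma$ be the dual polar graph: its vertex set $X$ consists of the maximal isotropic subspaces of $U$, and $y, z \in X$ are adjacent when $\dim(y \cap z) = D-1$. It is distance-regular with diameter $D$. Let $\partial$ be its distance function, $A_i$ its distance matrices, $A = A_1$ its adjacency matrix, and $a_1$ the number of common neighbours of two adjacent vertices. Let $\theta_0 > \theta_1 > \cdots > \theta_D$ be the eigenvalues of $A$ and $E_i$ the projection onto the eigenspace for $\theta_i$. Fix $x \in X$. For $0 \le i \le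 D$ let $E^*_i$ be the diagonal matrix in ${\rm Mat}_X(\mathbb C)$ whose $(y,y)$-entry is $1$ if $\partial(x,y) = i$ and $0$ otherwise. Let $T = T(x)$ be the subalgebra of ${\rm Mat}_X(\mathbb C)$ generated by $A_0, \ldots, A_D, E^*_0, \ldots, E^*_D$, and let $Z(T)$ be its center. A $T$-module is a $T$-invariant subspace $W$ of $\mathbb C^X$. The endpoint $r$ (resp. dual endpoint $t$) of an irreducible $T$-module $W$ is the least $i$ with $E^*_iW \neq 0$ (resp. $E_iW \ne 0$), and its diameter is $d = |\{ i : E^*_iW \neq 0\}| - 1$. Set $$\zeta = -\frac{b(b^{D+e-2}+1)}{b-1},\quad \xi = \frac{b^2(b^{D+e-2}+1)(b^{D+e-1}+1)}{(b-1)(b^e+b)},\quad \gamma = \frac{(b^e-1)(b-1)}{b},$$ $$\omega(W) = \xi(b^{-1}-1)(b^{e+D-d-t-r}-b^{t-r}) - 2\gamma\zeta .$$ For scalars $\alpha_i \in \mathbb C$ $(1 \le i \le D)$ and $\beta_i \in \mathbb C$ $(0 \le i \le D)$ put $$C = \sum_{i=1}^D \alpha_i E^*_i A E^*_i + \sum_{i=0}^D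 \beta_i E^*_i \in T,$$ and let $\mathcal C$ be the space of all elements of this form that are central in $T$. (1) Suppose that the form is not of type $D_D(b)$. Then $C$ is central in $T$ if and only if both (i) $\alpha_i = b^{1-i}\alpha_1$ for $1 \le i \le D$, and (ii) $\beta_i = \beta_0 - a_1 b^{1-i}\,\frac{b^i-1}{b-1}\,\alpha_1$ for $0 \le i \le D$. Moreover there is a unique element $\Omega \in Z(T)$ that acts on every irreducible $T$-module $W$ as $\omega(W) I$, and $\Omega$ and $I$ form a basis of $\mathcal C$. (2) Suppose that the form is of type $D_D(b)$. Then $C$ is central in $T$ if and only if $\beta_i = \beta_0$ for $0 \le i \le D$, and $\mathcal C$ is spanned by $I$. -/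

import Mathlib

open scoped Matrix

noncomputable section

namespace DualPolar

/-! ### Forms and dual polar graphs -/

/-- The six families: `C` is $C_D(b)$, `B` is $B_D(b)$, `D` is $D_D(b)$, `twistedD` is
${}^2D_{D+1}(b)$, `twistedAEven` is ${}^2A_{2D}(q)$ and `twistedAOdd` is ${}^2A_{2D-1}(q)$. -/
inductive Family
  | C
  | B
  | D
  | twistedD
  | twistedAEven
  | twistedAOdd

/-- The parameter $e$ of a family. -/
def Family.e : Family → ℝ
  | .C => 1
  | .B => 1
  | .D => 0
  | .twistedD => 2
  | .twistedAEven => 3 / 2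
  | .twistedAOdd => 1 / 2

section Forms

variable {F U : Type*} [Field F] [AddCommGroup U] [Module F U]

/-- A form on `U`: bilinear, quadratic, or sesquilinear with respect to `σ`. The laws
(alternating, Hermitean, nondegenerate) are in `Form.IsOfFamily`. -/
inductive Form (F U : Type*) [Field F] [AddCommGroup U] [Module F U]
  | bilinear (f : U →ₗ[F] U →ₗ[F] F)
  | quadratic (Q : QuadraticForm F U)
  | sesquilinear (σ : F →+* F) (h : U →ₛₗ[σ] U →ₗ[F] F)

/-- The form vanishes completely on `W`. -/
def Form.IsIsotropic : Form F U → Submodule F U → Prop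
  | .bilinear f, W => ∀ u ∈ W, ∀ v ∈ W, f u v = 0
  | .quadratic Q, W => ∀ u ∈ W, Q u = 0
  | .sesquilinear _ h, W => ∀ u ∈ W, ∀ v ∈ W, h u v = 0

/-- The Witt index is `D`: the largest dimension of an isotropic subspace is `D`. -/
def Form.HasWittIndex (P : Form F U) (D : ℕ) : Prop :=
  IsGreatest {n : ℕ | ∃ W : Submodule F U, P.IsIsotropic W ∧ Module.finrank F W = n} D

/-- A nondegenerate symplectic form. -/
def IsSymplecticForm (f : U →ₗ[F] U →ₗ[F] F) : Prop :=
  (∀ u, f u u = 0) ∧ ∀ u, (∀ v, f u v = 0) → u = 0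

/-- A nondegenerate quadratic form, in any characteristic: no nonzero singular vector lies in
the radical of the polar form. -/
def IsNondegenerateQuadratic (Q : QuadraticForm F U) : Prop :=
  ∀ u, Q u = 0 → (∀ v, QuadraticMap.polar Q u v = 0) → u = 0

/-- A nondegenerate Hermitean form over a field of order $q^2$, with respect to the involution
$a \mapsto a^q$. -/
def IsHermiteanForm (σ : F →+* F) (h : U →ₛₗ[σ] U →ₗ[F] F) : Prop :=
  (∃ q : ℕ, Nat.card F = q ^ 2 ∧ ∀ a, σ a = a ^ q) ∧
  (∀ u v, h v u = σ (h u v)) ∧ ∀ u, (∀ v, h u v = 0) → u = 0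

/-- The form on `U` is nondegenerate and belongs to the given family with parameter `D`. -/
def Form.IsOfFamily : Form F U → Family → ℕ → Prop
  | .bilinear f, .C, D => IsSymplecticForm f ∧ Module.finrank F U = 2 * D
  | .quadratic Q, .B, D => IsNondegenerateQuadratic Q ∧ Module.finrank F U = 2 * D + 1
  | .quadratic Q, .D, D => IsNondegenerateQuadratic Q ∧ Module.finrank F U = 2 * D ∧
      (Form.quadratic Q).HasWittIndex D
  | .quadratic Q, .twistedD, D => IsNondegenerateQuadratic Q ∧
      Module.finrank F U = 2 * D + 2 ∧ (Form.quadratic Q).HasWittIndex D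
  | .sesquilinear σ h, .twistedAEven, D => IsHermiteanForm σ h ∧
      Module.finrank F U = 2 * D + 1
  | .sesquilinear σ h, .twistedAOdd, D => IsHermiteanForm σ h ∧ Module.finrank F U = 2 * D
  | _, _, _ => False

/-- The maximal isotropic subspaces of `U`. -/
abbrev Vertex (P : Form F U) : Type _ := {W : Submodule F U // Maximal P.IsIsotropic W}

/-- The dual polar graph: maximal isotropic subspaces, adjacent when they meet in dimension
`D - 1`. -/
def graph (P : Form F U) (D : ℕ) : SimpleGraph (Vertex P) where
  Adj y z := y ≠ z ∧ Module.finrank F ↥(y.1 ⊓ z.1) + 1 = D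
  symm := ⟨fun y z h => ⟨h.1.symm, by rw [inf_comm]; exact h.2⟩⟩
  loopless := ⟨fun _ h => h.1 rfl⟩

end Forms

/-! ### The subconstituent algebra of a finite graph -/

section Algebra

variable {X : Type*} [Fintype X] [DecidableEq X]

/-- The intersection number $p^h_{ij}$ of a distance-regular graph: the common value of
$|\Gamma_i(y) \cap \Gamma_j(z)|$ over the vertices `y`, `z` at distance `h`. -/
def interNum (G : SimpleGraph X) (h i j : ℕ) : ℕ :=
  sInf {n : ℕ | ∃ y z : X, G.dist y z = h ∧ n = {w : X | G.dist y w = i ∧ G.dist z w = j}.ncard}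

/-- The distance matrix $A_i$. -/
def distMatrix (R : Type*) [Zero R] [One R] (G : SimpleGraph X) (i : ℕ) : Matrix X X R :=
  Matrix.of fun y z => if G.dist y z = i then 1 else 0

/-- The adjacency matrix $A = A_1$. -/
abbrev adj (G : SimpleGraph X) : Matrix X X ℂ := distMatrix ℂ G 1

/-- The dual idempotent $E^*_i = E^*_i(x)$. -/
def dualIdem (G : SimpleGraph X) (x : X) (i : ℕ) : Matrix X X ℂ :=
  Matrix.diagonal fun y => if G.dist x y = i then 1 else 0

/-- The subconstituent algebra $T = T(x)$: it is generated by the distance matrices (which span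
the Bose-Mesner algebra) and the dual idempotents (which span the dual Bose-Mesner algebra). -/
def subconstAlg (G : SimpleGraph X) (x : X) : Subalgebra ℂ (Matrix X X ℂ) :=
  Algebra.adjoin ℂ (Set.range (distMatrix ℂ G) ∪ Set.range (dualIdem G x))

/-- The center $Z(T)$, as a set of matrices. -/
def centerT (G : SimpleGraph X) (x : X) : Subalgebra ℂ (Matrix X X ℂ) :=
  (Subalgebra.center ℂ (subconstAlg G x)).map (subconstAlg G x).val

/-- The distinct eigenvalues of the (real symmetric) adjacency matrix. -/
def eigenvalues (G : SimpleGraph X) : Finset ℝ := (distMatrix ℝ G 1).charpoly.roots.toFinset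

/-- The primitive idempotent $E_i$: the projection onto the eigenspace of $A$ for $\theta_i$,
where $\theta_0 > \theta_1 > \cdots$ are the distinct eigenvalues. The sum has one term (the
eigenvalue with exactly `i` larger ones), in which the projection is written as the Lagrange
interpolation polynomial of the spectrum evaluated at $A$. -/
def idem (G : SimpleGraph X) (i : ℕ) : Matrix X X ℂ :=
  ∑ θ ∈ (eigenvalues G).filter (fun θ => ((eigenvalues G).filter (fun μ => θ < μ)).card = i),
    Polynomial.aeval (adj G) (Lagrange.basis (eigenvalues G) id θ)

/-- `W` is a `T`-module: a subspace of the standard module invariant under `T`. -/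
def IsTModule (G : SimpleGraph X) (x : X) (W : Submodule ℂ (X → ℂ)) : Prop :=
  ∀ B ∈ subconstAlg G x, ∀ w ∈ W, B *ᵥ w ∈ W

/-- `W` is an irreducible `T`-module. -/
def IsIrredTModule (G : SimpleGraph X) (x : X) (W : Submodule ℂ (X → ℂ)) : Prop :=
  IsTModule G x W ∧ W ≠ ⊥ ∧ ∀ W' ≤ W, IsTModule G x W' → W' = ⊥ ∨ W' = W

/-- The endpoint of `W`: the least `i` with $E^*_i W \ne 0$. -/
def endpoint (G : SimpleGraph X) (x : X) (W : Submodule ℂ (X → ℂ)) : ℕ :=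
  sInf {i : ℕ | ∃ w ∈ W, dualIdem G x i *ᵥ w ≠ 0}

/-- The dual endpoint of `W`: the least `i` with $E_i W \ne 0$. -/
def dualEndpoint (G : SimpleGraph X) (W : Submodule ℂ (X → ℂ)) : ℕ :=
  sInf {i : ℕ | ∃ w ∈ W, idem G i *ᵥ w ≠ 0}

/-- The diameter of `W`: one less than the number of `i` with $E^*_i W \ne 0$. -/
def moduleDiam (G : SimpleGraph X) (x : X) (W : Submodule ℂ (X → ℂ)) : ℕ :=
  {i : ℕ | ∃ w ∈ W, dualIdem G x i *ᵥ w ≠ 0}.ncard - 1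

/-- The element $\sum_{i=1}^D \alpha_i E^*_i A E^*_i + \sum_{i=0}^D \beta_i E^*_i$ of $T$. -/
def elemC (G : SimpleGraph X) (x : X) (D : ℕ) (α β : ℕ → ℂ) : Matrix X X ℂ :=
  ∑ i ∈ Finset.Icc 1 D, α i • (dualIdem G x i * adj G * dualIdem G x i) +
    ∑ i ∈ Finset.range (D + 1), β i • dualIdem G x i

/-- The space $\mathcal C$ of central elements of $T$ of the above shape, as a set. -/
def centralShape (G : SimpleGraph X) (x : X) (D : ℕ) : Set (Matrix X X ℂ) :=
  {M | (∃ α β : ℕ → ℂ, M = elemC G x D α β) ∧ M ∈ centerT G x}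

/-! ### The element `Ω` -/

/-- The scalar $\zeta$. -/
def zeta (b e : ℝ) (D : ℕ) : ℝ := -(b * (b ^ (D + e - 2) + 1) / (b - 1))

/-- The scalar $\xi$. -/
def xi (b e : ℝ) (D : ℕ) : ℝ :=
  b ^ 2 * (b ^ (D + e - 2) + 1) * (b ^ (D + e - 1) + 1) / ((b - 1) * (b ^ e + b))

/-- The scalar $\gamma$. -/
def gam (b e : ℝ) : ℝ := (b ^ e - 1) * (b - 1) / b

/-- The scalar $\omega(W)$ for an irreducible `T`-module with endpoint `r`, dual endpoint `t`
and diameter `d`. -/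
def omega (b e : ℝ) (D r t d : ℕ) : ℝ :=
  xi b e D * (b⁻¹ - 1) * (b ^ (e + D - d - t - r) - b ^ ((t : ℝ) - r)) -
    2 * gam b e * zeta b e D

/-- `Om` is the element $\Omega$: it is in $Z(T)$ and acts on every irreducible `T`-module $W$
as $\omega(W) I$. -/
def IsOmega (G : SimpleGraph X) (x : X) (b e : ℝ) (D : ℕ) (Om : Matrix X X ℂ) : Prop :=
  Om ∈ centerT G x ∧ ∀ W : Submodule ℂ (X → ℂ), IsIrredTModule G x W → ∀ w ∈ W,
    Om *ᵥ w =
      ((omega b e D (endpoint G x W) (dualEndpoint G W) (moduleDiam G x W) : ℝ) : ℂ) • w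

end Algebra

end DualPolar

end

/-! Split `A` with respect to the base vertex as `A = R + L + F` into its raising, lowering and flat
parts, and let `K` be the diagonal matrix with entries `b ^ (-dist x y)` (`weight`). A line (the
maximal isotropic subspaces through a fixed one of codimension one) has `s + 1` points with `s = b ^
e`. On each line there is a unique point nearest to a given vertex. Counting common neighbours with
this fact gives `F R = b R F + (s - 1) R` (`flat_mul_raise`). With `F' = F + (s - 1)/(b - 1)` this
reads `F' R = b R F'`. Since also `R K = b K R`, and transposing handles `L`, the product `K F'` is
central (`weightedFlat_mem`). Up to scaling and adding a multiple of the identity, it is `Ω`.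

The scalar by which `K F'` acts on an irreducible module `W` is found by computing the trace of `A`
on `W` in two ways. This needs two bases of `W`, adapted to the `E*_i` and to the `E_i`. They come
from a filtration of the standard module: let `W_i` be spanned by the characteristic functions of
"contains `S`" with `dim S < i`. Then `A` acts as `θ_i` on `W_{i+1}/W_i` (`adj_mulVec_sub_mem`), and
multiplication by `K` maps `W_i` into `W_{i+1}` (`weight_mulVec_mem`). So `E_i K E_j = 0` when `|i -
j| > 1`, and the explicit `θ_i` yield a tridiagonal relation between `A` and `K`. Its component
raising the distance by one expresses `L R R` through `R L R`, `R R L` and `R` (`cubic_relation`,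
`lower_raise_raise`).

Hence if `v` lies at the endpoint of `W` and is an eigenvector of `L R`, the vectors `R ^ k v` span
`W` (`span_raise_pow`). The nonzero vectors `E_i v` span it as well (`span_idem_mulVec`), and their
indices are consecutive. On `R ^ k v` the matrix `F` acts as a scalar determined by the scalar of `K
F'`, whereas `R` and `L` do not contribute to the trace. Equating the trace with the sum of the
eigenvalues `θ_t, ..., θ_{t+d}` gives the scalar (`weightedFlat_mulVec`). Uniqueness of `Ω` holds
because `T` is closed under conjugate transposition, so that a central element is determined by its
action on irreducible modules (`eq_zero_of_mem_centerT`).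

Finally, an element `C` of the given shape is symmetric and commutes with `F` and all `E*_i`, so it
is central exactly when it commutes with `R`. On each subconstituent `C R - R C` is a combination of
`R F` and `R` (`elemC_mem_centerT_iff`). For `s > 1` entries at adjacent and at nonadjacent pairs
separate the two coefficients; for `s = 1`, which is type `D`, `F = 0` and only the `β i` matter. -/

set_option linter.unusedSectionVars false

noncomputable section

/-! ### Polar spaces: orthogonal complements and gates -/

namespace DualPolar

open Module

/-- A reflexive sesquilinear form together with its singular vectors: the common features of
symplectic, quadratic and Hermitean forms. -/
structure PolarSpace (F U : Type*) [Field F] [AddCommGroup U] [Module F U] where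
  σ : F →+* F
  B : U →ₛₗ[σ] U →ₗ[F] F
  sing : U → Prop
  refl : ∀ u v, B u v = 0 → B v u = 0
  sing_zero : sing 0
  sing_smul : ∀ (a : F) u, sing u → sing (a • u)
  sing_add : ∀ u v, sing u → sing v → B u v = 0 → sing (u + v)
  sing_self : ∀ u, sing u → B u u = 0
  nondeg : ∀ u, sing u → (∀ v, B u v = 0) → u = 0

namespace PolarSpace

variable {F U : Type*} [Field F] [AddCommGroup U] [Module F U] (P : PolarSpace F U)

/-- Totally isotropic (singular) subspaces. -/
def Iso (S : Submodule F U) : Prop := (∀ u ∈ S, P.sing u) ∧ ∀ u ∈ S, ∀ v ∈ S, P.B u v = 0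

/-- The subspace of vectors orthogonal to `S`. -/
def perp (S : Submodule F U) : Submodule F U where
  carrier := {v | ∀ u ∈ S, P.B u v = 0}
  add_mem' := fun ha hb u hu => by rw [map_add, ha u hu, hb u hu, add_zero]
  zero_mem' := fun u _ => map_zero _
  smul_mem' := fun c v hv u hu => by rw [map_smul, hv u hu, smul_zero]

variable {P}

theorem mem_perp {S : Submodule F U} {v : U} : v ∈ P.perp S ↔ ∀ u ∈ S, P.B u v = 0 := Iff.rfl

theorem Iso.mono {S T : Submodule F U} (hT : P.Iso T) (h : S ≤ T) : P.Iso S :=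
  ⟨fun u hu => hT.1 u (h hu), fun u hu v hv => hT.2 u (h hu) v (h hv)⟩

theorem Iso.le_perp {S : Submodule F U} (hS : P.Iso S) : S ≤ P.perp S :=
  fun v hv u hu => hS.2 u hu v hv

theorem perp_anti {S T : Submodule F U} (h : S ≤ T) : P.perp T ≤ P.perp S :=
  fun _ hv u hu => hv u (h hu)

theorem iso_bot : P.Iso ⊥ := by
  refine ⟨fun u hu => ?_, fun u hu v hv => ?_⟩
  · rw [(Submodule.mem_bot F).1 hu]; exact P.sing_zero
  · rw [(Submodule.mem_bot F).1 hv]; exact map_zero _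

theorem Iso.sup {S T : Submodule F U} (hS : P.Iso S) (hT : P.Iso T) (h : T ≤ P.perp S) :
    P.Iso (S ⊔ T) := by
  constructor
  · intro u hu
    obtain ⟨a, ha, c, hc, rfl⟩ := Submodule.mem_sup.1 hu
    exact P.sing_add _ _ (hS.1 a ha) (hT.1 c hc) (h hc a ha)
  · intro u hu v hv
    obtain ⟨a, ha, c, hc, rfl⟩ := Submodule.mem_sup.1 hu
    obtain ⟨a', ha', c', hc', rfl⟩ := Submodule.mem_sup.1 hv
    simp only [map_add, LinearMap.add_apply]
    rw [hS.2 a ha a' ha', hT.2 c hc c' hc', h hc' a ha, P.refl _ _ (h hc a' ha')]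
    simp

theorem iso_span_singleton {u : U} (hu : P.sing u) : P.Iso (F ∙ u) := by
  constructor
  · intro v hv
    obtain ⟨a, rfl⟩ := Submodule.mem_span_singleton.1 hv
    exact P.sing_smul _ _ hu
  · intro v hv w hw
    obtain ⟨a, rfl⟩ := Submodule.mem_span_singleton.1 hv
    obtain ⟨c, rfl⟩ := Submodule.mem_span_singleton.1 hw
    simp [P.sing_self u hu]

/-- A singular vector orthogonal to a maximal isotropic subspace lies in it. -/
theorem mem_of_maximal {y : Submodule F U} (hy : Maximal P.Iso y) {v : U} (hv : P.sing v)
    (h : v ∈ P.perp y) : v ∈ y := by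
  have := hy.2 (hy.1.sup (iso_span_singleton hv)
    ((Submodule.span_singleton_le_iff_mem _ _).2 h)) le_sup_left
  exact this (Submodule.mem_sup_right (Submodule.mem_span_singleton_self v))

theorem eq_of_maximal_of_le {y z : Submodule F U} (hy : Maximal P.Iso y) (hz : P.Iso z)
    (h : y ≤ z) : y = z := le_antisymm h (hy.2 hz h)

section FiniteDim

variable [FiniteDimensional F U]

/-- Each vector of a complement of a subspace orthogonal to `T` imposes one condition on `T`. -/
theorem finrank_le_perp_inf (S T S₀ : Submodule F U) (h₀ : S₀ ≤ S) (hT : T ≤ P.perp S₀) :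
    finrank F T + finrank F S₀ ≤ finrank F ↥(P.perp S ⊓ T) + finrank F S := by
  obtain ⟨S₁, hd, hs⟩ := IsModularLattice.exists_disjoint_and_sup_eq h₀
  have hdim := Submodule.finrank_sup_add_finrank_inf_eq S₀ S₁
  rw [hs, hd.eq_bot, finrank_bot] at hdim
  let u := finBasis F S₁
  let ψ : T →ₗ[F] (Fin (finrank F S₁) → F) :=
    LinearMap.pi fun j => (P.B (u j : U)).comp T.subtype
  have hk : (LinearMap.ker ψ).map T.subtype ≤ P.perp S ⊓ T := by
    rintro _ ⟨v, hv, rfl⟩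
    refine ⟨fun w hw => ?_, v.2⟩
    rw [← hs] at hw
    obtain ⟨a, ha, c, hc, rfl⟩ := Submodule.mem_sup.1 hw
    have h1 : P.B a v = 0 := hT v.2 a ha
    have h2 : P.B c v = 0 := by
      have := u.sum_repr ⟨c, hc⟩
      have hc' : c = ∑ i, u.repr ⟨c, hc⟩ i • (u i : U) := by
        simpa only [Submodule.coe_sum, Submodule.coe_smul] using (congrArg Subtype.val this).symm
      rw [hc', map_sum, LinearMap.sum_apply]
      refine Finset.sum_eq_zero fun i _ => ?_
      have h3 : P.B (u i : U) v = 0 := congrFun (LinearMap.mem_ker.1 hv) i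
      rw [LinearMap.map_smulₛₗ, LinearMap.smul_apply, h3, smul_zero]
    simp [h1, h2]
  have h1 := Submodule.finrank_mono hk
  rw [← (Submodule.equivMapOfInjective _ T.injective_subtype _).finrank_eq] at h1
  have h2 := ψ.finrank_range_add_finrank_ker
  have h3 := Submodule.finrank_le (LinearMap.range ψ)
  rw [finrank_fin_fun] at h3
  omega

/-- The functionals `P.B u`, for `u` in a basis of `S`, are independent: a relation between them,
with coefficients pulled back through the surjective `σ`, is a vector of `S` orthogonal to
everything. This vector is singular, so it suffices that nondegeneracy is assumed for singular
vectors only, as it must be for quadratic forms in characteristic two. -/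
theorem finrank_perp [Finite F] (S : Submodule F U) (hS : P.Iso S) :
    finrank F (P.perp S) + finrank F S = finrank F U := by
  have hσ : Function.Surjective P.σ := Finite.surjective_of_injective P.σ.injective
  let u := finBasis F S
  let ψ : U →ₗ[F] (Fin (finrank F S) → F) := LinearMap.pi fun j => P.B (u j : U)
  have hk : LinearMap.ker ψ = P.perp S := by
    ext v
    rw [LinearMap.mem_ker, mem_perp]
    constructor
    · intro hv c hc
      have := u.sum_repr ⟨c, hc⟩
      have hc' : c = ∑ i, u.repr ⟨c, hc⟩ i • (u i : U) := by
        simpa only [Submodule.coe_sum, Submodule.coe_smul] using (congrArg Subtype.val this).symm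
      rw [hc', map_sum, LinearMap.sum_apply]
      refine Finset.sum_eq_zero fun i _ => ?_
      have h3 : P.B (u i : U) v = 0 := congrFun hv i
      rw [LinearMap.map_smulₛₗ, LinearMap.smul_apply, h3, smul_zero]
    · intro hv
      funext i
      exact hv _ (u i).2
  have hr : LinearMap.range ψ = ⊤ := by
    by_contra hne
    obtain ⟨f, hf, hf0⟩ := Submodule.exists_le_ker_of_lt_top _ (lt_top_iff_ne_top.2 hne)
    choose τ hτ using fun i => hσ (f (Pi.single i 1))
    have h0 : (∑ i, τ i • (u i : U)) = 0 := by
      apply P.nondeg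
      · exact hS.1 _ (Submodule.sum_mem _ fun i _ => Submodule.smul_mem _ _ (u i).2)
      · intro v
        rw [map_sum, LinearMap.sum_apply]
        have h1 : f (ψ v) = 0 := hf0 ⟨v, rfl⟩
        rw [pi_eq_sum_univ (ψ v), map_sum] at h1
        rw [← h1]
        refine Finset.sum_congr rfl fun i _ => ?_
        rw [LinearMap.map_smulₛₗ, LinearMap.smul_apply, hτ, map_smul, smul_eq_mul, smul_eq_mul,
          mul_comm]
        congr 2
        funext j
        simp [Pi.single_apply, eq_comm]
    have h1 : ∑ i, τ i • u i = 0 := by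
      apply Subtype.ext
      simpa using h0
    have h2 := Fintype.linearIndependent_iff.1 u.linearIndependent τ h1
    apply hf
    apply LinearMap.pi_ext'
    intro i
    ext
    simp [← hτ, h2]
  have h2 := ψ.finrank_range_add_finrank_ker
  rw [hk, hr, finrank_top, finrank_fin_fun] at h2
  omega

variable {D : ℕ}

/-- All maximal isotropic subspaces have the same dimension. -/
theorem finrank_maximal (hD : ∃ W, P.Iso W ∧ finrank F W = D)
    (hD' : ∀ W, P.Iso W → finrank F W ≤ D) {y : Submodule F U} (hy : Maximal P.Iso y) :
    finrank F y = D := by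
  obtain ⟨z, hz, hzD⟩ := hD
  have h1 : P.perp y ⊓ z ≤ y ⊓ z := fun v hv =>
    ⟨mem_of_maximal hy (hz.1 v hv.2) hv.1, hv.2⟩
  have h2 := Submodule.finrank_mono h1
  -- Vectors of `z` are already orthogonal to `y ⊓ z`, so being orthogonal to `y` costs at most `dim
  -- y - dim (y ⊓ z)` conditions. The solutions lie in `y ⊓ z`, which forces `D ≤ dim y`.
  have h3 := finrank_le_perp_inf (P := P) y z (y ⊓ z) inf_le_left
    (fun v hv u hu => hz.2 u hu.2 v hv)
  have := hD' y hy.1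
  omega

theorem maximal_of_finrank (hD' : ∀ W, P.Iso W → finrank F W ≤ D) {y : Submodule F U}
    (hy : P.Iso y) (h : D ≤ finrank F y) : Maximal P.Iso y :=
  ⟨hy, fun W hW hle => (Submodule.eq_of_le_of_finrank_le hle ((hD' W hW).trans h)).ge⟩

/-- Among the maximal isotropic subspaces containing `S` there is a unique one nearest `y`. -/
theorem exists_gate (hD : ∃ W, P.Iso W ∧ finrank F W = D)
    (hD' : ∀ W, P.Iso W → finrank F W ≤ D) {y S : Submodule F U} (hy : Maximal P.Iso y)
    (hS : P.Iso S) : ∃ p, Maximal P.Iso p ∧ S ≤ p ∧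
      finrank F ↥(p ⊓ y) + finrank F S = D + finrank F ↥(S ⊓ y) ∧
      ∀ z, Maximal P.Iso z → S ≤ z → z ⊓ y ≤ p ⊓ y ∧ (z ⊓ y = p ⊓ y → z = p) := by
  have hyD := finrank_maximal hD hD' hy
  have h1 := finrank_le_perp_inf (P := P) S y (S ⊓ y) inf_le_left
    (fun v hv u hu => hy.1.2 u hu.2 v hv)
  -- The gate is `S + (S^⊥ ∩ y)`. By `h1` its dimension is at least `D`, and every isotropic `z`
  -- above `S` meets `y` inside `S^⊥ ∩ y`.
  have hiso : P.Iso (S ⊔ P.perp S ⊓ y) := hS.sup (hy.1.mono inf_le_right) inf_le_left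
  have h2 := Submodule.finrank_sup_add_finrank_inf_eq S (P.perp S ⊓ y)
  have h3 : S ⊓ (P.perp S ⊓ y) = S ⊓ y := by
    rw [← inf_assoc, inf_eq_left.2 hS.le_perp]
  rw [h3] at h2
  have h4 := hD' _ hiso
  have hmax : Maximal P.Iso (S ⊔ P.perp S ⊓ y) := maximal_of_finrank hD' hiso (by omega)
  have h5 := finrank_maximal hD hD' hmax
  have h6 : (S ⊔ P.perp S ⊓ y) ⊓ y = P.perp S ⊓ y := by
    apply le_antisymm
    · exact fun v hv => ⟨fun u hu => hmax.1.2 u (Submodule.mem_sup_left hu) v hv.1, hv.2⟩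
    · exact le_inf le_sup_right inf_le_right
  refine ⟨_, hmax, le_sup_left, ?_, fun z hz hSz => ?_⟩
  · rw [h6]; omega
  · rw [h6]
    refine ⟨fun v hv => ⟨fun u hu => hz.1.2 u (hSz hu) v hv.1, hv.2⟩, fun h => ?_⟩
    have : S ⊔ P.perp S ⊓ y ≤ z := sup_le hSz (h ▸ inf_le_left)
    exact (eq_of_maximal_of_le hmax hz.1 this).symm

end FiniteDim
end PolarSpace
end DualPolar

/-! ### The number of points on a line -/

namespace DualPolar

open Module

theorem card_submodule {F U : Type*} [Field F] [Finite F] [AddCommGroup U] [Module F U]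
    [FiniteDimensional F U] [Fintype U] (S : Submodule F U) [DecidablePred (· ∈ S)] :
    (Finset.univ.filter (· ∈ S)).card = Nat.card F ^ finrank F S := by
  rw [← Module.natCard_eq_pow_finrank (K := F) (V := S), Nat.card_eq_fintype_card,
    ← Fintype.card_subtype]

namespace PolarSpace

variable {F U : Type*} [Field F] [AddCommGroup U] [Module F U] {P : PolarSpace F U} {D : ℕ}

theorem finrank_sup_span_singleton [FiniteDimensional F U] {H : Submodule F U} {w : U}
    (hw : w ∉ H) : finrank F ↥(H ⊔ F ∙ w) = finrank F H + 1 := by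
  have h0 : w ≠ 0 := fun h => hw (h ▸ H.zero_mem)
  have h1 := Submodule.finrank_sup_add_finrank_inf_eq H (F ∙ w)
  have h2 : H ⊓ (F ∙ w) = ⊥ := by
    rw [← disjoint_iff, Submodule.disjoint_span_singleton' h0]
    exact hw
  rw [h2, finrank_bot, finrank_span_singleton h0] at h1
  omega

/-- The number of maximal isotropic subspaces through an isotropic subspace of codimension one. -/
theorem ncard_line [Finite F] [FiniteDimensional F U] {κ : ℕ}
    (hκ : ∀ u w, P.sing u → P.B u w ≠ 0 → Nat.card {c : F // P.sing (w + c • u)} = κ)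
    (hD : ∃ W, P.Iso W ∧ finrank F W = D)
    (hD' : ∀ W, P.Iso W → finrank F W ≤ D) {H : Submodule F U} (hH : P.Iso H)
    (hHD : finrank F H + 1 = D) :
    {z | Maximal P.Iso z ∧ H ≤ z}.ncard = κ * Nat.card F ^ (finrank F U - 2 * D) + 1 := by
  classical
  have : Finite U := Module.finite_of_finite F
  let _ : Fintype U := Fintype.ofFinite U
  let _ : Fintype F := Fintype.ofFinite F
  let _ : Fintype (Submodule F U) := Fintype.ofFinite _
  set b := Nat.card F with hb
  have hb1 : 1 < b := Finite.one_lt_card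
  obtain ⟨W, hW, hWD⟩ := hD
  obtain ⟨z₀, hz₀, hHz₀, -⟩ :=
    exists_gate ⟨W, hW, hWD⟩ hD' (maximal_of_finrank hD' hW hWD.ge) hH
  have hfin : ∀ z, Maximal P.Iso z → finrank F z = D := fun z hz =>
    finrank_maximal ⟨W, hW, hWD⟩ hD' hz
  have hz₀D := hfin z₀ hz₀
  obtain ⟨u, huz, huH⟩ : ∃ u ∈ z₀, u ∉ H := by
    by_contra! hcon
    have := Submodule.finrank_mono (show z₀ ≤ H from hcon)
    omega
  have hspan : ∀ z, Maximal P.Iso z → H ≤ z → ∀ w ∈ z, w ∉ H → H ⊔ F ∙ w = z := by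
    intro z hz hHz w hwz hwH
    apply Submodule.eq_of_le_of_finrank_eq
    · exact sup_le hHz ((Submodule.span_singleton_le_iff_mem _ _).2 hwz)
    · rw [finrank_sup_span_singleton hwH, hfin z hz, hHD]
  have hperp : ∀ w ∈ P.perp H, (w ∈ P.perp z₀ ↔ P.B u w = 0) := by
    intro w hw
    refine ⟨fun h => h u huz, fun h v hv => ?_⟩
    rw [← hspan z₀ hz₀ hHz₀ u huz huH] at hv
    obtain ⟨a, ha, c, hc, rfl⟩ := Submodule.mem_sup.1 hv
    obtain ⟨c, rfl⟩ := Submodule.mem_span_singleton.1 hc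
    rw [map_add, LinearMap.add_apply, hw a ha, LinearMap.map_smulₛₗ, LinearMap.smul_apply, h]
    simp
  -- Double counting of the pairs `(w, c)` with `w` in `T` and `w + c • u` singular. Each `w` admits
  -- `κ` values of `c`, while `(w, c) ↦ (w + c • u, c)` maps the pairs bijectively onto `S × F`. The
  -- set `S` is then partitioned into the differences `z \ H` with `z ≠ z₀`.
  let T : Finset U := Finset.univ.filter fun w => w ∈ P.perp H ∧ w ∉ P.perp z₀
  let S : Finset U := Finset.univ.filter fun w => P.sing w ∧ w ∈ P.perp H ∧ w ∉ P.perp z₀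
  let Z : Finset (Submodule F U) :=
    Finset.univ.filter fun z => (Maximal P.Iso z ∧ H ≤ z) ∧ z ≠ z₀
  have hTcard : T.card + b ^ finrank F (P.perp z₀) = b ^ finrank F (P.perp H) := by
    rw [← card_submodule, ← card_submodule, ← Finset.card_union_of_disjoint]
    · congr 1
      ext w
      have : w ∈ P.perp z₀ → w ∈ P.perp H := fun h => perp_anti hHz₀ h
      simp only [T, Finset.mem_union, Finset.mem_filter, Finset.mem_univ, true_and]
      tauto
    · rw [Finset.disjoint_left]
      intro w hw
      simp only [T, Finset.mem_filter, Finset.mem_univ, true_and] at hw ⊢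
      exact hw.2
  have hTS : T.card * κ = S.card * b := by
    have hadd : ∀ w (c : F), (w + c • u ∈ P.perp H ∧ w + c • u ∉ P.perp z₀) ↔
        (w ∈ P.perp H ∧ w ∉ P.perp z₀) := by
      intro w c
      have h1 : c • u ∈ P.perp z₀ := Submodule.smul_mem _ _ (hz₀.1.le_perp huz)
      rw [Submodule.add_mem_iff_left _ h1, Submodule.add_mem_iff_left _ (perp_anti hHz₀ h1)]
    have h1 : ((T ×ˢ (Finset.univ : Finset F)).filter fun p => P.sing (p.1 + p.2 • u)).card
        = T.card * κ := by
      rw [Finset.card_filter, Finset.sum_product, Finset.sum_const_nat]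
      intro w hw
      rw [← Finset.card_filter, ← hκ u w (hz₀.1.1 u huz), Nat.card_eq_fintype_card,
        Fintype.card_subtype]
      simp only [T, Finset.mem_filter, Finset.mem_univ, true_and] at hw
      exact fun h => hw.2 ((hperp w hw.1).2 h)
    rw [← h1, hb, Nat.card_eq_fintype_card, ← Finset.card_univ, ← Finset.card_product]
    refine Finset.card_nbij' (fun p => (p.1 + p.2 • u, p.2)) (fun p => (p.1 - p.2 • u, p.2))
      ?_ ?_ ?_ ?_
    · rintro ⟨w, c⟩ h
      simp only [S, T, Finset.coe_filter, Finset.mem_product, Finset.mem_filter, Finset.mem_univ, true_and,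
        and_true, Finset.coe_product, Set.mem_prod, Set.mem_ofPred_eq, Finset.coe_univ, Set.mem_univ] at h ⊢
      exact ⟨h.2, (hadd _ _).2 h.1⟩
    · rintro ⟨w, c⟩ h
      simp only [S, T, Finset.coe_filter, Finset.mem_product, Finset.mem_filter, Finset.mem_univ, true_and,
        and_true, Finset.coe_product, Set.mem_prod, Set.mem_ofPred_eq, Finset.coe_univ, Set.mem_univ] at h ⊢
      refine ⟨(hadd _ c).1 ?_, ?_⟩
      · simpa using h.2
      · simpa using h.1
    · rintro ⟨w, c⟩ _; simp
    · rintro ⟨w, c⟩ _; simp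
  have hSZ : S.card = Z.card * (b ^ D - b ^ finrank F H) := by
    rw [Finset.card_eq_sum_card_fiberwise (f := fun w => H ⊔ F ∙ w) (t := Z)]
    · rw [Finset.sum_const_nat]
      intro z hz
      simp only [Z, Finset.mem_filter, Finset.mem_univ, true_and] at hz
      obtain ⟨⟨hz, hHz⟩, hne⟩ := hz
      have h1 : (S.filter fun w => H ⊔ F ∙ w = z) =
          (Finset.univ.filter (· ∈ z)) \ (Finset.univ.filter (· ∈ H)) := by
        ext w
        simp only [S, Finset.mem_filter, Finset.mem_univ, true_and, Finset.mem_sdiff]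
        constructor
        · rintro ⟨⟨hs, hw, hw'⟩, rfl⟩
          exact ⟨Submodule.mem_sup_right (Submodule.mem_span_singleton_self w),
            fun h => hw' (hz₀.1.le_perp (hHz₀ h))⟩
        · rintro ⟨hwz, hwH⟩
          refine ⟨⟨hz.1.1 w hwz, perp_anti hHz (hz.1.le_perp hwz), fun h => hne ?_⟩,
            hspan z hz hHz w hwz hwH⟩
          rw [← hspan z hz hHz w hwz hwH]
          exact hspan z₀ hz₀ hHz₀ w (mem_of_maximal hz₀ (hz.1.1 w hwz) h) hwH
      rw [h1, Finset.card_sdiff_of_subset, card_submodule, card_submodule, hfin z hz]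
      intro w
      simpa using fun h => hHz h
    · intro w hw
      simp only [S, Z, Finset.coe_filter, Finset.mem_univ, true_and, Set.mem_ofPred_eq] at hw ⊢
      obtain ⟨hs, hw, hw'⟩ := hw
      have hwH : w ∉ H := fun h => hw' (hz₀.1.le_perp (hHz₀ h))
      refine ⟨⟨maximal_of_finrank hD' (hH.sup (iso_span_singleton hs)
        ((Submodule.span_singleton_le_iff_mem _ _).2 hw)) ?_, le_sup_left⟩, ?_⟩
      · rw [finrank_sup_span_singleton hwH, hHD]
      · intro h
        apply hw'
        apply hz₀.1.le_perp
        rw [← h]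
        exact Submodule.mem_sup_right (Submodule.mem_span_singleton_self w)
  have hZ : {z | Maximal P.Iso z ∧ H ≤ z}.ncard = Z.card + 1 := by
    rw [Set.ncard_eq_toFinset_card', ← Finset.card_erase_add_one (a := z₀)]
    · congr 2
      ext z
      simp only [Z, Finset.mem_erase, Set.mem_toFinset, Set.mem_ofPred_eq, Finset.mem_filter,
        Finset.mem_univ, true_and]
      tauto
    · simp [hz₀, hHz₀]
  rw [hZ]
  congr 1
  have d1 := finrank_perp H hH
  have d2 := finrank_perp z₀ hz₀.1
  have d3 := Submodule.finrank_mono hz₀.1.le_perp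
  obtain ⟨m, hm⟩ := Nat.exists_eq_add_of_le (show 2 * D ≤ finrank F U by omega)
  -- Writing `b - 1` as `k + 1` keeps truncated subtraction out of the final comparison.
  obtain ⟨k, hk⟩ : ∃ k, b = k + 1 + 1 := ⟨b - 2, by omega⟩
  have e1 : finrank F (P.perp H) = finrank F H + m + 1 + 1 := by omega
  have e2 : finrank F (P.perp z₀) = finrank F H + m + 1 := by omega
  rw [e1, e2] at hTcard
  have e3 : T.card = b ^ (finrank F H + m + 1) * (k + 1) := by
    have : b ^ (finrank F H + m + 1 + 1) =
        b ^ (finrank F H + m + 1) * (k + 1) + b ^ (finrank F H + m + 1) := by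
      rw [pow_succ _ (finrank F H + m + 1), hk]; ring
    omega
  have e4 : b ^ D - b ^ finrank F H = b ^ finrank F H * (k + 1) := by
    rw [← hHD, pow_succ]
    have : b ^ finrank F H * b = b ^ finrank F H * (k + 1) + b ^ finrank F H := by
      rw [hk]; ring
    omega
  rw [e4] at hSZ
  rw [e3, hSZ] at hTS
  have e5 : finrank F U - 2 * D = m := by omega
  rw [e5]
  have hpos : 0 < b ^ finrank F H * (k + 1) * b := by positivity
  apply Nat.eq_of_mul_eq_mul_right hpos
  linear_combination -hTS

end PolarSpace
end DualPolar

/-! ### Counting hyperplanes; the axioms used for maximal isotropic subspaces -/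

namespace DualPolar

open Module

/-- Annihilators turn hyperplanes into one-dimensional subspaces of the dual, that is, into points
of its projective space. -/
theorem card_hyperplanes {F V : Type*} [Field F] [Finite F] [AddCommGroup V] [Module F V]
    [FiniteDimensional F V] :
    Nat.card {H : Submodule F V // finrank F H + 1 = finrank F V} =
      ∑ i ∈ Finset.range (finrank F V), Nat.card F ^ i := by
  rw [← Projectivization.card_of_finrank F (Dual F V) Subspace.dual_finrank_eq]
  apply Nat.card_congr
  refine Equiv.trans ?_ (Projectivization.equivSubmodule F (Dual F V)).symm
  refine Equiv.subtypeEquiv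
    (Subspace.orderIsoFiniteDimensional.toEquiv.trans OrderDual.ofDual) fun H => ?_
  have h1 := Subspace.finrank_add_finrank_dualAnnihilator_eq H
  change _ ↔ finrank F (Submodule.dualAnnihilator H) = 1
  omega

/-- The number of hyperplanes of `y` containing `K`. -/
theorem ncard_hyperplanes {F U : Type*} [Field F] [Finite F] [AddCommGroup U] [Module F U]
    [FiniteDimensional F U] {K y : Submodule F U} (h : K ≤ y) :
    {H | K ≤ H ∧ H ≤ y ∧ finrank F H + 1 = finrank F y}.ncard =
      ∑ i ∈ Finset.range (finrank F y - finrank F K), Nat.card F ^ i := by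
  let K' : Submodule F y := K.comap y.subtype
  have hK' : finrank F K' = finrank F K := (Submodule.comapSubtypeEquivOfLe h).finrank_eq
  have hq := Submodule.finrank_quotient_add_finrank K'
  have hdim : finrank F (y ⧸ K') = finrank F y - finrank F K := by omega
  rw [← hdim, ← card_hyperplanes]
  let f : Submodule F (y ⧸ K') → Submodule F U := fun H => (H.comap K'.mkQ).map y.subtype
  have hf : Function.Injective f :=
    (Submodule.map_injective_of_injective y.injective_subtype).comp
      (Submodule.comap_injective_of_surjective K'.mkQ_surjective)
  have hfin : ∀ H, finrank F (f H) = finrank F H + finrank F K := by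
    intro H
    have h1 : finrank F (f H) = finrank F (H.comap K'.mkQ) :=
      ((Submodule.equivMapOfInjective _ y.injective_subtype _).finrank_eq).symm
    have h2 := LinearMap.finrank_range_add_finrank_ker
      (K'.mkQ.comp (H.comap K'.mkQ).subtype)
    have h3 : LinearMap.range (K'.mkQ.comp (H.comap K'.mkQ).subtype) = H := by
      rw [LinearMap.range_comp, Submodule.range_subtype,
        Submodule.map_comap_eq_of_surjective K'.mkQ_surjective]
    have h4 : finrank F (LinearMap.ker (K'.mkQ.comp (H.comap K'.mkQ).subtype)) = finrank F K' := by
      rw [LinearMap.ker_comp, Submodule.ker_mkQ]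
      refine (Submodule.comapSubtypeEquivOfLe ?_).finrank_eq
      intro v hv
      rw [Submodule.mem_comap, Submodule.mkQ_apply, (Submodule.Quotient.mk_eq_zero K').2 hv]
      exact H.zero_mem
    rw [h3, h4] at h2
    omega
  have hset : {H | K ≤ H ∧ H ≤ y ∧ finrank F H + 1 = finrank F y} =
      f '' {H | finrank F H + 1 = finrank F (y ⧸ K')} := by
    ext H
    constructor
    · rintro ⟨h1, h2, h3⟩
      have h4 : f ((H.comap y.subtype).map K'.mkQ) = H := by
        have : K' ≤ H.comap y.subtype := Submodule.comap_mono h1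
        simp only [f]
        rw [Submodule.comap_map_mkQ, sup_eq_right.2 this, Submodule.map_comap_subtype,
          inf_eq_right.2 h2]
      refine ⟨_, ?_, h4⟩
      have := hfin ((H.comap y.subtype).map K'.mkQ)
      rw [h4] at this
      change _ + 1 = _
      omega
    · rintro ⟨H, hH, rfl⟩
      refine ⟨?_, Submodule.map_subtype_le _ _, ?_⟩
      · intro v hv
        refine ⟨⟨v, h hv⟩, ?_, rfl⟩
        have : (⟨v, h hv⟩ : y) ∈ K' := hv
        change K'.mkQ _ ∈ H
        rw [Submodule.mkQ_apply, (Submodule.Quotient.mk_eq_zero K').2 this]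
        exact H.zero_mem
      · rw [hfin]
        change _ + 1 = _ at hH
        omega
  rw [hset, Set.ncard_image_of_injective _ hf]
  rfl

/-- The properties of the maximal isotropic subspaces used below: the gate property and the
number of maximal isotropic subspaces through a subspace of codimension one. -/
structure IsDualPolar {F U : Type*} [Field F] [AddCommGroup U] [Module F U]
    (I : Submodule F U → Prop) (D s : ℕ) : Prop where
  mono : ∀ S T, I T → S ≤ T → I S
  finrank_eq : ∀ y, Maximal I y → finrank F y = D
  gate : ∀ y S, Maximal I y → I S → ∃ p, Maximal I p ∧ S ≤ p ∧
    finrank F ↥(p ⊓ y) + finrank F S = D + finrank F ↥(S ⊓ y) ∧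
    ∀ z, Maximal I z → S ≤ z → z ⊓ y ≤ p ⊓ y ∧ (z ⊓ y = p ⊓ y → z = p)
  line : ∀ H, I H → finrank F H + 1 = D → {z | Maximal I z ∧ H ≤ z}.ncard = s + 1

namespace PolarSpace

variable {F U : Type*} [Field F] [Finite F] [AddCommGroup U] [Module F U]
  [FiniteDimensional F U] {P : PolarSpace F U} {D : ℕ}

theorem isDualPolar {κ : ℕ}
    (hκ : ∀ u w, P.sing u → P.B u w ≠ 0 → Nat.card {c : F // P.sing (w + c • u)} = κ)
    (hD : (∃ W, P.Iso W ∧ finrank F W = D) ∧ ∀ W, P.Iso W → finrank F W ≤ D) :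
    IsDualPolar P.Iso D (κ * Nat.card F ^ (finrank F U - 2 * D)) where
  mono _ _ h hle := h.mono hle
  finrank_eq _ hy := finrank_maximal hD.1 hD.2 hy
  gate _ _ hy hS := exists_gate hD.1 hD.2 hy hS
  line _ hH h := ncard_line hκ hD.1 hD.2 hH h

/-- In dimension `2D` or `2D + 1` the upper bound is automatic from `W ≤ W^⊥`, so only the extension
of smaller isotropic subspaces has to be verified for each form. -/
theorem wittIndex (h1 : 2 * D ≤ finrank F U) (h2 : finrank F U ≤ 2 * D + 1)
    (h : ∀ W, P.Iso W → finrank F W < D → ∃ v ∈ P.perp W, P.sing v ∧ v ∉ W) :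
    (∃ W, P.Iso W ∧ finrank F W = D) ∧ ∀ W, P.Iso W → finrank F W ≤ D := by
  constructor
  · suffices ∀ k ≤ D, ∃ W, P.Iso W ∧ finrank F W = k from this D le_rfl
    intro k
    induction k with
    | zero => exact fun _ => ⟨⊥, iso_bot, finrank_bot _ _⟩
    | succ k ih =>
      intro hk
      obtain ⟨W, hW, hWk⟩ := ih (by omega)
      obtain ⟨v, hv, hs, hvW⟩ := h W hW (by omega)
      exact ⟨_, hW.sup (iso_span_singleton hs) ((Submodule.span_singleton_le_iff_mem _ _).2 hv),
        by rw [finrank_sup_span_singleton hvW, hWk]⟩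
  · intro W hW
    have d1 := finrank_perp W hW
    have d2 := Submodule.finrank_mono hW.le_perp
    omega

/-- `W'` stands in for the quotient `W^⊥ / W`: a nonzero singular vector in it enlarges `W`, and its
dimension decides whether such a vector must exist. -/
theorem exists_compl_perp {W : Submodule F U} (hW : P.Iso W) :
    ∃ W', W' ≤ P.perp W ∧ Disjoint W W' ∧ finrank F W' + 2 * finrank F W = finrank F U := by
  obtain ⟨W', hd, hs⟩ := IsModularLattice.exists_disjoint_and_sup_eq hW.le_perp
  refine ⟨W', hs ▸ le_sup_right, hd, ?_⟩
  have h1 := Submodule.finrank_sup_add_finrank_inf_eq W W'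
  rw [hs, hd.eq_bot, finrank_bot] at h1
  have := finrank_perp W hW
  omega

end PolarSpace

/-! ### Symplectic forms -/

section Symplectic

variable {F U : Type*} [Field F] [AddCommGroup U] [Module F U] {D : ℕ}

theorem neg_swap_of_alternating {f : U →ₗ[F] U →ₗ[F] F} (h : ∀ u, f u u = 0) (u v : U) :
    f v u = - f u v := by
  have := h (u + v)
  simp only [map_add, LinearMap.add_apply, h] at this
  linear_combination this

/-- The polar space of a symplectic form. -/
def symplecticSpace (f : U →ₗ[F] U →ₗ[F] F) (hf : IsSymplecticForm f) : PolarSpace F U where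
  σ := RingHom.id F
  B := f
  sing _ := True
  refl u v h := by rw [neg_swap_of_alternating hf.1, h, neg_zero]
  sing_zero := trivial
  sing_smul _ _ _ := trivial
  sing_add _ _ _ _ _ := trivial
  sing_self u _ := hf.1 u
  nondeg u _ h := hf.2 u h

/-- All vectors are singular, so `κ` is the order of the field, and an isotropic subspace that
cannot be enlarged contains its own orthogonal complement. -/
theorem symplectic_isDualPolar [Finite F] [FiniteDimensional F U] (f : U →ₗ[F] U →ₗ[F] F) (hf : IsSymplecticForm f)
    (hn : finrank F U = 2 * D) :
    IsDualPolar (Form.bilinear f).IsIsotropic D (Nat.card F) := by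
  have h1 : (Form.bilinear f).IsIsotropic = (symplecticSpace f hf).Iso := by
    funext W
    exact propext ⟨fun h => ⟨fun _ _ => trivial, h⟩, fun h => h.2⟩
  rw [h1]
  have h2 := PolarSpace.isDualPolar (P := symplecticSpace f hf) (D := D) (κ := Nat.card F)
    (fun u w _ _ => Nat.card_congr (Equiv.subtypeUnivEquiv fun _ => trivial))
    (PolarSpace.wittIndex hn.ge (by omega) fun W hW hWD => by
      by_contra! hcon
      have h3 : (symplecticSpace f hf).perp W ≤ W := fun v hv => hcon v hv trivial
      have := Submodule.finrank_mono h3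
      have := PolarSpace.finrank_perp W hW
      omega)
  simpa [hn] using h2

end Symplectic

/-! ### Quadratic forms -/

section Quadratic

variable {F U : Type*} [Field F] [AddCommGroup U] [Module F U] {D : ℕ}

/-- A quadratic form in at least three variables over a finite field has a nontrivial zero. -/
theorem exists_singular_vector [Finite F] [FiniteDimensional F U]
    (Q : QuadraticForm F U) (h : 3 ≤ finrank F U) :
    ∃ u, u ≠ 0 ∧ Q u = 0 := by
  classical
  let _ : Fintype F := Fintype.ofFinite F
  obtain ⟨B, rfl⟩ := LinearMap.BilinMap.toQuadraticMap_surjective (R := F) Q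
  let u := finBasis F U
  let f : MvPolynomial (Fin (finrank F U)) F :=
    ∑ i, ∑ j, MvPolynomial.C (B (u i) (u j)) * (MvPolynomial.X i * MvPolynomial.X j)
  have hev : ∀ x, MvPolynomial.eval x f = B (∑ i, x i • u i) (∑ i, x i • u i) := by
    intro x
    simp only [f, map_sum, map_mul, MvPolynomial.eval_C, MvPolynomial.eval_X, map_smul,
      LinearMap.sum_apply, LinearMap.smul_apply, smul_eq_mul, Finset.mul_sum]
    rw [Finset.sum_comm]
    exact Finset.sum_congr rfl fun i _ => Finset.sum_congr rfl fun j _ => by ring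
  have hdeg : f.totalDegree ≤ 2 := by
    refine MvPolynomial.totalDegree_finsetSum_le fun i _ =>
      MvPolynomial.totalDegree_finsetSum_le fun j _ => ?_
    refine (MvPolynomial.totalDegree_mul _ _).trans ?_
    rw [MvPolynomial.totalDegree_C, zero_add]
    refine (MvPolynomial.totalDegree_mul _ _).trans ?_
    simp
  obtain ⟨p, hp⟩ := CharP.exists F
  -- Chevalley–Warning: the degree 2 is less than the number of variables, so the characteristic
  -- divides the number of zeros and the trivial zero is not the only one.
  have hdvd := char_dvd_card_solutions p (f := f) (by rw [Fintype.card_fin]; omega)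
  have hpp : p.Prime := (CharP.char_is_prime_or_zero F p).resolve_right
    (CharP.char_ne_zero_of_finite F p)
  have h0 : MvPolynomial.eval 0 f = 0 := by rw [hev]; simp
  have hpos : 0 < Fintype.card {x // MvPolynomial.eval x f = 0} :=
    Fintype.card_pos_iff.2 ⟨⟨0, h0⟩⟩
  have h1 : 1 < Fintype.card {x // MvPolynomial.eval x f = 0} :=
    hpp.one_lt.trans_le (Nat.le_of_dvd hpos hdvd)
  obtain ⟨⟨x, hx⟩, hne⟩ := Fintype.exists_ne_of_one_lt_card h1 ⟨0, h0⟩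
  refine ⟨∑ i, x i • u i, fun h2 => hne ?_, ?_⟩
  · apply Subtype.ext
    funext i
    exact Fintype.linearIndependent_iff.1 u.linearIndependent x h2 i
  · rw [LinearMap.BilinMap.toQuadraticMap_apply, ← hev, hx]

/-- The polar space of a quadratic form. -/
def quadraticSpace (Q : QuadraticForm F U) (hQ : IsNondegenerateQuadratic Q) :
    PolarSpace F U where
  σ := RingHom.id F
  B := Q.polarBilin
  sing u := Q u = 0
  refl u v h := by
    rw [QuadraticMap.polarBilin_apply_apply] at h ⊢
    rw [QuadraticMap.polar_comm, h]
  sing_zero := QuadraticMap.map_zero Q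
  sing_smul a u h := by rw [QuadraticMap.map_smul, h, smul_zero]
  sing_add u v hu hv h := by
    rw [QuadraticMap.polarBilin_apply_apply, QuadraticMap.polar, hu, hv] at h
    simpa using h
  sing_self u hu := by
    rw [QuadraticMap.polarBilin_apply_apply, QuadraticMap.polar_self, hu, smul_zero]
  nondeg u hu h := hQ u hu h

theorem quadratic_iso (Q : QuadraticForm F U) (hQ : IsNondegenerateQuadratic Q) :
    (Form.quadratic Q).IsIsotropic = (quadraticSpace Q hQ).Iso := by
  funext W
  apply propext
  refine ⟨fun h => ⟨h, fun u hu v hv => ?_⟩, fun h => h.1⟩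
  change QuadraticMap.polar Q u v = 0
  rw [QuadraticMap.polar, h _ (W.add_mem hu hv), h u hu, h v hv]
  simp

/-- Along `w + c • u`, with `u` singular and not orthogonal to `w`, the form is affine in `c` with
nonzero slope. So it has exactly one zero, and `κ = 1`. -/
theorem quadratic_isDualPolar [Finite F] [FiniteDimensional F U]
    (Q : QuadraticForm F U) (hQ : IsNondegenerateQuadratic Q)
    (hD : (∃ W, (Form.quadratic Q).IsIsotropic W ∧ finrank F W = D) ∧
      ∀ W, (Form.quadratic Q).IsIsotropic W → finrank F W ≤ D) :
    IsDualPolar (Form.quadratic Q).IsIsotropic D (Nat.card F ^ (finrank F U - 2 * D)) := by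
  rw [quadratic_iso Q hQ] at hD ⊢
  have h2 := PolarSpace.isDualPolar (P := quadraticSpace Q hQ) (D := D) (κ := 1)
    (fun u w hu huw => by
      change QuadraticMap.polar Q u w ≠ 0 at huw
      change Q u = 0 at hu
      rw [Nat.card_eq_one_iff_unique]
      have key : ∀ c : F, Q (w + c • u) = 0 ↔ c = - Q w / QuadraticMap.polar Q u w := by
        intro c
        rw [QuadraticMap.map_add Q, QuadraticMap.map_smul, hu, QuadraticMap.polar_smul_right,
          QuadraticMap.polar_comm, eq_div_iff huw, smul_zero, smul_eq_mul]
        constructor <;> intro h <;> linear_combination h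
      exact ⟨⟨fun a c => Subtype.ext (((key _).1 a.2).trans ((key _).1 c.2).symm)⟩,
        ⟨⟨_, (key _).2 rfl⟩⟩⟩) hD
  simpa using h2

/-- While `dim W < D`, the complement of `W` in `W^⊥` has dimension at least 3 and so contains a
nonzero singular vector. -/
theorem quadratic_wittIndex [Finite F] [FiniteDimensional F U]
    (Q : QuadraticForm F U) (hQ : IsNondegenerateQuadratic Q)
    (hn : finrank F U = 2 * D + 1) :
    (∃ W, (Form.quadratic Q).IsIsotropic W ∧ finrank F W = D) ∧
      ∀ W, (Form.quadratic Q).IsIsotropic W → finrank F W ≤ D := by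
  rw [quadratic_iso Q hQ]
  refine PolarSpace.wittIndex (by omega) hn.le fun W hW hWD => ?_
  obtain ⟨W', h1, h2, h3⟩ := PolarSpace.exists_compl_perp hW
  obtain ⟨v, hv0, hv⟩ := exists_singular_vector (Q.comp W'.subtype) (by omega)
  refine ⟨v, h1 v.2, hv, fun h => hv0 ?_⟩
  exact Subtype.ext ((Submodule.disjoint_def.1 h2) v h v.2)

end Quadratic

/-! ### Hermitean forms -/

section Hermitean

variable {F : Type*} [Field F] {q : ℕ}

/-- Used with `a = 1` to bound the fixed field of the involution and with `a = -1` to bound the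
elements of trace zero. -/
theorem card_roots_le [Fintype F] (hq : 1 < q) (a : F) [DecidablePred fun t : F => t ^ q = a * t] :
    (Finset.univ.filter fun t : F => t ^ q = a * t).card ≤ q := by
  classical
  have hdeg : (Polynomial.C a * Polynomial.X : Polynomial F).degree < (q : WithBot ℕ) :=
    (Polynomial.degree_C_mul_X_le a).trans_lt (by exact_mod_cast hq)
  have hm : (Polynomial.X ^ q - Polynomial.C a * Polynomial.X).Monic :=
    Polynomial.monic_X_pow_sub hdeg
  have hd : (Polynomial.X ^ q - Polynomial.C a * Polynomial.X : Polynomial F).natDegree = q := by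
    apply Polynomial.natDegree_eq_of_degree_eq_some
    rw [Polynomial.degree_sub_eq_left_of_degree_lt] <;> rw [Polynomial.degree_X_pow]
    exact hdeg
  calc _ ≤ (Polynomial.X ^ q - Polynomial.C a * Polynomial.X : Polynomial F).natDegree :=
        Polynomial.card_le_degree_of_subset_roots fun t ht => by
          rw [Finset.mem_val, Finset.mem_filter] at ht
          rw [Polynomial.mem_roots hm.ne_zero]
          simp [ht.2]
    _ = q := hd

variable [Finite F] (hq : Nat.card F = q ^ 2) {σ : F →+* F} (hσ : ∀ a, σ a = a ^ q)

include hq in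
theorem one_lt_of_card_eq_sq : 1 < q := by
  have : 1 < Nat.card F := Finite.one_lt_card
  by_contra hcon
  interval_cases q <;> omega

include hq hσ in
theorem involutive_of_card_eq_sq (a : F) : σ (σ a) = a := by
  let _ : Fintype F := Fintype.ofFinite F
  rw [hσ, hσ, ← pow_mul, ← sq, ← hq, Nat.card_eq_fintype_card, FiniteField.pow_card]

include hq hσ in
/-- The fibres of the trace map onto the fixed field of the involution. -/
theorem card_trace_eq {a : F} (ha : σ a = a) : Nat.card {t : F // t + σ t = a} = q := by
  classical
  let _ : Fintype F := Fintype.ofFinite F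
  have hq1 := one_lt_of_card_eq_sq hq
  have hi := involutive_of_card_eq_sq hq hσ
  let N : F → Finset F := fun a => Finset.univ.filter fun t : F => t + σ t = a
  have hN0 : (N 0).card ≤ q := by
    refine le_trans (Finset.card_le_card ?_) (card_roots_le hq1 (-1 : F))
    intro t ht
    simp only [N, Finset.mem_filter, Finset.mem_univ, true_and] at ht ⊢
    rw [← hσ]; linear_combination ht
  have hN : ∀ a, (N a).card ≤ (N 0).card := by
    intro a
    rcases (N a).eq_empty_or_nonempty with h | ⟨t₀, ht₀⟩
    · simp [h]
    · refine Finset.card_le_card_of_injOn (fun t => t - t₀) ?_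
        (fun _ _ _ _ h => sub_left_injective h)
      intro t ht
      simp only [N, Finset.coe_filter, Finset.mem_univ, true_and, Set.mem_ofPred_eq,
        Finset.mem_filter, map_sub] at ht ht₀ ⊢
      linear_combination ht - ht₀
  let Fix : Finset F := Finset.univ.filter fun t : F => t ^ q = 1 * t
  have hFix : Fix.card ≤ q := card_roots_le hq1 1
  -- The trace takes values in `Fix`. Since `Fix` has at most `q` elements and each fibre at most
  -- `q`, a total of `q ^ 2` leaves no room for a smaller fibre over `Fix`.
  have hsum : ∑ a ∈ Fix, (N a).card = q ^ 2 := by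
    rw [← hq, Nat.card_eq_fintype_card, ← Finset.card_univ,
      Finset.card_eq_sum_card_fiberwise (f := fun t => t + σ t) (t := Fix)]
    intro t _
    simp only [Fix, Finset.coe_filter, Finset.mem_univ, true_and, Set.mem_ofPred_eq, one_mul]
    rw [← hσ, map_add, hi, add_comm]
  have haF : a ∈ Fix := by
    simp only [Fix, Finset.mem_filter, Finset.mem_univ, true_and, one_mul]
    rw [← hσ, ha]
  have hcard : Nat.card {t : F // t + σ t = a} = (N a).card := by
    rw [Nat.card_eq_fintype_card, Fintype.card_subtype]
  rw [hcard]
  apply le_antisymm ((hN a).trans hN0)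
  by_contra hlt
  have h1 : ∑ a ∈ Fix, (N a).card < ∑ a ∈ Fix, q :=
    Finset.sum_lt_sum (fun i _ => (hN i).trans hN0) ⟨a, haF, by omega⟩
  rw [hsum, Finset.sum_const, smul_eq_mul, sq] at h1
  exact absurd (Nat.mul_le_mul_right q hFix) (by omega)

include hq hσ in
/-- The norm map is onto the fixed field of the involution. -/
theorem exists_norm_eq {a : F} (ha : σ a = a) : ∃ c, c * σ c = a := by
  classical
  let _ : Fintype F := Fintype.ofFinite F
  have hq1 := one_lt_of_card_eq_sq hq
  rcases eq_or_ne a 0 with rfl | ha0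
  · exact ⟨0, by simp⟩
  obtain ⟨g, hg⟩ := IsCyclic.exists_generator (α := Fˣ)
  obtain ⟨k, hk⟩ := (IsOfFinOrder.mem_powers_iff_mem_zpowers (isOfFinOrder_of_finite g)).2
    (hg (Units.mk0 a ha0))
  have ho : orderOf g = q ^ 2 - 1 := by
    rw [orderOf_eq_card_of_forall_mem_zpowers hg, Nat.card_units, hq]
  -- A fixed element satisfies `a ^ (q - 1) = 1`. As `g` has order `(q + 1) * (q - 1)`, the exponent
  -- of `a` is divisible by `q + 1`, and `t ^ (q + 1)` is the norm of `t`.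
  have h1 : g ^ (k * (q - 1)) = 1 := by
    rw [pow_mul]
    simp only at hk
    rw [hk]
    apply Units.ext
    have h2 : a ^ (q - 1) * a = 1 * a := by
      rw [← pow_succ, Nat.sub_add_cancel hq1.le, ← hσ, ha, one_mul]
    simpa using mul_right_cancel₀ ha0 h2
  have h2 : q ^ 2 - 1 = (q + 1) * (q - 1) := by
    have := Nat.sq_sub_sq q 1
    simpa using this
  rw [← orderOf_dvd_iff_pow_eq_one, ho, h2] at h1
  obtain ⟨m, rfl⟩ := Nat.dvd_of_mul_dvd_mul_right (by omega) h1
  refine ⟨((g ^ m : Fˣ) : F), ?_⟩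
  rw [hσ, ← pow_succ', ← Units.val_pow_eq_pow_val, ← pow_mul, mul_comm m]
  simp only at hk
  rw [hk]
  rfl

variable {U : Type*} [AddCommGroup U] [Module F U] {D : ℕ}

/-- The polar space of a Hermitean form. -/
def hermiteanSpace (h : U →ₛₗ[σ] U →ₗ[F] F) (hh : IsHermiteanForm σ h) : PolarSpace F U where
  σ := σ
  B := h
  sing u := h u u = 0
  refl u v huv := by rw [hh.2.1, huv, map_zero]
  sing_zero := by simp
  sing_smul a u hu := by
    rw [map_smul, LinearMap.map_smulₛₗ, LinearMap.smul_apply, hu, smul_zero, smul_zero]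
  sing_add u v hu hv huv := by
    simp [hu, hv, huv, hh.2.1 u v]
  sing_self u hu := hu
  nondeg u _ hu := hh.2.2 u hu

theorem hermitean_isDualPolar [FiniteDimensional F U] (h : U →ₛₗ[σ] U →ₗ[F] F)
    (hh : IsHermiteanForm σ h) (hn : 2 * D ≤ finrank F U) (hn' : finrank F U ≤ 2 * D + 1) :
    ∃ q, Nat.card F = q ^ 2 ∧ IsDualPolar (Form.sesquilinear σ h).IsIsotropic D
      (q * Nat.card F ^ (finrank F U - 2 * D)) := by
  obtain ⟨q, hq, hσ⟩ := hh.1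
  have hi := involutive_of_card_eq_sq hq hσ
  refine ⟨q, hq, ?_⟩
  have h1 : (Form.sesquilinear σ h).IsIsotropic = (hermiteanSpace h hh).Iso := by
    funext W
    exact propext ⟨fun h => ⟨fun u hu => h u hu u hu, h⟩, fun h => h.2⟩
  rw [h1]
  refine PolarSpace.isDualPolar (fun u w hu huw => ?_)
    (PolarSpace.wittIndex hn hn' fun W hW hWD => ?_)
  · change h u w ≠ 0 at huw
    change h u u = 0 at hu
    have huw' : h w u ≠ 0 := by
      rw [hh.2.1 u w]
      exact (map_ne_zero σ).2 huw
    have hw : σ (-h w w) = - h w w := by rw [map_neg, ← hh.2.1]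
    -- Singularity of `w + c • u` prescribes the trace of `h w u * c`, whence `κ = q`.
    rw [← card_trace_eq hq hσ hw]
    refine Nat.card_congr (Equiv.subtypeEquiv (Equiv.mulLeft₀ _ huw') fun c => ?_)
    change h (w + c • u) (w + c • u) = 0 ↔ h w u * c + σ (h w u * c) = - h w w
    have : h (w + c • u) (w + c • u) = h w w + (h w u * c + σ (h w u * c)) := by
      simp only [map_add, LinearMap.add_apply, LinearMap.map_smulₛₗ, LinearMap.smul_apply,
        map_smul, hu, map_mul, smul_eq_mul, ← hh.2.1 w u]
      ring
    rw [this]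
    constructor <;> intro h3 <;> linear_combination h3
  · obtain ⟨W', h1, h2, h3⟩ := PolarSpace.exists_compl_perp hW
    have hnt : 1 < finrank F W' := by omega
    let e := finBasis F W'
    let i₀ : Fin (finrank F W') := ⟨0, by omega⟩
    let i₁ : Fin (finrank F W') := ⟨1, hnt⟩
    have hne : i₁ ≠ i₀ := by simp [i₀, i₁]
    suffices ∃ v : W', v ≠ 0 ∧ h v v = 0 by
      obtain ⟨v, hv0, hv⟩ := this
      exact ⟨v, h1 v.2, hv, fun h3 => hv0
        (Subtype.ext ((Submodule.disjoint_def.1 h2) v h3 v.2))⟩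
    -- Two dimensions suffice. If `u` is not isotropic, make `w'` orthogonal to it; then `w' + c •
    -- u` is isotropic as soon as the norm of `c` is `-h w' w' / h u u`, and the norm map is onto
    -- the fixed field.
    by_cases hu : h (e i₀) (e i₀) = 0
    · exact ⟨e i₀, e.ne_zero _, hu⟩
    · set u : U := ((e i₀ : W') : U)
      set w : U := ((e i₁ : W') : U)
      have hfix : ∀ v, σ (h v v) = h v v := fun v => (hh.2.1 v v).symm
      set a := h u w / h u u with ha
      let w' : U := w - a • u
      have hw1 : h u w' = 0 := by
        simp only [w', map_sub, map_smul, smul_eq_mul, ha]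
        field_simp
        ring
      have hw2 : h w' u = 0 := by rw [hh.2.1 u w', hw1, map_zero]
      obtain ⟨c, hc⟩ := exists_norm_eq hq hσ (a := - h w' w' / h u u) (by
        rw [map_div₀, map_neg, hfix, hfix])
      refine ⟨e i₁ + (c - a) • e i₀, fun h0 => ?_, ?_⟩
      · have := congrArg (fun v => e.repr v i₁) h0
        simp [hne.symm] at this
      · have hv : ((e i₁ + (c - a) • e i₀ : W') : U) = w' + c • u := by
          simp only [Submodule.coe_add, Submodule.coe_smul, w', u, w]
          module
        rw [hv]
        simp only [map_add, LinearMap.add_apply, LinearMap.map_smulₛₗ, LinearMap.smul_apply,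
          map_smul, smul_eq_mul, hw1, hw2]
        field_simp at hc
        linear_combination hc

end Hermitean
end DualPolar

/-! ### The line size of each family -/

namespace DualPolar

open Module

theorem rpow_three_half {q b : ℕ} (h : b = q ^ 2) : (b : ℝ) ^ (3 / 2 : ℝ) = q ^ 3 := by
  rw [h, Nat.cast_pow, ← Real.rpow_natCast, ← Real.rpow_mul (by positivity),
    ← Real.rpow_natCast]
  norm_num

theorem rpow_one_half {q b : ℕ} (h : b = q ^ 2) : (b : ℝ) ^ (1 / 2 : ℝ) = q := by
  rw [h, Nat.cast_pow, ← Real.rpow_natCast, ← Real.rpow_mul (by positivity)]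
  norm_num

/-- `Module.finrank` is zero in infinite dimension, so a prescribed positive value already forces
finite dimension. -/
theorem Form.IsOfFamily.finiteDimensional {F U : Type*} [Field F] [AddCommGroup U] [Module F U]
    {P : Form F U} {fam : Family} {D : ℕ} (hD : 0 < D) (hP : P.IsOfFamily fam D) :
    FiniteDimensional F U := by
  apply Module.finite_of_finrank_pos
  cases P <;> cases fam <;> simp only [Form.IsOfFamily] at hP <;> omega

/-- Every form of the six families gives a dual polar space whose lines have `b ^ e + 1` points. -/
theorem Form.IsOfFamily.isDualPolar {F U : Type*} [Field F] [Finite F] [AddCommGroup U]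
    [Module F U] {P : Form F U} {fam : Family} {D : ℕ} (hD : 0 < D) (hP : P.IsOfFamily fam D) :
    ∃ s : ℕ, (s : ℝ) = (Nat.card F : ℝ) ^ fam.e ∧ IsDualPolar P.IsIsotropic D s := by
  have := hP.finiteDimensional hD
  -- The number `κ * b ^ (dim U - 2D)` is `b`, `b`, `1`, `b ^ 2`, `q * b`, `q` for the six families
  -- in the order of `Family`; this is `b ^ e` each time.
  cases P with
  | bilinear f =>
    cases fam <;> simp only [Form.IsOfFamily] at hP
    exact ⟨_, by simp [Family.e], symplectic_isDualPolar f hP.1 hP.2⟩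
  | quadratic Q =>
    have key : ∀ W : Form.HasWittIndex (.quadratic Q) D,
        (∃ W, (Form.quadratic Q).IsIsotropic W ∧ finrank F W = D) ∧
        ∀ W, (Form.quadratic Q).IsIsotropic W → finrank F W ≤ D :=
      fun W => ⟨W.1, fun V hV => W.2 ⟨V, hV, rfl⟩⟩
    cases fam <;> simp only [Form.IsOfFamily] at hP
    · refine ⟨_, ?_, quadratic_isDualPolar Q hP.1 (quadratic_wittIndex Q hP.1 hP.2)⟩
      rw [hP.2]; simp [Family.e]
    · refine ⟨_, ?_, quadratic_isDualPolar Q hP.1 (key hP.2.2)⟩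
      rw [hP.2.1]; simp [Family.e]
    · refine ⟨_, ?_, quadratic_isDualPolar Q hP.1 (key hP.2.2)⟩
      rw [hP.2.1]; simp [Family.e]
  | sesquilinear σ h =>
    cases fam <;> simp only [Form.IsOfFamily] at hP
    · obtain ⟨q, hq, hI⟩ := hermitean_isDualPolar h hP.1 (D := D) (by omega) (by omega)
      refine ⟨_, ?_, hI⟩
      rw [hP.2, Family.e, rpow_three_half hq, hq]
      simp; ring
    · obtain ⟨q, hq, hI⟩ := hermitean_isDualPolar h hP.1 (D := D) (by omega) (by omega)
      refine ⟨_, ?_, hI⟩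
      rw [hP.2, Family.e, rpow_one_half hq]
      simp

end DualPolar

/-! ### Vertices, lines, and neighbours sorted by the dimension of the meet -/

namespace DualPolar

open Module

section Combinatorics

variable {F U : Type*} [Field F] [AddCommGroup U] [Module F U] {P : Form F U}

/-- The dimension of the intersection of two vertices. -/
def meetDim (y z : Vertex P) : ℕ := finrank F ↥(y.1 ⊓ z.1)

theorem meetDim_comm (y z : Vertex P) : meetDim y z = meetDim z y := by
  rw [meetDim, meetDim, inf_comm]

variable [FiniteDimensional F U] {D s : ℕ}

namespace IsDualPolar

variable (hI : IsDualPolar P.IsIsotropic D s)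

include hI

theorem finrank_vertex (y : Vertex P) : finrank F y.1 = D := hI.finrank_eq _ y.2

theorem meetDim_self (y : Vertex P) : meetDim y y = D := by
  rw [meetDim, inf_idem, hI.finrank_vertex]

theorem meetDim_le (y z : Vertex P) : meetDim y z ≤ D := by
  rw [← hI.finrank_vertex y]
  exact Submodule.finrank_mono inf_le_left

theorem meetDim_eq_iff {y z : Vertex P} : meetDim y z = D ↔ y = z := by
  constructor
  · intro h
    have h1 : y.1 ⊓ z.1 = y.1 := Submodule.eq_of_le_of_finrank_eq inf_le_left
      (by rw [hI.finrank_vertex]; exact h)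
    have h2 : y.1 ⊓ z.1 = z.1 := Submodule.eq_of_le_of_finrank_eq inf_le_right
      (by rw [hI.finrank_vertex]; exact h)
    exact Subtype.ext (h1.symm.trans h2)
  · rintro rfl
    exact hI.meetDim_self y

theorem adj_iff {y z : Vertex P} : (graph P D).Adj y z ↔ meetDim y z + 1 = D := by
  refine ⟨fun h => h.2, fun h => ⟨?_, h⟩⟩
  rintro rfl
  rw [hI.meetDim_self] at h
  omega

theorem inf_eq_of_le {H : Submodule F U} (hH : finrank F H + 1 = D) {y z : Vertex P}
    (hy : H ≤ y.1) (hz : H ≤ z.1) (hne : y ≠ z) : y.1 ⊓ z.1 = H := by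
  refine (Submodule.eq_of_le_of_finrank_le (le_inf hy hz) ?_).symm
  have h1 := hI.meetDim_le y z
  have h2 : meetDim y z ≠ D := fun h => hne (hI.meetDim_eq_iff.1 h)
  change meetDim y z ≤ _
  omega

theorem adj_of_le {H : Submodule F U} (hH : finrank F H + 1 = D) {y z : Vertex P}
    (hy : H ≤ y.1) (hz : H ≤ z.1) (hne : y ≠ z) : (graph P D).Adj y z := by
  rw [hI.adj_iff, meetDim, hI.inf_eq_of_le hH hy hz hne, hH]

/-- Two subspaces of a vertex meet in at least the expected dimension. -/
theorem finrank_add_le (y : Vertex P) {S T : Submodule F U} (hS : S ≤ y.1) (hT : T ≤ y.1) :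
    finrank F S + finrank F T ≤ D + finrank F ↥(S ⊓ T) := by
  rw [← Submodule.finrank_sup_add_finrank_inf_eq, ← hI.finrank_vertex y]
  exact Nat.add_le_add_right (Submodule.finrank_mono (sup_le hS hT)) _

/-- Inside `y`, intersecting `y ⊓ x` with the hyperplane `y ⊓ z` loses at most one dimension. -/
theorem meetDim_le_of_adj {y z : Vertex P} (h : (graph P D).Adj y z) (x : Vertex P) :
    meetDim y x ≤ meetDim z x + 1 := by
  have h1 := hI.finrank_add_le y (S := y.1 ⊓ z.1) (T := y.1 ⊓ x.1) inf_le_left inf_le_left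
  have h2 : finrank F ↥(y.1 ⊓ z.1 ⊓ (y.1 ⊓ x.1)) ≤ meetDim z x :=
    Submodule.finrank_mono (inf_le_inf inf_le_right inf_le_right)
  have h3 := hI.adj_iff.1 h
  rw [meetDim] at h3
  change _ + meetDim y x ≤ _ at h1
  omega

theorem iso_of_le {y : Vertex P} {S : Submodule F U} (h : S ≤ y.1) : P.IsIsotropic S :=
  hI.mono _ _ y.2.1 h

/-- The unique vertex of a line nearest to a given vertex. -/
theorem exists_nearest {H : Submodule F U} (hiso : P.IsIsotropic H) (hH : finrank F H + 1 = D)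
    (x : Vertex P) : ∃ p : Vertex P, H ≤ p.1 ∧ meetDim p x = finrank F ↥(H ⊓ x.1) + 1 ∧
      ∀ z : Vertex P, H ≤ z.1 → z ≠ p → meetDim z x = finrank F ↥(H ⊓ x.1) := by
  obtain ⟨p, hp, hHp, hpx, hmax⟩ := hI.gate _ _ x.2 hiso
  have h1 : meetDim (⟨p, hp⟩ : Vertex P) x = finrank F ↥(H ⊓ x.1) + 1 := by
    rw [meetDim]
    change finrank F ↥(p ⊓ x.1) = _
    omega
  refine ⟨⟨p, hp⟩, hHp, h1, fun z hz hne => ?_⟩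
  obtain ⟨h2, h3⟩ := hmax z.1 z.2 hz
  have h4 := Submodule.finrank_mono h2
  have h5 : finrank F ↥(z.1 ⊓ x.1) ≠ finrank F ↥(p ⊓ x.1) := fun h =>
    hne (Subtype.ext (h3 (Submodule.eq_of_le_of_finrank_eq h2 h)))
  have h6 : finrank F ↥(H ⊓ x.1) ≤ finrank F ↥(z.1 ⊓ x.1) :=
    Submodule.finrank_mono (inf_le_inf hz le_rfl)
  rw [meetDim]
  omega

theorem ncard_line_vertex {H : Submodule F U} (hiso : P.IsIsotropic H)
    (hH : finrank F H + 1 = D) : {z : Vertex P | H ≤ z.1}.ncard = s + 1 := by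
  rw [← hI.line H hiso hH, ← Set.ncard_image_of_injective _ Subtype.val_injective]
  congr 1
  ext z
  constructor
  · rintro ⟨z, hz, rfl⟩
    exact ⟨z.2, hz⟩
  · rintro ⟨hz, h⟩
    exact ⟨⟨z, hz⟩, h, rfl⟩

/-- Three mutually adjacent vertices lie on a line. -/
theorem inf_le_of_triangle {y z w : Vertex P} (hyz : (graph P D).Adj y z)
    (hyw : (graph P D).Adj y w) (hzw : (graph P D).Adj z w) : y.1 ⊓ z.1 ≤ w.1 := by
  have a1 := hI.adj_iff.1 hyz
  have a2 := hI.adj_iff.1 hyw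
  have a3 := hI.adj_iff.1 hzw
  rw [meetDim_comm] at a3
  by_contra hcon
  -- If `w` did not contain `y ⊓ z`, both `y` and `w` would be nearest to `z` on the line `y ⊓ w`,
  -- against uniqueness.
  obtain ⟨p, hp, hpz, hother⟩ := hI.exists_nearest
    (hI.iso_of_le (y := w) (S := y.1 ⊓ w.1) inf_le_right) a2 z
  have h1 : finrank F ↥(y.1 ⊓ w.1 ⊓ z.1) + 1 < D := by
    have hle : y.1 ⊓ w.1 ⊓ z.1 ≤ y.1 ⊓ z.1 := inf_le_inf inf_le_left le_rfl
    have h2 := Submodule.finrank_mono hle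
    have h3 : finrank F ↥(y.1 ⊓ w.1 ⊓ z.1) ≠ finrank F ↥(y.1 ⊓ z.1) := by
      intro h
      apply hcon
      rw [← Submodule.eq_of_le_of_finrank_eq hle h]
      exact inf_le_left.trans inf_le_right
    rw [meetDim] at a1
    omega
  have h2 : y = p := by
    by_contra hne
    have := hother y inf_le_left hne
    omega
  have h3 : w = p := by
    by_contra hne
    have := hother w inf_le_right hne
    omega
  exact hyw.1 (h2.trans h3.symm)

end IsDualPolar

/-- The number of neighbours `w` of `y` with `meetDim w z = m`, when `meetDim y z = k`. -/
def nbCount (b s D m k : ℕ) : ℕ :=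
  (∑ i ∈ Finset.range (D - k), b ^ i) * (if m = k + 1 then 1 else if m = k then s - 1 else 0) +
  (∑ i ∈ Finset.range D, b ^ i - ∑ i ∈ Finset.range (D - k), b ^ i) *
    (if m + 1 = k then s else 0)

namespace IsDualPolar

variable [Finite F]

open Classical in
/-- The hyperplanes of `y` containing `K`. -/
def hyp (F : Type*) {U : Type*} [Field F] [Finite F] [AddCommGroup U] [Module F U]
    [FiniteDimensional F U] (K y : Submodule F U) : Finset (Submodule F U) :=
  haveI : Finite U := Module.finite_of_finite F
  (Set.toFinite {H | K ≤ H ∧ H ≤ y ∧ finrank F H + 1 = finrank F y}).toFinset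

theorem mem_hyp {K y H : Submodule F U} :
    H ∈ hyp F K y ↔ K ≤ H ∧ H ≤ y ∧ finrank F H + 1 = finrank F y := by
  simp [hyp]

theorem card_hyp {K y : Submodule F U} (h : K ≤ y) :
    (hyp F K y).card = ∑ i ∈ Finset.range (finrank F y - finrank F K), Nat.card F ^ i := by
  rw [← ncard_hyperplanes h, hyp]
  exact (Set.ncard_eq_toFinset_card _ _).symm

theorem filter_hyp {K y : Submodule F U} [DecidablePred fun H : Submodule F U => K ≤ H] :
    (hyp F ⊥ y).filter (K ≤ ·) = hyp F K y := by
  ext H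
  simp only [Finset.mem_filter, mem_hyp, bot_le, true_and]
  tauto

variable (hI : IsDualPolar P.IsIsotropic D s)

include hI

/-- The neighbours of `y`, sorted by lines. -/
theorem card_neighbors [Fintype (Vertex P)] (y : Vertex P) (p : Vertex P → Prop)
    [DecidablePred p] [DecidableRel (graph P D).Adj]
    [∀ H : Submodule F U, DecidablePred fun w : Vertex P => H ≤ w.1 ∧ w ≠ y ∧ p w] :
    (Finset.univ.filter fun w => (graph P D).Adj y w ∧ p w).card =
      ∑ H ∈ hyp F ⊥ y.1, (Finset.univ.filter fun w : Vertex P => H ≤ w.1 ∧ w ≠ y ∧ p w).card := by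
  classical
  rw [Finset.card_eq_sum_card_fiberwise (f := fun w : Vertex P => y.1 ⊓ w.1) (t := hyp F ⊥ y.1)]
  · refine Finset.sum_congr rfl fun H hH => ?_
    obtain ⟨-, hHy, hHD⟩ := mem_hyp.1 hH
    rw [hI.finrank_vertex] at hHD
    congr 1
    ext w
    simp only [Finset.mem_filter, Finset.mem_univ, true_and]
    constructor
    · rintro ⟨⟨h1, h2⟩, rfl⟩
      exact ⟨inf_le_right, h1.1.symm, h2⟩
    · rintro ⟨h1, h2, h3⟩
      exact ⟨⟨hI.adj_of_le hHD hHy h1 h2.symm, h3⟩, hI.inf_eq_of_le hHD hHy h1 h2.symm⟩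
  · intro w hw
    simp only [Finset.coe_filter, Finset.mem_univ, true_and, Set.mem_ofPred_eq] at hw
    exact mem_hyp.2 ⟨bot_le, inf_le_left, by rw [hI.finrank_vertex]; exact hI.adj_iff.1 hw.1⟩

theorem card_line_filter [Fintype (Vertex P)] {H : Submodule F U} (hiso : P.IsIsotropic H)
    (hH : finrank F H + 1 = D) [DecidablePred fun w : Vertex P => H ≤ w.1] :
    (Finset.univ.filter fun w : Vertex P => H ≤ w.1).card = s + 1 := by
  rw [← hI.ncard_line_vertex hiso hH, Set.ncard_eq_toFinset_card']
  congr 1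
  ext; simp

open Classical in
-- Neighbours are sorted by the line `H = y ⊓ w`. If `H` contains `y ⊓ z`, the point of `H` nearest
-- to `z` is one step closer than `y`, and the `s - 1` points other than it and `y` are level with
-- `y`. Otherwise `y` is itself nearest, and the other `s` points are one step farther. Lines of the
-- first kind are the hyperplanes of `y` over `y ⊓ z`.
theorem card_neighbors_meetDim [Fintype (Vertex P)] (y z : Vertex P) (m : ℕ) :
    (Finset.univ.filter fun w => (graph P D).Adj y w ∧ meetDim w z = m).card =
      nbCount (Nat.card F) s D m (meetDim y z) := by
  set k := meetDim y z with hk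
  rw [hI.card_neighbors]
  have key : ∀ H ∈ hyp F ⊥ y.1,
      (Finset.univ.filter fun w : Vertex P => H ≤ w.1 ∧ w ≠ y ∧ meetDim w z = m).card =
      if y.1 ⊓ z.1 ≤ H then (if m = k + 1 then 1 else if m = k then s - 1 else 0)
      else (if m + 1 = k then s else 0) := by
    intro H hH
    obtain ⟨-, hHy, hHD⟩ := mem_hyp.1 hH
    rw [hI.finrank_vertex] at hHD
    have hiso := hI.iso_of_le hHy
    obtain ⟨p, hp, hpz, hother⟩ := hI.exists_nearest hiso hHD z
    have hline := hI.card_line_filter hiso hHD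
    have hle : H ⊓ z.1 ≤ y.1 ⊓ z.1 := inf_le_inf hHy le_rfl
    split_ifs with hK h1 h2 h3
    · have hHz : H ⊓ z.1 = y.1 ⊓ z.1 := le_antisymm hle (le_inf hK inf_le_right)
      rw [hHz] at hpz hother
      change meetDim p z = k + 1 at hpz
      change ∀ w : Vertex P, H ≤ w.1 → w ≠ p → meetDim w z = k at hother
      rw [Finset.card_eq_one]
      refine ⟨p, ?_⟩
      ext w
      simp only [Finset.mem_filter, Finset.mem_univ, true_and, Finset.mem_singleton]
      constructor
      · rintro ⟨a, -, c⟩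
        by_contra hne
        have := hother w a hne
        omega
      · rintro rfl
        refine ⟨hp, ?_, by omega⟩
        rintro rfl
        omega
    · have hHz : H ⊓ z.1 = y.1 ⊓ z.1 := le_antisymm hle (le_inf hK inf_le_right)
      rw [hHz] at hpz hother
      change meetDim p z = k + 1 at hpz
      change ∀ w : Vertex P, H ≤ w.1 → w ≠ p → meetDim w z = k at hother
      have hpy : p ≠ y := by
        rintro rfl
        omega
      have : (Finset.univ.filter fun w : Vertex P => H ≤ w.1 ∧ w ≠ y ∧ meetDim w z = m) =
          ((Finset.univ.filter fun w : Vertex P => H ≤ w.1).erase y).erase p := by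
        ext w
        simp only [Finset.mem_filter, Finset.mem_univ, true_and, Finset.mem_erase]
        constructor
        · rintro ⟨a, b, c⟩
          refine ⟨?_, b, a⟩
          rintro rfl
          omega
        · rintro ⟨a, b, c⟩
          exact ⟨c, b, by rw [hother w c a, h2]⟩
      rw [this, Finset.card_erase_of_mem, Finset.card_erase_of_mem, hline]
      · omega
      · simpa using hHy
      · simp [hpy, hp]
    · have hHz : H ⊓ z.1 = y.1 ⊓ z.1 := le_antisymm hle (le_inf hK inf_le_right)
      rw [hHz] at hpz hother
      change meetDim p z = k + 1 at hpz
      change ∀ w : Vertex P, H ≤ w.1 → w ≠ p → meetDim w z = k at hother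
      rw [Finset.card_eq_zero, Finset.filter_eq_empty_iff]
      rintro w - ⟨a, b, c⟩
      by_cases hwp : w = p
      · rw [hwp] at c; omega
      · have := hother w a hwp; omega
    all_goals
      have hlt : finrank F ↥(H ⊓ z.1) < k := by
        refine lt_of_le_of_ne (Submodule.finrank_mono hle) fun h => hK ?_
        rw [← Submodule.eq_of_le_of_finrank_eq hle h]
        exact inf_le_left
      have hpy : y = p := by
        by_contra hne
        have := hother y hHy hne
        omega
      subst hpy
    · have : (Finset.univ.filter fun w : Vertex P => H ≤ w.1 ∧ w ≠ y ∧ meetDim w z = m) =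
          (Finset.univ.filter fun w : Vertex P => H ≤ w.1).erase y := by
        ext w
        simp only [Finset.mem_filter, Finset.mem_univ, true_and, Finset.mem_erase]
        constructor
        · rintro ⟨a, b, c⟩
          exact ⟨b, a⟩
        · rintro ⟨b, c⟩
          exact ⟨c, b, by have := hother w c b; omega⟩
      rw [this, Finset.card_erase_of_mem (by simpa using hHy), hline]
      omega
    · rw [Finset.card_eq_zero, Finset.filter_eq_empty_iff]
      rintro w - ⟨a, b, c⟩
      have := hother w a b
      omega
  rw [Finset.sum_congr rfl key, Finset.sum_ite, Finset.sum_const, Finset.sum_const, smul_eq_mul,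
    smul_eq_mul, filter_hyp, card_hyp inf_le_left]
  have h2 := Finset.card_filter_add_card_filter_not (s := hyp F ⊥ y.1) (fun H => y.1 ⊓ z.1 ≤ H)
  rw [filter_hyp, card_hyp inf_le_left, card_hyp bot_le, finrank_bot, hI.finrank_vertex] at h2
  rw [hI.finrank_vertex, nbCount]
  change (∑ i ∈ Finset.range (D - k), _) * _ + _ = _
  change ∑ i ∈ Finset.range (D - k), _ + _ = _ at h2
  congr 2
  rw [Nat.sub_zero] at h2
  omega

end IsDualPolar
end Combinatorics
end DualPolar

/-! ### Common neighbours of two vertices -/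

namespace DualPolar

open Module

namespace IsDualPolar

variable {F U : Type*} [Field F] [AddCommGroup U] [Module F U] {P : Form F U}
  [FiniteDimensional F U] {D s : ℕ} [Finite F] (hI : IsDualPolar P.IsIsotropic D s)

/-- The common neighbours of two adjacent vertices. -/
theorem common_neighbors_adj (hI : IsDualPolar P.IsIsotropic D s) {y z : Vertex P}
    (h : (graph P D).Adj y z) (w : Vertex P) :
    (graph P D).Adj y w ∧ (graph P D).Adj w z ↔ y.1 ⊓ z.1 ≤ w.1 ∧ w ≠ y ∧ w ≠ z := by
  constructor
  · rintro ⟨h1, h2⟩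
    exact ⟨hI.inf_le_of_triangle h h1 h2.symm, h1.1.symm, h2.1⟩
  · rintro ⟨h1, h2, h3⟩
    have hD := hI.adj_iff.1 h
    exact ⟨hI.adj_of_le hD inf_le_left h1 h2.symm, hI.adj_of_le hD h1 inf_le_right h3⟩

include hI

open Classical in
theorem card_common_neighbors_adj [Fintype (Vertex P)] {y z : Vertex P}
    (h : (graph P D).Adj y z) :
    (Finset.univ.filter fun w => (graph P D).Adj y w ∧ (graph P D).Adj w z).card = s - 1 := by
  have hD := hI.adj_iff.1 h
  have : (Finset.univ.filter fun w => (graph P D).Adj y w ∧ (graph P D).Adj w z) =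
      ((Finset.univ.filter fun w : Vertex P => y.1 ⊓ z.1 ≤ w.1).erase y).erase z := by
    ext w
    simp only [Finset.mem_filter, Finset.mem_univ, true_and, Finset.mem_erase,
      hI.common_neighbors_adj h]
    tauto
  rw [this, Finset.card_erase_of_mem, Finset.card_erase_of_mem,
    hI.card_line_filter (hI.iso_of_le (y := y) inf_le_left) hD]
  · omega
  · simp
  · simp [h.1.symm]

/-- If `z` is farther from `x` than its neighbour `y`, so are all common neighbours. -/
theorem meetDim_common_neighbor {x y z w : Vertex P} (h : (graph P D).Adj y z)
    (hx : meetDim y x = meetDim z x + 1) (hyw : (graph P D).Adj y w)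
    (hwz : (graph P D).Adj w z) : meetDim w x = meetDim z x := by
  have hD := hI.adj_iff.1 h
  obtain ⟨h1, h2, -⟩ := (hI.common_neighbors_adj h w).1 ⟨hyw, hwz⟩
  obtain ⟨p, -, hpx, hother⟩ :=
    hI.exists_nearest (hI.iso_of_le (y := y) inf_le_left) hD x
  have hp : y = p := by
    by_contra hne
    have := hother y inf_le_left hne
    by_cases hzp : z = p
    · subst hzp; omega
    · have := hother z inf_le_right hzp
      omega
  subst hp
  have h3 := hother w h1 h2
  have h4 := hother z inf_le_right h.1.symm
  omega

open Classical in
/-- The common neighbours of two vertices `y`, `z` at distance two, where `z` is one step farther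
from `x` than `y`: one of them is at the distance of `y`, and `b` at the distance of `z`. -/
theorem card_common_neighbors_two [Fintype (Vertex P)] {x y z : Vertex P}
    (hyz : meetDim y z + 2 = D) (hx : meetDim y x = meetDim z x + 1) :
    (Finset.univ.filter fun w => (graph P D).Adj y w ∧
      ((graph P D).Adj w z ∧ meetDim w x = meetDim y x)).card = 1 ∧
    (Finset.univ.filter fun w => (graph P D).Adj y w ∧
      ((graph P D).Adj w z ∧ meetDim w x = meetDim z x)).card = Nat.card F := by
  set k := meetDim z x with hk
  set K := y.1 ⊓ z.1 with hK
  have hKD : finrank F K + 2 = D := hyz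
  -- Each line of `y` over `K` carries one common neighbour, its point nearest to `z`. This point is
  -- level with `y` (relative to `x`) if `H` also contains `y ⊓ x`, and level with `z` otherwise.
  have key : ∀ H ∈ hyp F ⊥ y.1, ∀ m,
      (Finset.univ.filter fun w : Vertex P => H ≤ w.1 ∧ w ≠ y ∧
        ((graph P D).Adj w z ∧ meetDim w x = m)).card =
      if K ≤ H ∧ m = (if y.1 ⊓ x.1 ≤ H then k + 1 else k) then 1 else 0 := by
    intro H hH m
    obtain ⟨-, hHy, hHD⟩ := mem_hyp.1 hH
    rw [hI.finrank_vertex] at hHD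
    have hiso := hI.iso_of_le hHy
    obtain ⟨p, hp, hpz, hother⟩ := hI.exists_nearest hiso hHD z
    obtain ⟨p', hp', hpz', hother'⟩ := hI.exists_nearest hiso hHD x
    have hle : H ⊓ z.1 ≤ K := inf_le_inf hHy le_rfl
    have hle' : H ⊓ x.1 ≤ y.1 ⊓ x.1 := inf_le_inf hHy le_rfl
    by_cases hKH : K ≤ H
    · have hHz : H ⊓ z.1 = K := le_antisymm hle (le_inf hKH inf_le_right)
      rw [hHz] at hpz hother
      have hpz2 : (graph P D).Adj p z := hI.adj_iff.2 (by omega)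
      have hpy : p ≠ y := by
        rintro rfl
        omega
      have hpx : meetDim p x = (if y.1 ⊓ x.1 ≤ H then k + 1 else k) := by
        split_ifs with hc
        · have hHx : H ⊓ x.1 = y.1 ⊓ x.1 := le_antisymm hle' (le_inf hc inf_le_right)
          rw [hHx] at hpz' hother'
          change meetDim p' x = meetDim y x + 1 at hpz'
          change ∀ w : Vertex P, H ≤ w.1 → w ≠ p' → meetDim w x = meetDim y x at hother'
          have h1 := hI.meetDim_le_of_adj hpz2 x
          by_cases hpp : p = p'
          · subst hpp; omega
          · rw [hother' p hp hpp]
            omega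
        · have hlt : finrank F ↥(H ⊓ x.1) < meetDim y x := by
            refine lt_of_le_of_ne (Submodule.finrank_mono hle') fun h => hc ?_
            rw [← Submodule.eq_of_le_of_finrank_eq hle' h]
            exact inf_le_left
          have hpy' : y = p' := by
            by_contra hne
            have := hother' y hHy hne
            omega
          subst hpy'
          rw [hother' p hp hpy]
          omega
      rw [← hpx]
      simp only [hKH, true_and]
      split_ifs with hm
      · rw [Finset.card_eq_one]
        refine ⟨p, ?_⟩
        ext w
        simp only [Finset.mem_filter, Finset.mem_univ, true_and, Finset.mem_singleton]
        constructor
        · rintro ⟨a, -, c, -⟩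
          by_contra hne
          have := hother w a hne
          have := hI.adj_iff.1 c
          omega
        · rintro rfl
          exact ⟨hp, hpy, hpz2, hm.symm⟩
      · rw [Finset.card_eq_zero, Finset.filter_eq_empty_iff]
        rintro w - ⟨a, -, c, d⟩
        have hwp : w = p := by
          by_contra hne
          have := hother w a hne
          have := hI.adj_iff.1 c
          omega
        exact hm (by rw [← d, hwp])
    · rw [if_neg (fun h => hKH h.1), Finset.card_eq_zero, Finset.filter_eq_empty_iff]
      rintro w - ⟨a, -, c, d⟩
      have hlt : finrank F ↥(H ⊓ z.1) < finrank F K := by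
        refine lt_of_le_of_ne (Submodule.finrank_mono hle) fun h => hKH ?_
        rw [← Submodule.eq_of_le_of_finrank_eq hle h]
        exact inf_le_left
      have := hI.adj_iff.1 c
      by_cases hwp : w = p
      · subst hwp; omega
      · have := hother w a hwp
        omega
  -- Exactly one `H` contains both `K` and `y ⊓ x`, because their sum is a hyperplane of `y`. The
  -- dimension is at least `D - 1`, since their intersection lies in `x ⊓ z`. If the sum were all of
  -- `y`, the gate of `y` over `x ⊓ z` would be `y`; then `x ⊓ z ≤ y`, and the dimension formula
  -- would give `D - 1` after all.
  have hJ : finrank F ↥(K ⊔ y.1 ⊓ x.1) + 1 = D := by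
    have h1 := Submodule.finrank_sup_add_finrank_inf_eq K (y.1 ⊓ x.1)
    change _ = _ + meetDim y x at h1
    have h2 : K ⊓ (y.1 ⊓ x.1) = x.1 ⊓ z.1 ⊓ y.1 := by
      apply le_antisymm
      · exact le_inf (le_inf (inf_le_right.trans inf_le_right) (inf_le_left.trans inf_le_right))
          (inf_le_left.trans inf_le_left)
      · exact le_inf (le_inf inf_le_right (inf_le_left.trans inf_le_right))
          (le_inf inf_le_right (inf_le_left.trans inf_le_left))
    have h3 : finrank F ↥(x.1 ⊓ z.1 ⊓ y.1) ≤ k := by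
      rw [hk, meetDim_comm]
      exact Submodule.finrank_mono inf_le_left
    have hxz : finrank F ↥(x.1 ⊓ z.1) = k := by rw [hk, meetDim_comm]; rfl
    have h4 : K ⊔ y.1 ⊓ x.1 ≤ y.1 := sup_le inf_le_left inf_le_left
    have h5 := Submodule.finrank_mono h4
    rw [hI.finrank_vertex] at h5
    rw [h2] at h1
    by_contra hne
    obtain ⟨p, hp, hSp, hpy, hmax⟩ :=
      hI.gate y.1 (x.1 ⊓ z.1) y.2 (hI.iso_of_le (y := x) inf_le_left)
    have h6 := (hmax z.1 z.2 inf_le_right).1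
    have h7 := (hmax x.1 x.2 inf_le_left).1
    have h8 : K ⊔ y.1 ⊓ x.1 ≤ p ⊓ y.1 := by
      refine sup_le ?_ ?_
      · rw [hK, inf_comm]; exact h6
      · rw [inf_comm]; exact h7
    have h9 := Submodule.finrank_mono h8
    omega
  have hJy : K ⊔ y.1 ⊓ x.1 ≤ y.1 := sup_le inf_le_left inf_le_left
  have hc1 : (hyp F (K ⊔ y.1 ⊓ x.1) y.1).card = 1 := by
    rw [card_hyp hJy, hI.finrank_vertex, show D - finrank F ↥(K ⊔ y.1 ⊓ x.1) = 1 by omega]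
    simp
  have hc2 : (hyp F K y.1).card = Nat.card F + 1 := by
    rw [card_hyp inf_le_left, hI.finrank_vertex, show D - finrank F K = 2 by omega]
    simp [Finset.sum_range_succ, add_comm]
  have hf1 : (hyp F ⊥ y.1).filter (fun H => K ≤ H ∧ y.1 ⊓ x.1 ≤ H) =
      hyp F (K ⊔ y.1 ⊓ x.1) y.1 := by
    rw [← filter_hyp (K := K ⊔ y.1 ⊓ x.1)]
    simp only [sup_le_iff]
  have hf2 : ((hyp F ⊥ y.1).filter (fun H => K ≤ H ∧ ¬ y.1 ⊓ x.1 ≤ H)).card = Nat.card F := by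
    have := Finset.card_filter_add_card_filter_not (s := hyp F K y.1) (fun H => y.1 ⊓ x.1 ≤ H)
    rw [← filter_hyp, Finset.filter_filter, Finset.filter_filter, hf1, filter_hyp, hc1, hc2] at this
    omega
  constructor
  · rw [hI.card_neighbors, Finset.sum_congr rfl fun H hH => key H hH _, ← Finset.card_filter,
      ← hc1, ← hf1]
    congr 1
    refine Finset.filter_congr fun H _ => ?_
    split_ifs <;> simp_all
  · rw [hI.card_neighbors, Finset.sum_congr rfl fun H hH => key H hH _, ← Finset.card_filter,
      ← hf2]
    congr 1
    refine Finset.filter_congr fun H _ => ?_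
    split_ifs <;> simp_all

end IsDualPolar
end DualPolar

/-! ### Neighbours containing a subspace; graph distance -/

namespace DualPolar

open Module

namespace IsDualPolar

variable {F U : Type*} [Field F] [AddCommGroup U] [Module F U] {P : Form F U}
  [FiniteDimensional F U] {D s : ℕ} [Finite F] (hI : IsDualPolar P.IsIsotropic D s)

include hI

open Classical in
/-- The number of neighbours of `y` containing `S`. -/
theorem card_neighbors_ge [Fintype (Vertex P)] (y : Vertex P) {S : Submodule F U}
    (hS : P.IsIsotropic S) :
    (Finset.univ.filter fun w => (graph P D).Adj y w ∧ S ≤ w.1).card =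
      (if S ≤ y.1 then s * ∑ i ∈ Finset.range (D - finrank F S), Nat.card F ^ i else 0) +
      (if finrank F ↥(S ⊓ y.1) + 1 = finrank F S then 1 else 0) := by
  by_cases hSy : S ≤ y.1
  · rw [if_pos hSy, inf_eq_left.2 hSy, if_neg (by omega), add_zero, hI.card_neighbors]
    have key : ∀ H ∈ hyp F ⊥ y.1,
        (Finset.univ.filter fun w : Vertex P => H ≤ w.1 ∧ w ≠ y ∧ S ≤ w.1).card =
        if S ≤ H then s else 0 := by
      intro H hH
      obtain ⟨-, hHy, hHD⟩ := mem_hyp.1 hH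
      rw [hI.finrank_vertex] at hHD
      split_ifs with hSH
      · have : (Finset.univ.filter fun w : Vertex P => H ≤ w.1 ∧ w ≠ y ∧ S ≤ w.1) =
            (Finset.univ.filter fun w : Vertex P => H ≤ w.1).erase y := by
          ext w
          simp only [Finset.mem_filter, Finset.mem_univ, true_and, Finset.mem_erase]
          exact ⟨fun h => ⟨h.2.1, h.1⟩, fun h => ⟨h.2, h.1, hSH.trans h.2⟩⟩
        rw [this, Finset.card_erase_of_mem (by simpa using hHy),
          hI.card_line_filter (hI.iso_of_le hHy) hHD]
        omega
      · rw [Finset.card_eq_zero, Finset.filter_eq_empty_iff]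
        rintro w - ⟨a, b, c⟩
        apply hSH
        rw [← hI.inf_eq_of_le hHD a hHy b]
        exact le_inf c hSy
    rw [Finset.sum_congr rfl key, ← Finset.sum_filter, Finset.sum_const, smul_eq_mul, filter_hyp,
      card_hyp hSy, hI.finrank_vertex, mul_comm]
  · rw [if_neg hSy, zero_add]
    -- A neighbour of `y` through `S` meets `y` in codimension one, so `S ⊓ y` has codimension at
    -- most one in `S`. When it is exactly one, the gate is adjacent to `y`, and no other vertex
    -- through `S` meets `y` in that dimension.
    obtain ⟨p, hp, hSp, hpy, hmax⟩ := hI.gate y.1 S y.2 hS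
    have hle : ∀ w : Vertex P, (graph P D).Adj y w → S ≤ w.1 →
        finrank F S ≤ finrank F ↥(S ⊓ y.1) + 1 := by
      intro w hw hSw
      have h1 := hI.finrank_add_le w hSw (inf_le_right : y.1 ⊓ w.1 ≤ w.1)
      have h2 := hI.adj_iff.1 hw
      rw [meetDim] at h2
      have h3 : finrank F ↥(S ⊓ (y.1 ⊓ w.1)) ≤ finrank F ↥(S ⊓ y.1) :=
        Submodule.finrank_mono (inf_le_inf le_rfl inf_le_left)
      omega
    have hlt : finrank F ↥(S ⊓ y.1) < finrank F S := by
      refine lt_of_le_of_ne (Submodule.finrank_mono inf_le_left) fun h => hSy ?_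
      rw [← Submodule.eq_of_le_of_finrank_eq inf_le_left h]
      exact inf_le_right
    split_ifs with h
    · rw [Finset.card_eq_one]
      refine ⟨⟨p, hp⟩, ?_⟩
      ext w
      simp only [Finset.mem_filter, Finset.mem_univ, true_and, Finset.mem_singleton]
      constructor
      · rintro ⟨h1, h2⟩
        obtain ⟨h3, h4⟩ := hmax w.1 w.2 h2
        refine Subtype.ext (h4 (Submodule.eq_of_le_of_finrank_eq h3 ?_))
        have := hI.adj_iff.1 h1
        rw [meetDim_comm, meetDim] at this
        omega
      · rintro rfl
        refine ⟨hI.adj_iff.2 ?_, hSp⟩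
        rw [meetDim_comm, meetDim]
        change finrank F ↥(p ⊓ y.1) + 1 = D
        omega
    · rw [Finset.card_eq_zero, Finset.filter_eq_empty_iff]
      rintro w - ⟨h1, h2⟩
      have := hle w h1 h2
      omega

omit hI in
open Classical in
-- The second summand matches the one in `card_neighbors_ge`. The difference of the two counts is
-- therefore supported on `S ≤ y`, and this produces an eigenvalue.
theorem card_hyp_le (S y : Submodule F U) :
    ((hyp F ⊥ S).filter (· ≤ y)).card =
      (if S ≤ y then ∑ i ∈ Finset.range (finrank F S), Nat.card F ^ i else 0) +
      (if finrank F ↥(S ⊓ y) + 1 = finrank F S then 1 else 0) := by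
  by_cases hSy : S ≤ y
  · rw [if_pos hSy, inf_eq_left.2 hSy, if_neg (by omega), add_zero, Finset.filter_true_of_mem,
      card_hyp bot_le, finrank_bot, Nat.sub_zero]
    exact fun H hH => (mem_hyp.1 hH).2.1.trans hSy
  · rw [if_neg hSy, zero_add]
    have hlt : finrank F ↥(S ⊓ y) < finrank F S := by
      refine lt_of_le_of_ne (Submodule.finrank_mono inf_le_left) fun h => hSy ?_
      rw [← Submodule.eq_of_le_of_finrank_eq inf_le_left h]
      exact inf_le_right
    have hle : ∀ H ∈ hyp F ⊥ S, H ≤ y → H = S ⊓ y ∧ finrank F ↥(S ⊓ y) + 1 = finrank F S := by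
      intro H hH hy
      obtain ⟨-, h1, h2⟩ := mem_hyp.1 hH
      have h3 : H ≤ S ⊓ y := le_inf h1 hy
      have h4 := Submodule.finrank_mono h3
      exact ⟨Submodule.eq_of_le_of_finrank_eq h3 (by omega), by omega⟩
    split_ifs with h
    · rw [Finset.card_eq_one]
      refine ⟨S ⊓ y, ?_⟩
      ext H
      simp only [Finset.mem_filter, Finset.mem_singleton]
      constructor
      · rintro ⟨h1, h2⟩
        exact (hle H h1 h2).1
      · rintro rfl
        exact ⟨mem_hyp.2 ⟨bot_le, inf_le_left, h⟩, inf_le_right⟩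
    · rw [Finset.card_eq_zero, Finset.filter_eq_empty_iff]
      exact fun H hH hy => h (hle H hH hy).2

omit hI in
theorem sum_range_pos {D : ℕ} (h : 0 < D) : 0 < ∑ i ∈ Finset.range D, Nat.card F ^ i :=
  Finset.sum_pos (fun _ _ => pow_pos Finite.card_pos _) ⟨0, by simpa using h⟩

omit hI in
theorem sum_range_lt {m n : ℕ} (h : m < n) :
    ∑ i ∈ Finset.range m, Nat.card F ^ i < ∑ i ∈ Finset.range n, Nat.card F ^ i :=
  Finset.sum_lt_sum_of_subset (Finset.range_mono h.le) (i := m) (by simpa using h) (by simp)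
    (pow_pos Finite.card_pos _) (fun _ _ _ => Nat.zero_le _)

theorem exists_neighbor [Fintype (Vertex P)] {y z : Vertex P} {m : ℕ}
    (h : 0 < nbCount (Nat.card F) s D m (meetDim y z)) :
    ∃ w, (graph P D).Adj y w ∧ meetDim w z = m := by
  classical
  rw [← hI.card_neighbors_meetDim] at h
  obtain ⟨w, hw⟩ := Finset.card_pos.1 h
  simp only [Finset.mem_filter, Finset.mem_univ, true_and] at hw
  exact ⟨w, hw⟩

theorem exists_closer [Fintype (Vertex P)] {y z : Vertex P} (h : meetDim y z < D) :
    ∃ w, (graph P D).Adj y w ∧ meetDim w z = meetDim y z + 1 := by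
  apply hI.exists_neighbor
  rw [nbCount, if_pos rfl]
  have := sum_range_pos (F := F) (D := D - meetDim y z) (by omega)
  omega

theorem exists_level [Fintype (Vertex P)] (hs : 1 < s) {y z : Vertex P} (h : meetDim y z < D) :
    ∃ w, (graph P D).Adj y w ∧ meetDim w z = meetDim y z := by
  apply hI.exists_neighbor
  rw [nbCount, if_neg (by omega), if_pos rfl]
  have := sum_range_pos (F := F) (D := D - meetDim y z) (by omega)
  have := Nat.mul_pos this (show 0 < s - 1 by omega)
  omega

theorem exists_farther [Fintype (Vertex P)] (hs : 0 < s) {y z : Vertex P}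
    (h : 0 < meetDim y z) :
    ∃ w, (graph P D).Adj y w ∧ meetDim w z + 1 = meetDim y z := by
  have h1 := hI.meetDim_le y z
  obtain ⟨w, hw, hw'⟩ := hI.exists_neighbor (y := y) (z := z) (m := meetDim y z - 1) (by
    rw [nbCount, if_neg (by omega), if_neg (by omega), if_pos (by omega)]
    have := sum_range_lt (F := F) (show D - meetDim y z < D by omega)
    have := Nat.mul_pos (Nat.sub_pos_of_lt this) hs
    omega)
  exact ⟨w, hw, by omega⟩

/-- A vertex `z` farther from `x` than `y` at distance two from `y`. -/
theorem exists_farther_two [Fintype (Vertex P)] (hs : 1 < s) {x y : Vertex P}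
    (h : meetDim y x < D) (h0 : 0 < meetDim y x) :
    ∃ w z, (graph P D).Adj y w ∧ (graph P D).Adj w z ∧ meetDim w x = meetDim y x ∧
      meetDim y x = meetDim z x + 1 ∧ meetDim y z + 2 = D := by
  obtain ⟨w, hyw, hw⟩ := hI.exists_level hs h
  obtain ⟨z, hwz, hz⟩ := hI.exists_farther (y := w) (z := x) (by omega) (by omega)
  refine ⟨w, z, hyw, hwz, hw, by omega, ?_⟩
  have h1 := hI.adj_iff.1 hyw
  have h2 := hI.adj_iff.1 hwz
  rw [meetDim_comm] at h2
  have h3 := hI.meetDim_le_of_adj hwz.symm y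
  rw [meetDim_comm z y, meetDim_comm w y] at h3
  have h3' := hI.meetDim_le_of_adj hwz y
  rw [meetDim_comm w y, meetDim_comm z y] at h3'
  have h4 := hI.meetDim_le y z
  have h5 : meetDim y z ≠ D := by
    intro h
    rw [hI.meetDim_eq_iff.1 h] at hw
    omega
  -- Were `y` and `z` adjacent, their common neighbour `w` would be level with `z`, not with `y`.
  have h6 : meetDim y z + 1 ≠ D := by
    intro h
    have := hI.meetDim_common_neighbor (x := x) (hI.adj_iff.2 h) (by omega) hyw hwz
    omega
  omega

theorem meetDim_add_le_of_walk {y z : Vertex P} (p : (graph P D).Walk y z) :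
    D ≤ meetDim y z + p.length := by
  induction p with
  | nil => rw [hI.meetDim_self]; omega
  | cons h p ih =>
    rw [SimpleGraph.Walk.length_cons]
    have := hI.meetDim_le_of_adj h.symm
    rename_i u v w
    have := this w
    omega

theorem exists_walk [Fintype (Vertex P)] (z : Vertex P) :
    ∀ n, ∀ y : Vertex P, meetDim y z + n = D → ∃ p : (graph P D).Walk y z, p.length = n := by
  intro n
  induction n with
  | zero =>
    intro y h
    obtain rfl := hI.meetDim_eq_iff.1 (by simpa using h)
    exact ⟨.nil, rfl⟩
  | succ n ih =>
    intro y h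
    obtain ⟨w, hw, hwz⟩ := hI.exists_closer (y := y) (z := z) (by omega)
    obtain ⟨p, hp⟩ := ih w (by omega)
    exact ⟨.cons hw p, by simp [hp]⟩

theorem connected [Fintype (Vertex P)] (x : Vertex P) : (graph P D).Connected where
  preconnected y z := by
    obtain ⟨p, -⟩ := hI.exists_walk z (D - meetDim y z) y (by have := hI.meetDim_le y z; omega)
    exact ⟨p⟩
  nonempty := ⟨x⟩

/-- An edge changes the meet with `z` by at most one dimension, and some edge always increases it
while it is below `D`. -/
theorem dist_add_meetDim [Fintype (Vertex P)] (y z : Vertex P) :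
    (graph P D).dist y z + meetDim y z = D := by
  obtain ⟨p, hp⟩ := hI.exists_walk z (D - meetDim y z) y (by have := hI.meetDim_le y z; omega)
  have h1 := SimpleGraph.dist_le p
  obtain ⟨p', hp'⟩ := (hI.connected y).exists_walk_length_eq_dist y z
  have h2 := hI.meetDim_add_le_of_walk p'
  have := hI.meetDim_le y z
  omega

end IsDualPolar
end DualPolar

/-! ### Raising, lowering and flat matrices -/

namespace DualPolar

open Module

section Operators

variable {X : Type*} [Fintype X] [DecidableEq X]

open Classical in
/-- The raising matrix with respect to `x`. -/
def raise (G : SimpleGraph X) (x : X) : Matrix X X ℂ :=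
  Matrix.of fun z y => if G.Adj y z ∧ G.dist x z = G.dist x y + 1 then 1 else 0

open Classical in
/-- The lowering matrix with respect to `x`. -/
def lower (G : SimpleGraph X) (x : X) : Matrix X X ℂ :=
  Matrix.of fun z y => if G.Adj y z ∧ G.dist x z + 1 = G.dist x y then 1 else 0

open Classical in
/-- The flat matrix with respect to `x`. -/
def flat (G : SimpleGraph X) (x : X) : Matrix X X ℂ :=
  Matrix.of fun z y => if G.Adj y z ∧ G.dist x z = G.dist x y then 1 else 0

/-- The diagonal matrix with entries `b ^ (- dist x y)`. -/
def weight (b : ℂ) (G : SimpleGraph X) (x : X) : Matrix X X ℂ :=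
  Matrix.diagonal fun y => (b ^ G.dist x y)⁻¹

variable {G : SimpleGraph X} {x : X}

open Classical in
theorem adj_apply (y z : X) : adj G y z = if G.Adj y z then 1 else 0 := by
  simp [adj, distMatrix, SimpleGraph.dist_eq_one_iff_adj]

theorem ite_mul_ite (p q : Prop) [Decidable p] [Decidable q] [Decidable (p ∧ q)] :
    ((if p then 1 else 0) * (if q then 1 else 0) : ℂ) = if p ∧ q then 1 else 0 := by
  by_cases p <;> by_cases q <;> simp_all

open Classical in
theorem adj_eq_adjMatrix : adj G = G.adjMatrix ℂ := by
  ext y z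
  rw [adj_apply, SimpleGraph.adjMatrix_apply]

theorem adj_eq : adj G = raise G x + lower G x + flat G x := by
  classical
  ext z y
  simp only [adj_apply, raise, lower, flat, Matrix.add_apply, Matrix.of_apply, G.adj_comm y z]
  by_cases h : G.Adj z y
  · have h1 := h.symm.diff_dist_adj (u := x)
    simp only [h, true_and, if_true]
    rcases h1 with h1 | h1 | h1
    · rw [if_neg (by omega), if_neg (by omega), if_pos (by omega)]; simp
    · rw [if_pos (by omega), if_neg (by omega), if_neg (by omega)]; simp
    · by_cases h2 : G.dist x y = 0
      · rw [if_neg (by omega), if_neg (by omega), if_pos (by omega)]; simp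
      · rw [if_neg (by omega), if_pos (by omega), if_neg (by omega)]; simp
  · simp [h]

theorem transpose_raise : (raise G x)ᵀ = lower G x := by
  classical
  ext z y
  simp only [raise, lower, Matrix.transpose_apply, Matrix.of_apply, G.adj_comm y z, eq_comm]

theorem transpose_flat : (flat G x)ᵀ = flat G x := by
  classical
  ext z y
  simp only [flat, Matrix.transpose_apply, Matrix.of_apply, G.adj_comm y z, eq_comm]

theorem transpose_weight (b : ℂ) : (weight b G x)ᵀ = weight b G x := Matrix.diagonal_transpose _

theorem transpose_adj : (adj G)ᵀ = adj G := by
  ext y z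
  simp only [Matrix.transpose_apply, adj, distMatrix, Matrix.of_apply, G.dist_comm]

/-- Conjugation by `weight` scales the raising, lowering and flat matrices by `b`, `b⁻¹` and `1`. It
thus grades words in them by the net change of distance, which later separates the components of a
relation. -/
theorem raise_mul_weight {b : ℂ} (hb : b ≠ 0) :
    raise G x * weight b G x = b • (weight b G x * raise G x) := by
  classical
  ext z y
  simp only [weight, raise, Matrix.mul_diagonal, Matrix.diagonal_mul, Matrix.smul_apply,
    Matrix.of_apply, smul_eq_mul]
  split_ifs with h
  · rw [h.2, pow_succ]; field_simp
  · simp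

theorem lower_mul_weight {b : ℂ} (hb : b ≠ 0) :
    lower G x * weight b G x = b⁻¹ • (weight b G x * lower G x) := by
  classical
  ext z y
  simp only [weight, lower, Matrix.mul_diagonal, Matrix.diagonal_mul, Matrix.smul_apply,
    Matrix.of_apply, smul_eq_mul]
  split_ifs with h
  · rw [← h.2, pow_succ]; field_simp
  · simp

theorem flat_mul_weight (b : ℂ) : flat G x * weight b G x = weight b G x * flat G x := by
  classical
  ext z y
  simp only [weight, flat, Matrix.mul_diagonal, Matrix.diagonal_mul, Matrix.of_apply]
  split_ifs with h
  · rw [h.2]; ring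
  · simp

theorem eq_inv_smul_sub {c : ℂ} (hc : c ≠ 0) {M N S : Matrix X X ℂ} (h : M = S + c • N) :
    N = c⁻¹ • (M - S) := by
  rw [h, add_sub_cancel_left, smul_smul, inv_mul_cancel₀ hc, one_smul]

end Operators

namespace IsDualPolar

variable {F U : Type*} [Field F] [AddCommGroup U] [Module F U] {P : Form F U}
  [FiniteDimensional F U] {D s : ℕ} [Finite F] (hI : IsDualPolar P.IsIsotropic D s)
  [Fintype (Vertex P)] [DecidableEq (Vertex P)]

include hI

theorem dist_le (y z : Vertex P) : (graph P D).dist y z ≤ D := by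
  have := hI.dist_add_meetDim y z
  omega

theorem dist_iff {x y z : Vertex P} : (graph P D).dist x z = (graph P D).dist x y + 1 ↔
    meetDim y x = meetDim z x + 1 := by
  have h1 := hI.dist_add_meetDim x y
  have h2 := hI.dist_add_meetDim x z
  rw [meetDim_comm y x, meetDim_comm z x]
  omega

theorem dist_eq_iff {x y z : Vertex P} : (graph P D).dist x z = (graph P D).dist x y ↔
    meetDim z x = meetDim y x := by
  have h1 := hI.dist_add_meetDim x y
  have h2 := hI.dist_add_meetDim x z
  rw [meetDim_comm y x, meetDim_comm z x]
  omega

theorem adj_mul_distMatrix {i : ℕ} (hi : i ≤ D) :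
    adj (graph P D) * distMatrix ℂ (graph P D) i =
      ∑ j ∈ Finset.range (D + 1), (nbCount (Nat.card F) s D (D - i) (D - j) : ℂ) •
        distMatrix ℂ (graph P D) j := by
  classical
  ext y z
  have h1 := hI.dist_add_meetDim y z
  rw [Matrix.mul_apply, Matrix.sum_apply, Finset.sum_eq_single ((graph P D).dist y z)]
  · simp only [adj_apply, distMatrix, Matrix.of_apply, Matrix.smul_apply, if_true, smul_eq_mul,
      mul_one]
    rw [show D - (graph P D).dist y z = meetDim y z by omega, ← hI.card_neighbors_meetDim,
      Finset.card_filter]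
    push_cast
    refine Finset.sum_congr rfl fun w _ => ?_
    rw [ite_mul_ite]
    have h2 := hI.dist_add_meetDim w z
    congr 1
    rw [eq_iff_iff]
    constructor
    · rintro ⟨h3, h4⟩; exact ⟨h3, by omega⟩
    · rintro ⟨h3, h4⟩; exact ⟨h3, by omega⟩
  · intro j _ hj
    simp [distMatrix, hj.symm]
  · intro h
    simp at h
    omega

theorem distMatrix_zero : distMatrix ℂ (graph P D) 0 = 1 := by
  ext y z
  have := (hI.connected y).dist_eq_zero_iff (u := y) (v := z)
  simp [distMatrix, this, Matrix.one_apply]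

/-- In the expansion of `A * A_i` the last nonzero term is the one in `A_{i+1}`, so the distance
matrices are successively polynomials in `A`. -/
theorem distMatrix_mem (i : ℕ) :
    distMatrix ℂ (graph P D) i ∈ Algebra.adjoin ℂ {adj (graph P D)} := by
  induction i using Nat.strong_induction_on with
  | _ i ih =>
    rcases i with _ | i
    · rw [hI.distMatrix_zero]; exact one_mem _
    by_cases hi : D < i + 1
    · have : distMatrix ℂ (graph P D) (i + 1) = 0 := by
        ext y z
        have := hI.dist_le y z
        simp only [distMatrix, Matrix.of_apply, Matrix.zero_apply]
        rw [if_neg (by omega)]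
      rw [this]; exact zero_mem _
    · have h1 := hI.adj_mul_distMatrix (i := i) (by omega)
      have h2 : ∑ j ∈ Finset.range (D + 1), (nbCount (Nat.card F) s D (D - i) (D - j) : ℂ) •
          distMatrix ℂ (graph P D) j = ∑ j ∈ Finset.range (i + 1 + 1),
          (nbCount (Nat.card F) s D (D - i) (D - j) : ℂ) • distMatrix ℂ (graph P D) j := by
        symm
        refine Finset.sum_subset (Finset.range_mono (by omega)) fun j hj hj' => ?_
        rw [Finset.mem_range] at hj hj'
        rw [nbCount, if_neg (by omega), if_neg (by omega), if_neg (by omega)]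
        simp
      rw [h2, Finset.sum_range_succ] at h1
      obtain ⟨c, hc⟩ : ∃ c : ℂ, c = (nbCount (Nat.card F) s D (D - i) (D - (i + 1)) : ℂ) :=
        ⟨_, rfl⟩
      have hc0 : c ≠ 0 := by
        rw [hc, Nat.cast_ne_zero, nbCount, if_pos (by omega)]
        have := sum_range_pos (F := F) (D := D - (D - (i + 1))) (by omega)
        omega
      rw [← hc] at h1
      have h3 : distMatrix ℂ (graph P D) (i + 1) = c⁻¹ • (adj (graph P D) *
          distMatrix ℂ (graph P D) i - ∑ j ∈ Finset.range (i + 1),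
          (nbCount (Nat.card F) s D (D - i) (D - j) : ℂ) • distMatrix ℂ (graph P D) j) := by
        exact eq_inv_smul_sub hc0 h1
      rw [h3]
      apply Subalgebra.smul_mem
      apply Subalgebra.sub_mem
      · exact Subalgebra.mul_mem _ (Algebra.subset_adjoin rfl) (ih i (by omega))
      · apply Subalgebra.sum_mem
        intro j hj
        rw [Finset.mem_range] at hj
        exact Subalgebra.smul_mem _ (ih j hj) _

variable (x : Vertex P)

open Classical in
theorem flat_mul_raise_apply (z y : Vertex P)
    (h : (graph P D).dist x z = (graph P D).dist x y + 1) :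
    (flat (graph P D) x * raise (graph P D) x) z y = (Finset.univ.filter fun w =>
      (graph P D).Adj y w ∧ ((graph P D).Adj w z ∧ meetDim w x = meetDim z x)).card := by
  rw [Matrix.mul_apply, Finset.card_filter]
  push_cast
  refine Finset.sum_congr rfl fun w _ => ?_
  simp only [flat, raise, Matrix.of_apply]
  rw [ite_mul_ite]
  congr 1
  have e := hI.dist_eq_iff (x := x) (y := z) (z := w)
  rw [eq_iff_iff]
  constructor
  · rintro ⟨⟨a, b⟩, c, d⟩; exact ⟨c, a, e.1 (by omega)⟩
  · rintro ⟨a, b, c⟩; have := e.2 c; exact ⟨⟨b, by omega⟩, a, by omega⟩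

open Classical in
theorem raise_mul_flat_apply (z y : Vertex P)
    (h : (graph P D).dist x z = (graph P D).dist x y + 1) :
    (raise (graph P D) x * flat (graph P D) x) z y = (Finset.univ.filter fun w =>
      (graph P D).Adj y w ∧ ((graph P D).Adj w z ∧ meetDim w x = meetDim y x)).card := by
  rw [Matrix.mul_apply, Finset.card_filter]
  push_cast
  refine Finset.sum_congr rfl fun w _ => ?_
  simp only [flat, raise, Matrix.of_apply]
  rw [ite_mul_ite]
  congr 1
  have e := hI.dist_eq_iff (x := x) (y := y) (z := w)
  rw [eq_iff_iff]
  constructor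
  · rintro ⟨⟨a, b⟩, c, d⟩; exact ⟨c, a, e.1 (by omega)⟩
  · rintro ⟨a, b, c⟩; have := e.2 c; exact ⟨⟨b, by omega⟩, a, by omega⟩

theorem raise_mul_flat_apply_adj {y z : Vertex P} (h : (graph P D).Adj y z)
    (hd : (graph P D).dist x z = (graph P D).dist x y + 1) :
    (raise (graph P D) x * flat (graph P D) x) z y = 0 := by
  classical
  rw [hI.raise_mul_flat_apply x z y hd, Nat.cast_eq_zero, Finset.card_eq_zero,
    Finset.filter_eq_empty_iff]
  rintro w - ⟨h1, h2, h3⟩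
  have hm := hI.dist_iff.1 hd
  have := hI.meetDim_common_neighbor (x := x) h hm h1 h2
  omega

/-- Only pairs with `z` one step farther from `x` than `y` matter. If they are adjacent, all `s - 1`
common neighbours are level with `z`. If they are at distance two, one common neighbour is level
with `y` and `b` are level with `z`. Otherwise there are none. -/
theorem flat_mul_raise (hs : 0 < s) :
    flat (graph P D) x * raise (graph P D) x =
      (Nat.card F : ℂ) • (raise (graph P D) x * flat (graph P D) x) +
      ((s : ℂ) - 1) • raise (graph P D) x := by
  classical
  ext z y
  rw [Matrix.add_apply, Matrix.smul_apply, Matrix.smul_apply]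
  by_cases hd : (graph P D).dist x z = (graph P D).dist x y + 1
  · have hm := hI.dist_iff.1 hd
    by_cases hadj : (graph P D).Adj y z
    · have h1 : raise (graph P D) x z y = 1 := by simp [raise, hadj, hd]
      rw [hI.raise_mul_flat_apply_adj x hadj hd, hI.flat_mul_raise_apply x z y hd, h1]
      have : (Finset.univ.filter fun w => (graph P D).Adj y w ∧
          ((graph P D).Adj w z ∧ meetDim w x = meetDim z x)) =
          Finset.univ.filter fun w => (graph P D).Adj y w ∧ (graph P D).Adj w z := by
        refine Finset.filter_congr fun w _ => ⟨fun h => ⟨h.1, h.2.1⟩, fun h => ⟨h.1, h.2, ?_⟩⟩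
        exact hI.meetDim_common_neighbor (x := x) hadj hm h.1 h.2
      rw [this, hI.card_common_neighbors_adj hadj, Nat.cast_sub (by omega)]
      simp
    · have h1 : raise (graph P D) x z y = 0 := by simp [raise, hadj]
      rw [hI.flat_mul_raise_apply x z y hd, hI.raise_mul_flat_apply x z y hd, h1]
      by_cases hyz : meetDim y z + 2 = D
      · obtain ⟨h2, h3⟩ := hI.card_common_neighbors_two hyz hm
        rw [h2, h3]; simp
      · have hno : ∀ w, (graph P D).Adj y w → (graph P D).Adj w z → False := by
          intro w hyw hwz
          have h2 := hI.meetDim_le_of_adj hyw.symm z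
          have h3 := hI.adj_iff.1 hwz
          have h4 := hI.meetDim_le y z
          have h5 : meetDim y z + 1 ≠ D := fun h => hadj (hI.adj_iff.2 h)
          have h6 : meetDim y z ≠ D := by
            intro h
            rw [hI.meetDim_eq_iff.1 h] at hm
            omega
          omega
        have e1 : ∀ m, (Finset.univ.filter fun w => (graph P D).Adj y w ∧
            ((graph P D).Adj w z ∧ meetDim w x = m)) = ∅ := by
          intro m
          rw [Finset.filter_eq_empty_iff]
          exact fun w _ h => hno w h.1 h.2.1
        rw [e1, e1]; simp
  · have h1 : raise (graph P D) x z y = 0 := by simp [raise, hd]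
    have h2 : (flat (graph P D) x * raise (graph P D) x) z y = 0 := by
      rw [Matrix.mul_apply]
      refine Finset.sum_eq_zero fun w _ => ?_
      simp only [flat, raise, Matrix.of_apply]
      rw [ite_mul_ite, if_neg]
      rintro ⟨⟨a, b⟩, c, d⟩; omega
    have h3 : (raise (graph P D) x * flat (graph P D) x) z y = 0 := by
      rw [Matrix.mul_apply]
      refine Finset.sum_eq_zero fun w _ => ?_
      simp only [flat, raise, Matrix.of_apply]
      rw [ite_mul_ite, if_neg]
      rintro ⟨⟨a, b⟩, c, d⟩; omega
    rw [h1, h2, h3]; simp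

end IsDualPolar
end DualPolar

/-! ### Eigenspace projections from a filtration -/

namespace DualPolar

open Module Polynomial

/-- The family `E` consists of the projections onto the eigenspaces of `A` for the distinct
eigenvalues `θ 0, …, θ D`, and `K` acts on these in a tridiagonal way. -/
structure SpectralData {V : Type*} [Fintype V] [DecidableEq V] (A K : Matrix V V ℂ) (θ : ℕ → ℝ)
    (D : ℕ) (E : ℕ → Matrix V V ℂ) : Prop where
  inj : ∀ i ≤ D, ∀ j ≤ D, θ i = θ j → i = j
  sum : ∑ i ∈ Finset.range (D + 1), E i = 1
  mul_left : ∀ i ≤ D, A * E i = (θ i : ℂ) • E i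
  mul_right : ∀ i ≤ D, E i * A = (θ i : ℂ) • E i
  tridiag : ∀ i ≤ D, ∀ j ≤ D, i + 1 < j ∨ j + 1 < i → E i * K * E j = 0
  ne_zero : ∀ i ≤ D, E i ≠ 0
  eq_zero : ∀ i, D < i → E i = 0
  mem : ∀ i, E i ∈ Algebra.adjoin ℂ {A}

section Filtration

variable {V : Type*} [Fintype V] [DecidableEq V] {A K : Matrix V V ℂ} {θ : ℕ → ℝ} {D : ℕ}
  {W : ℕ → Submodule ℂ (V → ℂ)}

theorem aeval_X_sub_C_mulVec (r : ℝ) (v : V → ℂ) :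
    aeval A (X - C r : ℝ[X]) *ᵥ v = A *ᵥ v - (r : ℂ) • v := by
  have : aeval A (C r : ℝ[X]) = (r : ℂ) • (1 : Matrix V V ℂ) := by
    rw [aeval_C, Algebra.algebraMap_eq_smul_one]
    ext i j
    simp
  rw [map_sub, aeval_X, this, Matrix.sub_mulVec, Matrix.smul_mulVec, Matrix.one_mulVec]

theorem aeval_prod_mulVec (h0 : W 0 = ⊥)
    (hA : ∀ i ≤ D, ∀ v ∈ W (i + 1), A *ᵥ v - (θ i : ℂ) • v ∈ W i) (i : ℕ) (hi : i ≤ D + 1) :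
    ∀ v ∈ W i, aeval A (∏ j ∈ Finset.range i, (X - C (θ j)) : ℝ[X]) *ᵥ v = 0 := by
  induction i with
  | zero =>
    intro v hv
    rw [h0, Submodule.mem_bot] at hv
    rw [hv, Matrix.mulVec_zero]
  | succ i ih =>
    intro v hv
    rw [Finset.prod_range_succ, map_mul, ← Matrix.mulVec_mulVec, aeval_X_sub_C_mulVec]
    exact ih (by omega) _ (hA i (by omega) v hv)

/-- The interpolation idempotents of an operator with a suitable filtration. -/
theorem spectralData_of_filtration
    (hθ : ∀ i ≤ D, ∀ j ≤ D, θ i = θ j → i = j) (h0 : W 0 = ⊥) (hT : W (D + 1) = ⊤)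
    (hW : Monotone W)
    (hA : ∀ i ≤ D, ∀ v ∈ W (i + 1), A *ᵥ v - (θ i : ℂ) • v ∈ W i)
    (hK : ∀ i, ∀ v ∈ W i, K *ᵥ v ∈ W (i + 1))
    (hAt : Aᵀ = A) (hKt : Kᵀ = K)
    (hne : ∀ p : ℝ[X], p ≠ 0 → p.natDegree ≤ D → aeval A p ≠ 0)
    {E : ℕ → Matrix V V ℂ}
    (hE : ∀ i ≤ D, E i = aeval A (Lagrange.basis (Finset.range (D + 1)) θ i))
    (hE' : ∀ i, D < i → E i = 0) : SpectralData A K θ D E := by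
  have hinj : Set.InjOn θ (Finset.range (D + 1)) := by
    intro i hi j hj h
    simp only [Finset.coe_range, Set.mem_Iio] at hi hj
    exact hθ i (by omega) j (by omega) h
  have hnodal : aeval A (∏ j ∈ Finset.range (D + 1), (X - C (θ j)) : ℝ[X]) = 0 := by
    apply Matrix.ext_of_mulVec_single
    intro j
    rw [Matrix.zero_mulVec]
    exact aeval_prod_mulVec h0 hA (D + 1) le_rfl _ (hT ▸ Submodule.mem_top)
  have hmul0 : ∀ i ≤ D,
      aeval A ((X - C (θ i)) * Lagrange.basis (Finset.range (D + 1)) θ i : ℝ[X]) = 0 := by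
    intro i hi
    have hmem : i ∈ Finset.range (D + 1) := by simp; omega
    have : (X - C (θ i)) * Lagrange.basis (Finset.range (D + 1)) θ i =
        (∏ j ∈ (Finset.range (D + 1)).erase i, C (θ i - θ j)⁻¹) *
        ∏ j ∈ Finset.range (D + 1), (X - C (θ j)) := by
      rw [← Finset.mul_prod_erase _ _ hmem, Lagrange.basis]
      simp only [Lagrange.basisDivisor]
      rw [Finset.prod_mul_distrib]
      ring
    rw [this, map_mul, hnodal, mul_zero]
  have hsc : ∀ r : ℝ, aeval A (C r : ℝ[X]) = (r : ℂ) • (1 : Matrix V V ℂ) := by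
    intro r
    rw [aeval_C, Algebra.algebraMap_eq_smul_one]
    ext i j
    simp
  have hl : ∀ i ≤ D, A * E i = (θ i : ℂ) • E i := by
    intro i hi
    have := hmul0 i hi
    rw [map_mul, map_sub, aeval_X, hsc, ← hE i hi, sub_mul, smul_mul_assoc, one_mul] at this
    exact sub_eq_zero.1 this
  have hcomm : ∀ i ≤ D, E i * A = A * E i := by
    intro i hi
    rw [hE i hi]
    conv_lhs => rw [← aeval_X (R := ℝ) A, aeval_X]
    have h1 : aeval A (Lagrange.basis (Finset.range (D + 1)) θ i * X : ℝ[X]) =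
        aeval A (X * Lagrange.basis (Finset.range (D + 1)) θ i : ℝ[X]) := by rw [mul_comm]
    rwa [map_mul, map_mul, aeval_X] at h1
  have hr : ∀ i ≤ D, E i * A = (θ i : ℂ) • E i := fun i hi => (hcomm i hi).trans (hl i hi)
  have hθc : ∀ i ≤ D, ∀ j ≤ D, i ≠ j → (θ i : ℂ) - θ j ≠ 0 := by
    intro i hi j hj hij h
    exact hij (hθ i hi j hj (by exact_mod_cast sub_eq_zero.1 h))
  -- On the layers below `W i` the matrix `A` acts by eigenvalues other than `θ i`, so `E i`
  -- annihilates them one after another.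
  have hkill : ∀ i ≤ D, ∀ j ≤ i, ∀ v ∈ W j, E i *ᵥ v = 0 := by
    intro i hi j
    induction j with
    | zero =>
      intro _ v hv
      rw [h0, Submodule.mem_bot] at hv
      rw [hv, Matrix.mulVec_zero]
    | succ j ih =>
      intro hj v hv
      have h1 := ih (by omega) _ (hA j (by omega) v hv)
      rw [Matrix.mulVec_sub, Matrix.mulVec_mulVec, hr i hi, Matrix.smul_mulVec,
        Matrix.mulVec_smul, ← sub_smul] at h1
      exact (smul_eq_zero.1 h1).resolve_left (hθc i hi j (by omega) (by omega))
  -- Dually, an eigenvector for `θ i` descends through each layer where `A` acts by a different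
  -- eigenvalue, from the top down to `W (i + 1)`.
  have hrange : ∀ i ≤ D, ∀ v, E i *ᵥ v ∈ W (i + 1) := by
    intro i hi v
    suffices ∀ n, ∀ j, j = i + n → j ≤ D → E i *ᵥ v ∈ W (j + 1) → E i *ᵥ v ∈ W (i + 1) from
      this (D - i) D (by omega) le_rfl (hT ▸ Submodule.mem_top)
    intro n
    induction n with
    | zero => rintro j rfl _ h; exact h
    | succ n ih =>
      rintro j rfl hjD h
      refine ih (i + n) rfl (by omega) ?_
      have h1 := hA _ hjD _ h
      rw [Matrix.mulVec_mulVec, hl i hi, Matrix.smul_mulVec, ← sub_smul] at h1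
      exact (Submodule.smul_mem_iff _ (hθc i hi _ hjD (by omega))).1 h1
  have htri : ∀ i ≤ D, ∀ j ≤ D, j + 1 < i → E i * K * E j = 0 := by
    intro i hi j hj hij
    apply Matrix.ext_of_mulVec_single
    intro k
    rw [Matrix.zero_mulVec, ← Matrix.mulVec_mulVec, ← Matrix.mulVec_mulVec]
    exact hkill i hi i le_rfl _ (hW (by omega) (hK _ _ (hrange j hj _)))
  have hEt : ∀ i ≤ D, (E i)ᵀ = E i := by
    intro i hi
    rw [hE i hi]
    generalize Lagrange.basis (Finset.range (D + 1)) θ i = p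
    rw [aeval_eq_sum_range, Matrix.transpose_sum]
    refine Finset.sum_congr rfl fun k _ => ?_
    rw [Matrix.transpose_smul, Matrix.transpose_pow, hAt]
  refine ⟨hθ, ?_, hl, hr, ?_, ?_, hE', ?_⟩
  · rw [Finset.sum_congr rfl fun i hi => hE i (by rw [Finset.mem_range] at hi; omega), ← map_sum,
      Lagrange.sum_basis hinj ⟨0, by simp⟩, map_one]
  · rintro i hi j hj (h | h)
    · have h1 := congrArg Matrix.transpose (htri j hj i hi h)
      rwa [Matrix.transpose_mul, Matrix.transpose_mul, hEt i hi, hEt j hj, hKt,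
        Matrix.transpose_zero, ← mul_assoc] at h1
    · exact htri i hi j hj h
  · intro i hi
    have hmem : i ∈ Finset.range (D + 1) := by simp; omega
    rw [hE i hi]
    refine hne _ (Lagrange.basis_ne_zero hinj hmem) ?_
    rw [Lagrange.natDegree_basis hinj hmem]
    simp
  · intro i
    by_cases hi : i ≤ D
    · rw [hE i hi, ← aeval_map_algebraMap ℂ]
      exact aeval_mem_adjoin_singleton _ _
    · rw [hE' i (by omega)]
      exact zero_mem _

end Filtration

section Idempotents

variable {V : Type*} [Fintype V] [DecidableEq V] {G : SimpleGraph V} {θ : ℕ → ℝ} {D : ℕ}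

theorem mem_eigenvalues (r : ℝ) :
    r ∈ eigenvalues G ↔ ∃ v : V → ℂ, v ≠ 0 ∧ adj G *ᵥ v = (r : ℂ) • v := by
  have h1 : (distMatrix ℝ G 1).map Complex.ofRealHom = adj G := by
    ext y z
    simp only [distMatrix, Matrix.map_apply, Matrix.of_apply, adj]
    split_ifs <;> simp
  rw [eigenvalues, Multiset.mem_toFinset, mem_roots (Matrix.charpoly_monic _).ne_zero, IsRoot.def,
    ← map_eq_zero_iff Complex.ofRealHom Complex.ofReal_injective, ← eval₂_hom, ← eval_map,
    ← Matrix.charpoly_map, h1, Matrix.eval_charpoly, ← Matrix.exists_mulVec_eq_zero_iff]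
  refine exists_congr fun v => and_congr_right fun _ => ?_
  rw [Matrix.sub_mulVec, sub_eq_zero, eq_comm, Matrix.scalar_apply,
    ← Matrix.smul_one_eq_diagonal, Matrix.smul_mulVec, Matrix.one_mulVec]
  rfl

/-- In a decreasing list of the eigenvalues exactly `i` of them exceed `θ i`, so the sum in `idem`
has the single term at `θ i`, or none for `i > D`. -/
theorem idem_eq (h : eigenvalues G = (Finset.range (D + 1)).image θ)
    (hθ : ∀ i j, i < j → j ≤ D → θ j < θ i) :
    (∀ i ≤ D, idem G i = aeval (adj G) (Lagrange.basis (Finset.range (D + 1)) θ i)) ∧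
      ∀ i, D < i → idem G i = 0 := by
  have hlt : ∀ i ≤ D, ∀ j ≤ D, (θ i < θ j ↔ j < i) := by
    intro i hi j hj
    refine ⟨fun h1 => ?_, fun h1 => hθ j i h1 hi⟩
    by_contra h2
    rcases lt_or_eq_of_le (not_lt.1 h2) with h3 | rfl
    · exact lt_asymm h1 (hθ i j h3 hj)
    · exact lt_irrefl _ h1
  have hinj : ∀ i ≤ D, ∀ j ≤ D, θ i = θ j → i = j := by
    intro i hi j hj h1
    have h2 := hlt i hi j hj
    have h3 := hlt j hj i hi
    rw [h1] at h2 h3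
    have := lt_irrefl (θ j)
    by_contra hne
    rcases Nat.lt_or_gt_of_ne hne with h4 | h4
    · exact this (h3.2 h4)
    · exact this (h2.2 h4)
  have hinj' : Set.InjOn θ (Finset.range (D + 1)) := by
    intro i hi j hj h1
    simp only [Finset.coe_range, Set.mem_Iio] at hi hj
    exact hinj i (by omega) j (by omega) h1
  have hcard : ∀ i ≤ D, ((eigenvalues G).filter (fun μ => θ i < μ)).card = i := by
    intro i hi
    have : (eigenvalues G).filter (fun μ => θ i < μ) = (Finset.range i).image θ := by
      ext μ
      simp only [h, Finset.mem_filter, Finset.mem_image, Finset.mem_range]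
      constructor
      · rintro ⟨⟨j, hj, rfl⟩, h1⟩
        exact ⟨j, (hlt i hi j (by omega)).1 h1, rfl⟩
      · rintro ⟨j, hj, rfl⟩
        exact ⟨⟨j, by omega, rfl⟩, (hlt i hi j (by omega)).2 hj⟩
    rw [this, Finset.card_image_of_injOn, Finset.card_range]
    exact hinj'.mono (by simp only [Finset.coe_range]; exact Set.Iio_subset_Iio (by omega))
  constructor
  · intro i hi
    have hf : (eigenvalues G).filter
        (fun μ => ((eigenvalues G).filter (fun ν => μ < ν)).card = i) = {θ i} := by
      ext μ
      simp only [Finset.mem_filter, Finset.mem_singleton]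
      constructor
      · rintro ⟨h1, h2⟩
        rw [h] at h1
        obtain ⟨j, hj, rfl⟩ := Finset.mem_image.1 h1
        rw [Finset.mem_range] at hj
        rw [hcard j (by omega)] at h2
        rw [h2]
      · rintro rfl
        exact ⟨h ▸ Finset.mem_image_of_mem _ (by simp; omega), hcard i hi⟩
    rw [idem, hf, Finset.sum_singleton]
    congr 1
    rw [Lagrange.basis, Lagrange.basis, h]
    have he : ((Finset.range (D + 1)).image θ).erase (θ i) =
        ((Finset.range (D + 1)).erase i).image θ := by
      ext μ
      simp only [Finset.mem_erase, Finset.mem_image, Finset.mem_range]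
      constructor
      · rintro ⟨h1, j, h2, rfl⟩
        exact ⟨j, ⟨fun h3 => h1 (by rw [h3]), h2⟩, rfl⟩
      · rintro ⟨j, ⟨h1, h2⟩, rfl⟩
        exact ⟨fun h3 => h1 (hinj j (by omega) i hi h3), j, h2, rfl⟩
    rw [he, Finset.prod_image]
    · rfl
    · exact hinj'.mono (Finset.coe_subset.2 (Finset.erase_subset _ _))
  · intro i hi
    rw [idem]
    apply Finset.sum_eq_zero
    intro μ hμ
    exfalso
    obtain ⟨h1, h2⟩ := Finset.mem_filter.1 hμ
    rw [h] at h1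
    obtain ⟨j, hj, rfl⟩ := Finset.mem_image.1 h1
    rw [Finset.mem_range] at hj
    rw [hcard j (by omega)] at h2
    omega

end Idempotents
end DualPolar

/-! ### The spectrum and the filtration by subspace dimension -/

namespace DualPolar

open Module

/-- The eigenvalues of the dual polar graph. -/
def dpEigenvalue (b s D i : ℕ) : ℝ :=
  s * ∑ j ∈ Finset.range (D - i), (b : ℝ) ^ j - ∑ j ∈ Finset.range i, (b : ℝ) ^ j

theorem dpEigenvalue_lt {b s D i j : ℕ} (hb : 0 < b) (h : i < j) :
    dpEigenvalue b s D j < dpEigenvalue b s D i := by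
  have h1 : ∑ k ∈ Finset.range i, (b : ℝ) ^ k < ∑ k ∈ Finset.range j, (b : ℝ) ^ k :=
    Finset.sum_lt_sum_of_subset (Finset.range_mono h.le) (i := i) (by simpa using h) (by simp)
      (by positivity) (fun _ _ _ => by positivity)
  have h2 : (s : ℝ) * ∑ k ∈ Finset.range (D - j), (b : ℝ) ^ k ≤
      s * ∑ k ∈ Finset.range (D - i), (b : ℝ) ^ k := by
    apply mul_le_mul_of_nonneg_left _ (Nat.cast_nonneg s)
    exact Finset.sum_le_sum_of_subset_of_nonneg (Finset.range_mono (by omega))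
      (fun _ _ _ => by positivity)
  unfold dpEigenvalue
  linarith

theorem dpEigenvalue_eq {b s D i : ℕ} (hb : 1 < b) :
    dpEigenvalue b s D i = (s * (b : ℝ) ^ (D - i) - (b : ℝ) ^ i + 1 - s) / (b - 1) := by
  have h1 : (b : ℝ) ≠ 1 := by exact_mod_cast hb.ne'
  have h2 : (b : ℝ) - 1 ≠ 0 := sub_ne_zero.2 h1
  rw [dpEigenvalue, geom_sum_eq h1, geom_sum_eq h1]
  field_simp
  ring

section PolynomialInAdj

open Polynomial

/-- A nonzero polynomial whose degree is a distance in the graph does not annihilate the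
adjacency matrix. -/
theorem aeval_adj_ne_zero {V : Type*} [Fintype V] [DecidableEq V] {G : SimpleGraph V}
    (hG : G.Connected) {p : ℝ[X]} (hp : p ≠ 0) {y z : V} (h : G.dist y z = p.natDegree) :
    aeval (adj G) p ≠ 0 := by
  classical
  intro h0
  have h1 := congrFun (congrFun h0 y) z
  rw [aeval_eq_sum_range, Matrix.sum_apply, Finset.sum_eq_single p.natDegree] at h1
  · rw [Matrix.smul_apply, Matrix.zero_apply, smul_eq_zero] at h1
    refine h1.elim (fun h2 => hp (leadingCoeff_eq_zero.1 h2)) fun h2 => ?_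
    -- Entries of powers of `A` count walks: the top power has a walk of length equal to the
    -- distance, the lower powers have none.
    rw [adj_eq_adjMatrix, SimpleGraph.adjMatrix_pow_apply_eq_card_walk, Nat.cast_eq_zero,
      Fintype.card_eq_zero_iff] at h2
    obtain ⟨w, hw⟩ := hG.exists_walk_length_eq_dist y z
    exact h2.false ⟨w, hw.trans h⟩
  · intro n hn hne
    rw [Finset.mem_range] at hn
    rw [Matrix.smul_apply, smul_eq_zero]
    right
    rw [adj_eq_adjMatrix, SimpleGraph.adjMatrix_pow_apply_eq_card_walk, Nat.cast_eq_zero,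
      Fintype.card_eq_zero_iff]
    refine ⟨fun ⟨w, hw⟩ => ?_⟩
    have := SimpleGraph.dist_le w
    change w.length = n at hw
    omega
  · simp

end PolynomialInAdj

section

variable {F U : Type*} [Field F] [AddCommGroup U] [Module F U] {P : Form F U}

open Classical in
/-- The characteristic function of the set of vertices containing `S`. -/
def containVec (P : Form F U) (S : Submodule F U) : Vertex P → ℂ :=
  fun y => if S ≤ y.1 then 1 else 0

theorem containVec_mul (S T : Submodule F U) :
    containVec P S * containVec P T = containVec P (S ⊔ T) := by
  classical
  funext y
  simp only [containVec, Pi.mul_apply, ite_mul_ite, sup_le_iff]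

/-- The span of the vectors `containVec S` with `dim S < i`. -/
def containSpan (P : Form F U) (i : ℕ) : Submodule ℂ (Vertex P → ℂ) :=
  Submodule.span ℂ (containVec P '' {S | finrank F S < i})

theorem containSpan_mono : Monotone (containSpan P) := fun _ _ h =>
  Submodule.span_mono (Set.image_mono fun _ hS => lt_of_lt_of_le hS h)

theorem containVec_mem {S : Submodule F U} {i : ℕ} (h : finrank F S < i) :
    containVec P S ∈ containSpan P i := Submodule.subset_span ⟨S, h, rfl⟩

end

namespace IsDualPolar

variable {F U : Type*} [Field F] [AddCommGroup U] [Module F U] {P : Form F U}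
  [FiniteDimensional F U] {D s : ℕ} [Finite F] (hI : IsDualPolar P.IsIsotropic D s)
  [Fintype (Vertex P)] [DecidableEq (Vertex P)]

include hI

/-- Evaluated at `y`, this compares the neighbours of `y` that contain `S` with the hyperplanes of
`S` that lie in `y`. When `S ⊓ y` has codimension one in `S` both counts are 1; when `S ≤ y` they
differ by the eigenvalue. -/
theorem adj_mulVec_containVec {S : Submodule F U} (hS : P.IsIsotropic S) :
    adj (graph P D) *ᵥ containVec P S =
      (dpEigenvalue (Nat.card F) s D (finrank F S) : ℂ) • containVec P S +
      ∑ H ∈ hyp F ⊥ S, containVec P H := by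
  classical
  funext y
  have h1 : (adj (graph P D) *ᵥ containVec P S) y =
      ((Finset.univ.filter fun w => (graph P D).Adj y w ∧ S ≤ w.1).card : ℂ) := by
    rw [Matrix.mulVec, dotProduct, Finset.card_filter]
    push_cast
    refine Finset.sum_congr rfl fun w _ => ?_
    rw [adj_apply, containVec, ite_mul_ite]
  have h2 : (∑ H ∈ hyp F ⊥ S, containVec P H) y =
      (((hyp F ⊥ S).filter (· ≤ y.1)).card : ℂ) := by
    rw [Finset.sum_apply, Finset.card_filter]
    push_cast
    rfl
  rw [h1, Pi.add_apply, h2, hI.card_neighbors_ge y hS, card_hyp_le, Pi.smul_apply, containVec,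
    dpEigenvalue]
  push_cast
  split_ifs <;> simp <;> ring

theorem adj_mulVec_sub_mem (i : ℕ) (v : Vertex P → ℂ) (hv : v ∈ containSpan P (i + 1)) :
    adj (graph P D) *ᵥ v - (dpEigenvalue (Nat.card F) s D i : ℂ) • v ∈ containSpan P i := by
  induction hv using Submodule.span_induction with
  | mem v hv =>
    obtain ⟨S, hS, rfl⟩ := hv
    change finrank F S < i + 1 at hS
    by_cases hiso : P.IsIsotropic S
    · rw [hI.adj_mulVec_containVec hiso]
      have hsum : ∑ H ∈ hyp F ⊥ S, containVec P H ∈ containSpan P i := by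
        refine Submodule.sum_mem _ fun H hH => containVec_mem ?_
        have := (mem_hyp.1 hH).2.2
        omega
      rcases Nat.lt_succ_iff_lt_or_eq.1 hS with h | h
      · exact Submodule.sub_mem _ (Submodule.add_mem _
          (Submodule.smul_mem _ _ (containVec_mem h)) hsum)
          (Submodule.smul_mem _ _ (containVec_mem h))
      · rw [h, add_sub_cancel_left]
        exact hsum
    · have : containVec P S = 0 := by
        funext y
        exact if_neg fun h => hiso (hI.iso_of_le h)
      rw [this]
      simp
  | zero => simp
  | add u v _ _ hu hv =>
    rw [Matrix.mulVec_add, smul_add, add_sub_add_comm]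
    exact Submodule.add_mem _ hu hv
  | smul c v _ hv =>
    rw [Matrix.mulVec_smul, smul_comm, ← smul_sub]
    exact Submodule.smul_mem _ _ hv

/-- Since `dim (x ∩ y) = D - dist x y`, the number of vectors of `x` lying in `y` is `b ^ (D - dist
x y)`. This writes the weight as a sum of characteristic functions of subspaces of dimension at most
one. -/
theorem weight_eq (x y : Vertex P) [Fintype x.1] :
    ((Nat.card F : ℂ) ^ (graph P D).dist x y)⁻¹ =
      ((Nat.card F : ℂ) ^ D)⁻¹ * ∑ u : x.1, containVec P (F ∙ (u : U)) y := by
  classical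
  have hb : (Nat.card F : ℂ) ≠ 0 := by exact_mod_cast Finite.card_pos.ne'
  have h1 : ∑ u : x.1, containVec P (F ∙ (u : U)) y = (Nat.card F : ℂ) ^ meetDim x y := by
    simp only [containVec, Submodule.span_singleton_le_iff_mem]
    rw [← Finset.sum_filter, Finset.sum_const, nsmul_one, meetDim, ← Nat.cast_pow,
      ← Module.natCard_eq_pow_finrank (K := F), ← Fintype.card_subtype,
      ← Nat.card_eq_fintype_card]
    congr 1
    refine Nat.card_congr ⟨fun u => ⟨u.1.1, u.1.2, u.2⟩, fun u => ⟨⟨u.1, u.2.1⟩, u.2.2⟩, ?_, ?_⟩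
    · intro u; rfl
    · intro u; rfl
  have h2 : (Nat.card F : ℂ) ^ D =
      (Nat.card F : ℂ) ^ (graph P D).dist x y * (Nat.card F : ℂ) ^ meetDim x y := by
    rw [← pow_add, hI.dist_add_meetDim]
  rw [h1, h2]
  field_simp

/-- The pointwise product of the functions of `S` and `⟨u⟩` is the function of `S + ⟨u⟩`, so
multiplication by the weight raises the dimension by at most one. This is all that is needed about
the dual side of the algebra. -/
theorem weight_mulVec_mem (x : Vertex P) (i : ℕ) (v : Vertex P → ℂ) (hv : v ∈ containSpan P i) :
    weight (Nat.card F) (graph P D) x *ᵥ v ∈ containSpan P (i + 1) := by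
  have : Finite U := Module.finite_of_finite F
  let _ : Fintype x.1 := Fintype.ofFinite _
  have h1 : ∀ v : Vertex P → ℂ, weight (Nat.card F) (graph P D) x *ᵥ v =
      ((Nat.card F : ℂ) ^ D)⁻¹ • ∑ u : x.1, containVec P (F ∙ (u : U)) * v := by
    intro v
    funext y
    rw [weight, Matrix.mulVec_diagonal, hI.weight_eq, Pi.smul_apply, Finset.sum_apply,
      smul_eq_mul, mul_assoc, Finset.sum_mul]
    rfl
  induction hv using Submodule.span_induction with
  | mem v hv =>
    obtain ⟨S, hS, rfl⟩ := hv
    change finrank F S < i at hS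
    rw [h1]
    refine Submodule.smul_mem _ _ (Submodule.sum_mem _ fun u _ => ?_)
    rw [containVec_mul]
    apply containVec_mem
    have h2 := Submodule.finrank_add_le_finrank_add_finrank (F ∙ (u : U)) S
    have h3 : finrank F (F ∙ (u : U)) ≤ 1 := by
      simpa using finrank_span_le_card (R := F) ({(u : U)} : Set U)
    omega
  | zero => simp
  | add u v _ _ hu hv =>
    rw [Matrix.mulVec_add]
    exact Submodule.add_mem _ hu hv
  | smul c v _ hv =>
    rw [Matrix.mulVec_smul]
    exact Submodule.smul_mem _ _ hv

theorem containSpan_top : containSpan P (D + 1) = ⊤ := by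
  classical
  rw [eq_top_iff, ← (Pi.basisFun ℂ (Vertex P)).span_eq, Submodule.span_le]
  rintro _ ⟨y, rfl⟩
  have : Pi.basisFun ℂ (Vertex P) y = containVec P y.1 := by
    funext z
    rw [Pi.basisFun_apply, Pi.single_apply, containVec]
    exact if_congr ⟨fun h => h ▸ le_rfl, fun h => Subtype.ext (y.2.eq_of_le z.2.1 h).symm⟩ rfl rfl
  rw [this]
  exact containVec_mem (by rw [hI.finrank_vertex]; omega)

theorem exists_dist_eq (hs : 0 < s) (x : Vertex P) :
    ∀ n ≤ D, ∃ y, (graph P D).dist x y = n := by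
  intro n
  induction n with
  | zero => exact fun _ => ⟨x, SimpleGraph.dist_self⟩
  | succ n ih =>
    intro hn
    obtain ⟨y, hy⟩ := ih (by omega)
    have h1 := hI.dist_add_meetDim x y
    rw [meetDim_comm] at h1
    obtain ⟨w, hw, hw'⟩ := hI.exists_farther hs (y := y) (z := x) (by omega)
    have h2 := hI.dist_add_meetDim x w
    rw [meetDim_comm] at h2
    exact ⟨w, by omega⟩

/-- The filtration argument is run twice. With the interpolation polynomials at the `dpEigenvalue`s
it shows that these are exactly the eigenvalues of `A`; `idem_eq` then identifies the resulting
projections with `idem`. -/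
theorem spectralData (hs : 0 < s) (x : Vertex P) :
    SpectralData (adj (graph P D)) (weight (Nat.card F) (graph P D) x)
      (dpEigenvalue (Nat.card F) s D) D (idem (graph P D)) := by
  have hb : 0 < Nat.card F := Finite.card_pos
  have hlt : ∀ i j, i < j → j ≤ D →
      dpEigenvalue (Nat.card F) s D j < dpEigenvalue (Nat.card F) s D i :=
    fun i j h _ => dpEigenvalue_lt hb h
  have hinj : ∀ i ≤ D, ∀ j ≤ D,
      dpEigenvalue (Nat.card F) s D i = dpEigenvalue (Nat.card F) s D j → i = j := by
    intro i hi j hj h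
    rcases lt_trichotomy i j with h1 | h1 | h1
    · exact absurd h (hlt i j h1 hj).ne'
    · exact h1
    · exact absurd h (hlt j i h1 hi).ne
  have hne : ∀ p : Polynomial ℝ, p ≠ 0 → p.natDegree ≤ D →
      Polynomial.aeval (adj (graph P D)) p ≠ 0 := by
    intro p hp hd
    obtain ⟨y, hy⟩ := hI.exists_dist_eq hs x _ hd
    exact aeval_adj_ne_zero (hI.connected x) hp hy
  have key := fun E hE hE' => spectralData_of_filtration (A := adj (graph P D))
    (K := weight (Nat.card F) (graph P D) x) (θ := dpEigenvalue (Nat.card F) s D) (D := D)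
    (W := containSpan P) hinj (by simp [containSpan]) hI.containSpan_top containSpan_mono
    (fun i _ v hv => hI.adj_mulVec_sub_mem i v hv) (hI.weight_mulVec_mem x)
    transpose_adj (transpose_weight _) hne (E := E) hE hE'
  have hsd := key (fun i => if i ≤ D then Polynomial.aeval (adj (graph P D))
    (Lagrange.basis (Finset.range (D + 1)) (dpEigenvalue (Nat.card F) s D) i) else 0)
    (fun i hi => if_pos hi) (fun i hi => if_neg (by omega))
  have heig : eigenvalues (graph P D) =
      (Finset.range (D + 1)).image (dpEigenvalue (Nat.card F) s D) := by
    ext r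
    rw [mem_eigenvalues, Finset.mem_image]
    constructor
    · rintro ⟨v, hv, hAv⟩
      by_contra! hcon
      apply hv
      rw [← Matrix.one_mulVec v, ← hsd.sum, Matrix.sum_mulVec]
      refine Finset.sum_eq_zero fun i hi => ?_
      have hi' : i ≤ D := by rw [Finset.mem_range] at hi; omega
      have h1 := hsd.mul_right i hi'
      have h2 := congrArg (· *ᵥ v) h1
      rw [← Matrix.mulVec_mulVec, hAv, Matrix.mulVec_smul, Matrix.smul_mulVec] at h2
      rw [← sub_eq_zero, ← sub_smul, smul_eq_zero] at h2
      refine h2.resolve_left fun h3 => hcon i hi ?_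
      exact_mod_cast (sub_eq_zero.1 h3).symm
    · rintro ⟨i, hi, rfl⟩
      have hi' : i ≤ D := by rw [Finset.mem_range] at hi; omega
      have h1 := hsd.ne_zero i hi'
      obtain ⟨y, hy⟩ : ∃ y, (if i ≤ D then Polynomial.aeval (adj (graph P D)) (Lagrange.basis
          (Finset.range (D + 1)) (dpEigenvalue (Nat.card F) s D) i) else 0) *ᵥ Pi.single y 1 ≠ 0 := by
        by_contra! hcon
        refine h1 (Matrix.ext_of_mulVec_single fun y => ?_)
        rw [hcon y, Matrix.zero_mulVec]
      refine ⟨_, hy, ?_⟩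
      rw [Matrix.mulVec_mulVec, hsd.mul_left i hi', Matrix.smul_mulVec]
  obtain ⟨h1, h2⟩ := idem_eq heig hlt
  exact key _ h1 h2

end IsDualPolar
end DualPolar

/-! ### The tridiagonal relation and its raising component -/

namespace DualPolar

section Cubic

variable {𝒜 : Type*} [Ring 𝒜] [Algebra ℂ 𝒜] {b ρ : ℂ} {R L F K K' : 𝒜}

/-- The component of the tridiagonal relation which raises the weight by one. -/
theorem cubic_relation (hb : b ≠ 0) (hb1 : b ^ 2 ≠ 1) (hK : K' * K = 1)
    (hRK : R * K = b • (K * R)) (hLK : L * K = b⁻¹ • (K * L)) (hFK : F * K = K * F)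
    (hFR : F * R = b • (R * F)) (hFL : F * L = b⁻¹ • (L * F))
    (hQ : ∀ A, A = R + L + F →
      A * A * A * K - (b + b⁻¹ + 1) • (A * A * K * A) + (b + b⁻¹ + 1) • (A * K * A * A) -
        K * A * A * A = ρ • (A * K - K * A)) :
    (b⁻¹ ^ 2 - 1) • (L * R * R) + ((b + b⁻¹ + 2) * (b - 1)) • (R * L * R) +
      (b - b ^ 3) • (R * R * L) = (ρ * (b - 1)) • R := by
  have aRK : ∀ Z, R * (K * Z) = b • (K * (R * Z)) := fun Z => by
    rw [← mul_assoc, hRK, smul_mul_assoc, mul_assoc]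
  have aLK : ∀ Z, L * (K * Z) = b⁻¹ • (K * (L * Z)) := fun Z => by
    rw [← mul_assoc, hLK, smul_mul_assoc, mul_assoc]
  have aFK : ∀ Z, F * (K * Z) = K * (F * Z) := fun Z => by
    rw [← mul_assoc, hFK, mul_assoc]
  have aFR : ∀ Z, F * (R * Z) = b • (R * (F * Z)) := fun Z => by
    rw [← mul_assoc, hFR, smul_mul_assoc, mul_assoc]
  have aFL : ∀ Z, F * (L * Z) = b⁻¹ • (L * (F * Z)) := fun Z => by
    rw [← mul_assoc, hFL, smul_mul_assoc, mul_assoc]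
  -- Once every `K` is moved to the left and every `F` to the right, all words containing `F` and
  -- all words changing the distance by other than one cancel. `Pos` and `Neg` are the surviving
  -- parts of degree `1` and `-1`.
  set Pos : 𝒜 := (b⁻¹ ^ 2 - 1) • (L * (R * R)) + ((b + b⁻¹ + 2) * (b - 1)) • (R * (L * R)) +
      (b - b ^ 3) • (R * (R * L)) - (ρ * (b - 1)) • R with hPos
  set Neg : 𝒜 := (b ^ 2 - 1) • (R * (L * L)) + ((b + b⁻¹ + 2) * (b⁻¹ - 1)) • (L * (R * L)) +
      (b⁻¹ - b⁻¹ ^ 3) • (L * (L * R)) - (ρ * (b⁻¹ - 1)) • L with hNeg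
  have h1 : K * (Pos + Neg) = 0 := by
    have h := hQ _ rfl
    simp only [mul_add, add_mul, mul_assoc, smul_add, aRK, aLK, aFK, hRK, hLK, hFK, aFR, aFL, hFR,
      hFL, mul_smul_comm, smul_mul_assoc, smul_smul, smul_sub] at h
    simp only [hPos, hNeg, mul_add, mul_sub, mul_smul_comm]
    rw [← sub_eq_zero] at h
    rw [← h]
    match_scalars <;> field_simp <;> ring
  have h2 : Pos + Neg = 0 := by
    rw [← one_mul (Pos + Neg), ← hK, mul_assoc, h1, mul_zero]
  have h3 : Pos * K = b • (K * Pos) := by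
    simp only [hPos, add_mul, sub_mul, mul_assoc, aRK, aLK, hRK, hLK, mul_smul_comm, smul_mul_assoc,
      smul_smul, mul_add, mul_sub, smul_add, smul_sub]
    match_scalars <;> field_simp
  have h4 : Neg * K = b⁻¹ • (K * Neg) := by
    simp only [hNeg, add_mul, sub_mul, mul_assoc, aRK, aLK, hRK, hLK, mul_smul_comm, smul_mul_assoc,
      smul_smul, mul_add, mul_sub, smul_add, smul_sub]
    match_scalars <;> field_simp
  -- Commuting `K` through the two parts costs the factors `b` and `b⁻¹`. As the parts are negatives
  -- of each other and `b ^ 2 ≠ 1`, they vanish.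
  have h5 : (b - b⁻¹) • (K * Pos) = 0 := by
    have h6 : Neg = - Pos := by
      rw [eq_neg_iff_add_eq_zero, add_comm]; exact h2
    rw [h6, neg_mul, h3, mul_neg, smul_neg, neg_inj] at h4
    rw [sub_smul, h4, sub_self]
  have h6 : b - b⁻¹ ≠ 0 := by
    intro h
    apply hb1
    field_simp at h
    linear_combination h
  have h7 : Pos = 0 := by
    rw [← one_mul Pos, ← hK, mul_assoc, (smul_eq_zero.1 h5).resolve_left h6, mul_zero]
  rw [hPos, sub_eq_zero] at h7
  simpa only [mul_assoc] using h7

end Cubic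

section Tridiagonal

variable {V : Type*} [Fintype V] [DecidableEq V] {A K : Matrix V V ℂ} {θ : ℕ → ℝ} {D : ℕ}
  {E : ℕ → Matrix V V ℂ}

theorem SpectralData.eq_zero_of_mul (h : SpectralData A K θ D E) {M : Matrix V V ℂ}
    (hM : ∀ i ≤ D, ∀ j ≤ D, E i * M * E j = 0) : M = 0 := by
  rw [← one_mul M, ← mul_one (1 * M), ← h.sum, Finset.sum_mul, Finset.sum_mul]
  refine Finset.sum_eq_zero fun i hi => ?_
  rw [Finset.mul_sum]
  refine Finset.sum_eq_zero fun j hj => ?_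
  rw [Finset.mem_range] at hi hj
  exact hM i (by omega) j (by omega)

/-- The tridiagonal relation for a shift `A + c` of `A`. -/
theorem SpectralData.tridiagonal_relation (h : SpectralData A K θ D E) (c β ρ : ℂ)
    (hθ : ∀ i < D, ((θ i : ℂ) + c) ^ 2 - β * ((θ i : ℂ) + c) * ((θ (i + 1) : ℂ) + c) +
      ((θ (i + 1) : ℂ) + c) ^ 2 = ρ) (A' : Matrix V V ℂ) (hA' : A' = A + c • 1) :
    A' * A' * A' * K - (β + 1) • (A' * A' * K * A') + (β + 1) • (A' * K * A' * A') -
      K * A' * A' * A' = ρ • (A' * K - K * A') := by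
  rw [← sub_eq_zero]
  apply h.eq_zero_of_mul
  intro i hi j hj
  set φ := (θ i : ℂ) + c with hφ
  set ψ := (θ j : ℂ) + c with hψ
  have h1 : E i * A' = φ • E i := by
    rw [hA', mul_add, h.mul_right i hi, mul_smul_comm, mul_one, ← add_smul]
  have h2 : A' * E j = ψ • E j := by
    rw [hA', add_mul, h.mul_left j hj, smul_mul_assoc, one_mul, ← add_smul]
  have h1' : ∀ Z, E i * (A' * Z) = φ • (E i * Z) := fun Z => by
    rw [← mul_assoc, h1, smul_mul_assoc]
  -- This is the relation sandwiched between `E i` and `E j`. The first factor vanishes for `i = j`,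
  -- the second for `|i - j| = 1`, and the matrix itself for `|i - j| > 1`.
  have hz : ((φ - ψ) * (φ ^ 2 - β * φ * ψ + ψ ^ 2 - ρ)) • (E i * (K * E j)) = 0 := by
    rw [smul_eq_zero]
    rcases lt_trichotomy i j with hij | hij | hij
    · by_cases hj1 : j = i + 1
      · left
        rw [hφ, hψ, hj1, hθ i (by omega), sub_self, mul_zero]
      · right
        rw [← mul_assoc]
        exact h.tridiag i hi j hj (by omega)
    · left
      rw [hφ, hψ, hij, sub_self, zero_mul]
    · by_cases hj1 : i = j + 1
      · left
        have := hθ j (by omega)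
        rw [hφ, hψ, hj1]
        linear_combination ((θ (j + 1) : ℂ) + c - (θ j + c)) * this
      · right
        rw [← mul_assoc]
        exact h.tridiag i hi j hj (by omega)
  rw [← hz]
  simp only [mul_sub, sub_mul, mul_add, add_mul, mul_assoc, h1', h2, mul_smul_comm, smul_mul_assoc,
    smul_smul, smul_sub]
  module

end Tridiagonal
end DualPolar

/-! ### The subconstituent algebra and its center -/

namespace DualPolar

open Module

variable {V : Type*} [Fintype V] [DecidableEq V]

/-- The properties of a dual polar graph, seen from the vertex `x`, that determine the structure
of its subconstituent algebra. -/
structure IsDualPolarGraph (G : SimpleGraph V) (x : V) (D b s : ℕ) : Prop where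
  connected : G.Connected
  dist_le : ∀ y, G.dist x y ≤ D
  one_lt : 1 < b
  spectral : SpectralData (adj G) (weight b G x) (dpEigenvalue b s D) D (idem G)
  distMatrix_mem : ∀ i, distMatrix ℂ G i ∈ Algebra.adjoin ℂ {adj G}
  flat_raise : flat G x * raise G x =
    (b : ℂ) • (raise G x * flat G x) + ((s : ℂ) - 1) • raise G x
  raise_flat_adj : ∀ y z, G.Adj y z → G.dist x z = G.dist x y + 1 →
    (raise G x * flat G x) z y = 0
  exists_edge : ∀ i < D, ∃ y z, G.Adj y z ∧ G.dist x y = i ∧ G.dist x z = i + 1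
  exists_two : 1 < s → ∀ i, 1 ≤ i → i < D → ∃ y z, ¬ G.Adj y z ∧ G.dist x y = i ∧
    G.dist x z = i + 1 ∧ (raise G x * flat G x) z y ≠ 0
  flat_eq_zero : s = 1 → flat G x = 0
  exists_flat : 1 < s → 1 ≤ D → ∃ y z, G.Adj y z ∧ G.dist x y = 1 ∧ G.dist x z = 1

section Stabilizer

/-- The matrices leaving `W` invariant. -/
def stab (W : Submodule ℂ (V → ℂ)) : Subalgebra ℂ (Matrix V V ℂ) where
  carrier := {M | ∀ w ∈ W, M *ᵥ w ∈ W}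
  mul_mem' := fun ha hb w hw => by rw [← Matrix.mulVec_mulVec]; exact ha _ (hb _ hw)
  add_mem' := fun ha hb w hw => by rw [Matrix.add_mulVec]; exact W.add_mem (ha _ hw) (hb _ hw)
  algebraMap_mem' := fun c w hw => by
    rw [Algebra.algebraMap_eq_smul_one, Matrix.smul_mulVec, Matrix.one_mulVec]
    exact W.smul_mem _ hw

variable {W : Submodule ℂ (V → ℂ)} {G : SimpleGraph V} {x : V} {D b s : ℕ}

theorem isTModule_iff_le : IsTModule G x W ↔ subconstAlg G x ≤ stab W := Iff.rfl

theorem mem_stab_span {M : Matrix V V ℂ} {s : Set (V → ℂ)}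
    (h : ∀ v ∈ s, M *ᵥ v ∈ Submodule.span ℂ s) : M ∈ stab (Submodule.span ℂ s) := by
  intro w hw
  have : Submodule.span ℂ s ≤ (Submodule.span ℂ s).comap (Matrix.mulVecLin M) :=
    Submodule.span_le.2 h
  exact this hw

theorem adj_mem : adj G ∈ subconstAlg G x := Algebra.subset_adjoin (Or.inl ⟨1, rfl⟩)

theorem dualIdem_mem (i : ℕ) : dualIdem G x i ∈ subconstAlg G x :=
  Algebra.subset_adjoin (Or.inr ⟨i, rfl⟩)

theorem dualIdem_mul_self (i : ℕ) : dualIdem G x i * dualIdem G x i = dualIdem G x i := by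
  simp [dualIdem]

theorem dualIdem_mul_ne {i j : ℕ} (h : i ≠ j) : dualIdem G x i * dualIdem G x j = 0 := by
  rw [dualIdem, dualIdem, Matrix.diagonal_mul_diagonal, ← Matrix.diagonal_zero]
  congr 1
  funext y
  by_cases h1 : G.dist x y = i
  · rw [if_neg (fun h2 => h (h1.symm.trans h2)), mul_zero]
  · rw [if_neg h1, zero_mul]

theorem dualIdem_mul_raise (i : ℕ) :
    dualIdem G x (i + 1) * raise G x = raise G x * dualIdem G x i := by
  classical
  ext z y
  simp only [dualIdem, raise, Matrix.diagonal_mul, Matrix.mul_diagonal, Matrix.of_apply,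
    ite_mul_ite]
  refine if_congr ?_ rfl rfl
  constructor
  · rintro ⟨h1, h2, h3⟩; exact ⟨⟨h2, h3⟩, by omega⟩
  · rintro ⟨⟨h1, h2⟩, h3⟩; exact ⟨by omega, h1, h2⟩

theorem dualIdem_mul_lower (i : ℕ) :
    dualIdem G x i * lower G x = lower G x * dualIdem G x (i + 1) := by
  classical
  ext z y
  simp only [dualIdem, lower, Matrix.diagonal_mul, Matrix.mul_diagonal, Matrix.of_apply,
    ite_mul_ite]
  refine if_congr ?_ rfl rfl
  constructor
  · rintro ⟨h1, h2, h3⟩; exact ⟨⟨h2, h3⟩, by omega⟩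
  · rintro ⟨⟨h1, h2⟩, h3⟩; exact ⟨by omega, h1, h2⟩

theorem lower_mul_dualIdem_zero : lower G x * dualIdem G x 0 = 0 := by
  classical
  ext z y
  simp only [dualIdem, lower, Matrix.mul_diagonal, Matrix.of_apply, ite_mul_ite, Matrix.zero_apply]
  rw [if_neg]
  rintro ⟨⟨h1, h2⟩, h3⟩
  omega

theorem dualIdem_mul_flat (i : ℕ) :
    dualIdem G x i * flat G x = flat G x * dualIdem G x i := by
  classical
  ext z y
  simp only [dualIdem, flat, Matrix.diagonal_mul, Matrix.mul_diagonal, Matrix.of_apply,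
    ite_mul_ite]
  refine if_congr ?_ rfl rfl
  constructor
  · rintro ⟨h1, h2, h3⟩; exact ⟨⟨h2, h3⟩, by omega⟩
  · rintro ⟨⟨h1, h2⟩, h3⟩; exact ⟨by omega, h1, h2⟩

theorem dualIdem_mul_weight (i : ℕ) (c : ℂ) :
    dualIdem G x i * weight c G x = (c ^ i)⁻¹ • dualIdem G x i := by
  rw [dualIdem, weight, Matrix.diagonal_mul_diagonal, ← Matrix.diagonal_smul]
  congr 1
  funext y
  by_cases h : G.dist x y = i <;> simp [h]

theorem weight_mul_dualIdem (i : ℕ) (c : ℂ) :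
    weight c G x * dualIdem G x i = (c ^ i)⁻¹ • dualIdem G x i := by
  rw [← dualIdem_mul_weight, dualIdem, weight, Matrix.diagonal_mul_diagonal,
    Matrix.diagonal_mul_diagonal]
  simp_rw [mul_comm]

namespace IsDualPolarGraph

variable (hG : IsDualPolarGraph G x D b s)

include hG

theorem cast_ne_zero : (b : ℂ) ≠ 0 := by
  have := hG.one_lt
  exact_mod_cast (by omega : b ≠ 0)

theorem cast_ne_one : (b : ℂ) ≠ 1 := by
  have := hG.one_lt
  exact_mod_cast (by omega : b ≠ 1)

theorem sq_ne_one : (b : ℂ) ^ 2 ≠ 1 := by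
  have := hG.one_lt
  have h : b ^ 2 ≠ 1 := by
    intro h
    nlinarith
  exact_mod_cast h

theorem dualIdem_eq_zero {i : ℕ} (hi : D < i) : dualIdem G x i = 0 := by
  rw [dualIdem, ← Matrix.diagonal_zero]
  congr 1
  funext y
  have := hG.dist_le y
  exact if_neg (by omega)

theorem sum_dualIdem_smul (f : ℕ → ℂ) : ∑ i ∈ Finset.range (D + 1), f i • dualIdem G x i =
    Matrix.diagonal fun y => f (G.dist x y) := by
  ext z y
  rw [Matrix.sum_apply]
  have := hG.dist_le y
  by_cases h : z = y
  · subst h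
    simp only [dualIdem, Matrix.smul_apply, Matrix.diagonal_apply_eq, smul_eq_mul, mul_ite,
      mul_one, mul_zero]
    rw [Finset.sum_ite_eq, if_pos (by simp; omega)]
  · simp [dualIdem, h]

theorem sum_dualIdem : ∑ i ∈ Finset.range (D + 1), dualIdem G x i = 1 := by
  have := hG.sum_dualIdem_smul 1
  simpa using this

theorem weight_mem : weight b G x ∈ subconstAlg G x := by
  rw [weight, ← hG.sum_dualIdem_smul fun i => ((b : ℂ) ^ i)⁻¹]
  exact Subalgebra.sum_mem _ fun i _ => Subalgebra.smul_mem _ (dualIdem_mem i) _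

theorem flat_eq : flat G x =
    ∑ i ∈ Finset.range (D + 1), dualIdem G x i * adj G * dualIdem G x i := by
  classical
  ext z y
  rw [Matrix.sum_apply]
  simp only [dualIdem, Matrix.diagonal_mul, Matrix.mul_diagonal, adj_apply, flat, Matrix.of_apply,
    ite_mul_ite]
  have := hG.dist_le y
  rw [Finset.sum_eq_single (G.dist x y)]
  · refine if_congr ?_ rfl rfl
    rw [G.adj_comm]; tauto
  · intro i _ hi
    rw [if_neg]
    rintro ⟨-, h⟩
    exact hi h.symm
  · intro h
    simp at h
    omega

theorem flat_mem : flat G x ∈ subconstAlg G x := by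
  rw [hG.flat_eq]
  exact Subalgebra.sum_mem _ fun i _ => mul_mem (mul_mem (dualIdem_mem i) adj_mem) (dualIdem_mem i)

theorem raise_eq : raise G x =
    ∑ i ∈ Finset.range (D + 1), dualIdem G x (i + 1) * adj G * dualIdem G x i := by
  classical
  ext z y
  rw [Matrix.sum_apply]
  simp only [dualIdem, Matrix.diagonal_mul, Matrix.mul_diagonal, adj_apply, raise, Matrix.of_apply,
    ite_mul_ite]
  have := hG.dist_le y
  rw [Finset.sum_eq_single (G.dist x y)]
  · refine if_congr ?_ rfl rfl
    rw [G.adj_comm]; tauto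
  · intro i _ hi
    rw [if_neg]
    rintro ⟨-, h⟩
    exact hi h.symm
  · intro h
    simp at h
    omega

theorem raise_mem : raise G x ∈ subconstAlg G x := by
  rw [hG.raise_eq]
  exact Subalgebra.sum_mem _ fun i _ => mul_mem (mul_mem (dualIdem_mem _) adj_mem) (dualIdem_mem i)

theorem lower_mem : lower G x ∈ subconstAlg G x := by
  have h : lower G x = adj G - raise G x - flat G x := by
    rw [adj_eq (x := x)]; abel
  rw [h]
  exact sub_mem (sub_mem adj_mem hG.raise_mem) hG.flat_mem

theorem idem_mem (i : ℕ) : idem G i ∈ subconstAlg G x :=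
  Algebra.adjoin_le (Set.singleton_subset_iff.2 adj_mem) (hG.spectral.mem i)

/-- The subconstituent algebra is generated by `A` and the dual idempotents. -/
theorem subconstAlg_le {S : Subalgebra ℂ (Matrix V V ℂ)} (hA : adj G ∈ S)
    (hE : ∀ i, dualIdem G x i ∈ S) : subconstAlg G x ≤ S := by
  refine Algebra.adjoin_le ?_
  rintro _ (⟨i, rfl⟩ | ⟨i, rfl⟩)
  · exact Algebra.adjoin_le (Set.singleton_subset_iff.2 hA) (hG.distMatrix_mem i)
  · exact hE i

/-- The weight takes distinct values `b ^ (-i)` on the subconstituents, so interpolation recovers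
each dual idempotent. A subspace invariant under `A` and the weight is therefore a module. -/
theorem dualIdem_mem_adjoin_weight (i : ℕ) :
    dualIdem G x i ∈ Algebra.adjoin ℂ {weight b G x} := by
  by_cases hi : i ≤ D
  · have hinj : Set.InjOn (fun i : ℕ => ((b : ℂ) ^ i)⁻¹) (Finset.range (D + 1)) := by
      intro i _ j _ h
      have h1 := inv_injective h
      exact Nat.pow_right_injective hG.one_lt (by simp only; exact_mod_cast h1)
    have : dualIdem G x i = Polynomial.aeval (weight b G x)
        (Lagrange.basis (Finset.range (D + 1)) (fun i : ℕ => ((b : ℂ) ^ i)⁻¹) i) := by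
      have h1 : weight b G x = Matrix.diagonalAlgHom ℂ fun y => ((b : ℂ) ^ G.dist x y)⁻¹ := rfl
      rw [h1, Polynomial.aeval_algHom_apply, dualIdem]
      change _ = Matrix.diagonal _
      congr 1
      funext y
      rw [Polynomial.aeval_pi_apply]
      beta_reduce
      rw [Polynomial.coe_aeval_eq_eval]
      have h2 := hG.dist_le y
      split_ifs with h
      · rw [h, Lagrange.eval_basis_self hinj (by simp; omega)]
      · exact (Lagrange.eval_basis_of_ne (s := Finset.range (D + 1))
          (v := fun i : ℕ => ((b : ℂ) ^ i)⁻¹) (i := i) (j := G.dist x y) (Ne.symm h)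
          (by simp; omega)).symm
    rw [this]
    exact Polynomial.aeval_mem_adjoin_singleton _ _
  · rw [hG.dualIdem_eq_zero (by omega)]
    exact zero_mem _

theorem isTModule_of_weight (hA : adj G ∈ stab W) (hK : weight b G x ∈ stab W) :
    IsTModule G x W :=
  hG.subconstAlg_le hA fun i =>
    Algebra.adjoin_le (Set.singleton_subset_iff.2 hK) (hG.dualIdem_mem_adjoin_weight i)

theorem mem_centerT_iff {M : Matrix V V ℂ} : M ∈ centerT G x ↔
    M ∈ subconstAlg G x ∧ adj G * M = M * adj G ∧
      ∀ i, dualIdem G x i * M = M * dualIdem G x i := by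
  rw [centerT, Subalgebra.mem_map]
  constructor
  · rintro ⟨⟨M, hM⟩, hc, rfl⟩
    rw [Subalgebra.mem_center_iff] at hc
    exact ⟨hM, congrArg Subtype.val (hc ⟨_, adj_mem⟩),
      fun i => congrArg Subtype.val (hc ⟨_, dualIdem_mem i⟩)⟩
  · rintro ⟨hM, hA, hE⟩
    refine ⟨⟨M, hM⟩, ?_, rfl⟩
    rw [Subalgebra.mem_center_iff]
    rintro ⟨N, hN⟩
    have : subconstAlg G x ≤ Subalgebra.centralizer ℂ {M} := by
      refine hG.subconstAlg_le ?_ fun i => ?_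
      · rw [Subalgebra.mem_centralizer_iff]
        rintro _ rfl
        exact hA.symm
      · rw [Subalgebra.mem_centralizer_iff]
        rintro _ rfl
        exact (hE i).symm
    have h1 := Subalgebra.mem_centralizer_iff ℂ |>.1 (this hN) M rfl
    exact Subtype.ext h1.symm

theorem commute_of_mem_centerT {M N : Matrix V V ℂ} (hM : M ∈ centerT G x)
    (hN : N ∈ subconstAlg G x) : N * M = M * N := by
  obtain ⟨⟨M, hM'⟩, hc, rfl⟩ := hM
  exact congrArg Subtype.val (Subalgebra.mem_center_iff.1 hc ⟨N, hN⟩)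

end IsDualPolarGraph
end Stabilizer
end DualPolar

/-! ### The central element `weightedFlat` -/

namespace DualPolar

open Module

variable {V : Type*} [Fintype V] [DecidableEq V]
  {W : Submodule ℂ (V → ℂ)} {G : SimpleGraph V} {x : V} {D b s : ℕ}

/-- The flat matrix, shifted by a scalar so that it `b`-commutes with raising and lowering. -/
def shiftedFlat (G : SimpleGraph V) (x : V) (b s : ℕ) : Matrix V V ℂ :=
  flat G x + (((s : ℂ) - 1) / (b - 1)) • 1

/-- The weighted flat matrix, a central element of the subconstituent algebra. -/
def weightedFlat (G : SimpleGraph V) (x : V) (b s : ℕ) : Matrix V V ℂ :=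
  weight b G x * shiftedFlat G x b s

namespace IsDualPolarGraph

variable (hG : IsDualPolarGraph G x D b s)

include hG

/-- The shift is the solution `c` of `(s - 1) + c = b * c`, which absorbs the linear term of
`flat_raise`. The same shift removes the constant term from the eigenvalues, see `dpEigenvalue_add`.
-/
theorem shiftedFlat_mul_raise :
    shiftedFlat G x b s * raise G x = (b : ℂ) • (raise G x * shiftedFlat G x b s) := by
  have h1 : (b : ℂ) - 1 ≠ 0 := sub_ne_zero.2 hG.cast_ne_one
  rw [shiftedFlat, add_mul, hG.flat_raise, mul_add, smul_add, smul_mul_assoc, one_mul,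
    mul_smul_comm, mul_one, smul_smul, add_assoc, ← add_smul]
  congr 2
  field_simp
  ring

theorem transpose_shiftedFlat : (shiftedFlat G x b s)ᵀ = shiftedFlat G x b s := by
  rw [shiftedFlat, Matrix.transpose_add, transpose_flat, Matrix.transpose_smul,
    Matrix.transpose_one]

theorem shiftedFlat_mul_lower :
    shiftedFlat G x b s * lower G x = (b : ℂ)⁻¹ • (lower G x * shiftedFlat G x b s) := by
  have h := congrArg Matrix.transpose hG.shiftedFlat_mul_raise
  rw [Matrix.transpose_smul, Matrix.transpose_mul, Matrix.transpose_mul, transpose_raise,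
    hG.transpose_shiftedFlat] at h
  rw [h, smul_smul, inv_mul_cancel₀ hG.cast_ne_zero, one_smul]

theorem shiftedFlat_mul_weight :
    shiftedFlat G x b s * weight b G x = weight b G x * shiftedFlat G x b s := by
  rw [shiftedFlat, add_mul, mul_add, flat_mul_weight, smul_mul_assoc, mul_smul_comm, one_mul,
    mul_one]

theorem dualIdem_mul_shiftedFlat (i : ℕ) :
    dualIdem G x i * shiftedFlat G x b s = shiftedFlat G x b s * dualIdem G x i := by
  rw [shiftedFlat, add_mul, mul_add, dualIdem_mul_flat, smul_mul_assoc, mul_smul_comm, one_mul,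
    mul_one]

theorem shiftedFlat_mem : shiftedFlat G x b s ∈ subconstAlg G x :=
  add_mem hG.flat_mem (Subalgebra.smul_mem _ (one_mem _) _)

/-- The weighted flat matrix is central. -/
theorem weightedFlat_mem : weightedFlat G x b s ∈ centerT G x := by
  have hb := hG.cast_ne_zero
  rw [hG.mem_centerT_iff]
  refine ⟨mul_mem hG.weight_mem hG.shiftedFlat_mem, ?_, fun i => ?_⟩
  -- The factors `b` from moving the raising matrix past the weight and past the shifted flat matrix
  -- agree, and likewise `b⁻¹` for lowering.
  · rw [weightedFlat, adj_eq (x := x), add_mul, add_mul, mul_add, mul_add, mul_assoc _ _ (raise G x),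
      mul_assoc _ _ (lower G x), hG.shiftedFlat_mul_raise, hG.shiftedFlat_mul_lower,
      ← mul_assoc (raise G x), ← mul_assoc (lower G x), raise_mul_weight hb, lower_mul_weight hb,
      mul_smul_comm, mul_smul_comm, smul_mul_assoc, smul_mul_assoc, mul_assoc, mul_assoc]
    congr 1
    have : flat G x = shiftedFlat G x b s - (((s : ℂ) - 1) / (b - 1)) • 1 := by
      rw [shiftedFlat]; abel
    rw [this]
    simp only [sub_mul, mul_sub, smul_mul_assoc, mul_smul_comm, one_mul, mul_one]
    rw [← mul_assoc, hG.shiftedFlat_mul_weight]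
  · rw [weightedFlat, mul_assoc, ← hG.dualIdem_mul_shiftedFlat, ← mul_assoc, ← mul_assoc,
      dualIdem_mul_weight, weight_mul_dualIdem]

theorem weight_inv_mul : weight (b : ℂ)⁻¹ G x * weight b G x = 1 := by
  rw [weight, weight, Matrix.diagonal_mul_diagonal, ← Matrix.diagonal_one]
  congr 1
  funext y
  rw [inv_pow, inv_inv, mul_inv_cancel₀ (pow_ne_zero _ hG.cast_ne_zero)]

theorem dpEigenvalue_add (i : ℕ) :
    (dpEigenvalue b s D i : ℂ) + ((s : ℂ) - 1) / (b - 1) =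
      ((s : ℂ) * (b : ℂ) ^ (D - i) - (b : ℂ) ^ i) / (b - 1) := by
  have h1 : (b : ℂ) - 1 ≠ 0 := sub_ne_zero.2 hG.cast_ne_one
  rw [dpEigenvalue_eq hG.one_lt]
  push_cast
  field_simp
  ring

/-- The shifted eigenvalues are combinations of `b ^ i` and `b ^ (-i)`, so with `β = b + b⁻¹` the
expression `φ ^ 2 - β φ ψ + ψ ^ 2` is the same for all consecutive pairs, and the tridiagonal
relation applies. What is used later is `c₁ ≠ 0`, which lets `L R R` be eliminated. -/
theorem lower_raise_raise : ∃ c₁ c₂ c₃ c₄ : ℂ, c₁ ≠ 0 ∧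
    c₁ • (lower G x * raise G x * raise G x) + c₂ • (raise G x * lower G x * raise G x) +
      c₃ • (raise G x * raise G x * lower G x) = c₄ • raise G x := by
  have hb := hG.cast_ne_zero
  have h1 : (b : ℂ) - 1 ≠ 0 := sub_ne_zero.2 hG.cast_ne_one
  refine ⟨_, _, _, _, ?_, cubic_relation (ρ := s * (b : ℂ) ^ (D - 1) * (b + 1) ^ 2 / b) hb
    hG.sq_ne_one hG.weight_inv_mul (raise_mul_weight hb) (lower_mul_weight hb)
    hG.shiftedFlat_mul_weight hG.shiftedFlat_mul_raise hG.shiftedFlat_mul_lower ?_⟩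
  · rw [inv_pow, sub_ne_zero]
    exact fun h => hG.sq_ne_one (inv_eq_one.1 h)
  · intro A hA
    refine hG.spectral.tridiagonal_relation (((s : ℂ) - 1) / (b - 1)) (b + (b : ℂ)⁻¹) _ ?_ A ?_
    · intro i hi
      rw [hG.dpEigenvalue_add i, hG.dpEigenvalue_add (i + 1)]
      have h2 : D - 1 = (D - (i + 1)) + i := by omega
      have h3 : D - i = (D - (i + 1)) + 1 := by omega
      rw [h2, h3, pow_add, pow_succ, pow_succ]
      field_simp
      ring
    · rw [hA, shiftedFlat, adj_eq (x := x)]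
      abel

end IsDualPolarGraph
end DualPolar

/-! ### Schur's lemma and endpoint vectors -/

namespace DualPolar

open Module

variable {V : Type*} [Fintype V] [DecidableEq V]
  {W : Submodule ℂ (V → ℂ)} {G : SimpleGraph V} {x : V} {D b s : ℕ}

theorem exists_eigenvector_of_mem_stab {M : Matrix V V ℂ} (hW : W ≠ ⊥) (hM : M ∈ stab W) :
    ∃ v ∈ W, v ≠ 0 ∧ ∃ μ : ℂ, M *ᵥ v = μ • v := by
  have : Nontrivial W := (Submodule.nontrivial_iff_ne_bot).2 hW
  obtain ⟨μ, hμ⟩ := Module.End.exists_eigenvalue ((Matrix.mulVecLin M).restrict hM)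
  obtain ⟨v, hv⟩ := hμ.exists_hasEigenvector
  refine ⟨v, v.2, fun h => hv.2 (Subtype.ext h), μ, ?_⟩
  exact congrArg Subtype.val hv.apply_eq_smul

theorem IsIrredTModule.eq_of_le (hW : IsIrredTModule G x W) {W' : Submodule ℂ (V → ℂ)}
    (hle : W' ≤ W) (hT : IsTModule G x W') {v : V → ℂ} (hv : v ∈ W') (h0 : v ≠ 0) : W' = W :=
  (hW.2.2 W' hle hT).resolve_left fun h => h0 (by rwa [h, Submodule.mem_bot] at hv)

/-- If the matrices `P i` separate the vectors `f i`, which span `W`, then the trace on `W` is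
the sum of the diagonal coefficients. -/
theorem trace_restrict_eq_sum {I : Finset ℕ} {M : Matrix V V ℂ} (hM : M ∈ stab W)
    (f : ℕ → V → ℂ) (P : ℕ → Matrix V V ℂ) (μ : ℕ → ℂ)
    (hspan : Submodule.span ℂ (f '' I) = W) (hf : ∀ i ∈ I, f i ≠ 0)
    (hP : ∀ i ∈ I, P i *ᵥ f i = f i) (hP' : ∀ i ∈ I, ∀ j ∈ I, i ≠ j → P i *ᵥ f j = 0)
    (hμ : ∀ i ∈ I, P i *ᵥ (M *ᵥ f i) = μ i • f i) :
    LinearMap.trace ℂ W ((Matrix.mulVecLin M).restrict hM) = ∑ i ∈ I, μ i := by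
  classical
  have hcoef : ∀ (c : I → ℂ) (i : I), P i *ᵥ (∑ j, c j • f j) = c i • f i := by
    intro c i
    rw [Matrix.mulVec_sum, Finset.sum_eq_single i, Matrix.mulVec_smul, hP i i.2]
    · intro j _ hj
      rw [Matrix.mulVec_smul, hP' i i.2 j j.2 (fun h => hj (Subtype.ext h.symm)), smul_zero]
    · simp
  have hmem : ∀ i : I, f i ∈ W := fun i => hspan ▸ Submodule.subset_span ⟨i, i.2, rfl⟩
  have hli : LinearIndependent ℂ fun i : I => (⟨f i, hmem i⟩ : W) := by
    rw [Fintype.linearIndependent_iff]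
    intro c hc i
    have h1 : ∑ j : I, c j • f j = 0 := by
      have := congrArg Subtype.val hc
      simpa using this
    have h2 := hcoef c i
    rw [h1, Matrix.mulVec_zero] at h2
    exact (smul_eq_zero.1 h2.symm).resolve_right (hf i i.2)
  have hsp : ⊤ ≤ Submodule.span ℂ (Set.range fun i : I => (⟨f i, hmem i⟩ : W)) := by
    intro w _
    have h1 : (Submodule.span ℂ (Set.range fun i : I => (⟨f i, hmem i⟩ : W))).map W.subtype =
        W := by
      rw [Submodule.map_span, ← Set.range_comp]
      conv_rhs => rw [← hspan]
      congr 1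
      ext u
      simp
    have h2 : (w : V → ℂ) ∈
        (Submodule.span ℂ (Set.range fun i : I => (⟨f i, hmem i⟩ : W))).map W.subtype := by
      rw [h1]; exact w.2
    obtain ⟨u, hu, hw⟩ := h2
    rwa [Subtype.ext hw] at hu
  let B : Basis I ℂ W := Basis.mk hli hsp
  rw [LinearMap.trace_eq_matrix_trace ℂ B, Matrix.trace, ← Finset.sum_coe_sort I μ]
  refine Finset.sum_congr rfl fun i _ => ?_
  rw [Matrix.diag_apply, LinearMap.toMatrix_apply]
  have hB : ∀ j, (B j : V → ℂ) = f j := fun j => by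
    simp [B]
  have h1 := hμ i i.2
  have h2 : M *ᵥ f i = ∑ j, B.repr (((Matrix.mulVecLin M).restrict hM) (B i)) j • f j := by
    have := (congrArg Subtype.val
      (B.sum_repr (((Matrix.mulVecLin M).restrict hM) (B i)))).symm
    change M *ᵥ (B i : V → ℂ) = _ at this
    rw [hB] at this
    refine this.trans ?_
    simp [hB]
  rw [h2, hcoef] at h1
  exact smul_left_injective ℂ (hf i i.2) h1

namespace IsDualPolarGraph

variable (hG : IsDualPolarGraph G x D b s)

include hG

/-- Schur's lemma for central elements. -/
theorem exists_smul_of_mem_centerT (hW : IsIrredTModule G x W) {M : Matrix V V ℂ}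
    (hM : M ∈ centerT G x) : ∃ μ : ℂ, ∀ w ∈ W, M *ᵥ w = μ • w := by
  obtain ⟨v, hv, h0, μ, hμ⟩ := exists_eigenvector_of_mem_stab hW.2.1
    (hW.1 M (hG.mem_centerT_iff.1 hM).1)
  refine ⟨μ, ?_⟩
  let W' : Submodule ℂ (V → ℂ) := W ⊓ LinearMap.ker (Matrix.mulVecLin (M - μ • 1))
  have hW' : ∀ w, w ∈ W' ↔ w ∈ W ∧ M *ᵥ w = μ • w := by
    intro w
    rw [Submodule.mem_inf, LinearMap.mem_ker, Matrix.mulVecLin_apply, Matrix.sub_mulVec,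
      Matrix.smul_mulVec, Matrix.one_mulVec, sub_eq_zero]
  have : W' = W := by
    refine hW.eq_of_le inf_le_left ?_ ((hW' v).2 ⟨hv, hμ⟩) h0
    intro N hN w hw
    rw [hW'] at hw ⊢
    refine ⟨hW.1 N hN w hw.1, ?_⟩
    rw [Matrix.mulVec_mulVec, ← hG.commute_of_mem_centerT hM hN, ← Matrix.mulVec_mulVec, hw.2,
      Matrix.mulVec_smul]
  intro w hw
  rw [← this, hW'] at hw
  exact hw.2

theorem exists_dualIdem_ne_zero (hW : W ≠ ⊥) : ∃ i, ∃ w ∈ W, dualIdem G x i *ᵥ w ≠ 0 := by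
  obtain ⟨w, hw, h0⟩ := Submodule.exists_mem_ne_zero_of_ne_bot hW
  by_contra! h
  apply h0
  rw [← Matrix.one_mulVec w, ← hG.sum_dualIdem, Matrix.sum_mulVec]
  exact Finset.sum_eq_zero fun i _ => h i w hw

/-- A vector at the endpoint of `W` from which `W` is generated by raising. -/
theorem exists_endpoint_vector (hW : IsIrredTModule G x W) : ∃ v ∈ W, v ≠ 0 ∧
    dualIdem G x (endpoint G x W) *ᵥ v = v ∧ lower G x *ᵥ v = 0 ∧
    ∃ μ : ℂ, lower G x *ᵥ (raise G x *ᵥ v) = μ • v := by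
  have hne := hG.exists_dualIdem_ne_zero hW.2.1
  have hr : endpoint G x W ∈ {i : ℕ | ∃ w ∈ W, dualIdem G x i *ᵥ w ≠ 0} := Nat.sInf_mem hne
  have hlt : ∀ i < endpoint G x W, ∀ w ∈ W, dualIdem G x i *ᵥ w = 0 := by
    intro i hi w hw
    by_contra h
    exact Nat.notMem_of_lt_sInf hi ⟨w, hw, h⟩
  generalize endpoint G x W = r at hr hlt
  obtain ⟨w, hw, h0⟩ := hr
  let W' : Submodule ℂ (V → ℂ) := W ⊓ LinearMap.ker (Matrix.mulVecLin (dualIdem G x r - 1))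
  have hW' : ∀ w, w ∈ W' ↔ w ∈ W ∧ dualIdem G x r *ᵥ w = w := by
    intro w
    rw [Submodule.mem_inf, LinearMap.mem_ker, Matrix.mulVecLin_apply, Matrix.sub_mulVec,
      Matrix.one_mulVec, sub_eq_zero]
  have hbot : W' ≠ ⊥ := by
    rw [Submodule.ne_bot_iff]
    refine ⟨_, (hW' _).2 ⟨hW.1 _ (dualIdem_mem r) w hw, ?_⟩, h0⟩
    rw [Matrix.mulVec_mulVec, dualIdem_mul_self]
  -- `W'` is the part of `W` on the subconstituent at the endpoint. Raising and then lowering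
  -- returns to it, so an eigenvector exists there; lowering kills it because the endpoint is
  -- minimal.
  have hst : lower G x * raise G x ∈ stab W' := by
    intro w hw
    rw [hW'] at hw ⊢
    refine ⟨hW.1 _ (mul_mem hG.lower_mem hG.raise_mem) w hw.1, ?_⟩
    rw [Matrix.mulVec_mulVec, ← mul_assoc, dualIdem_mul_lower, mul_assoc, dualIdem_mul_raise,
      ← mul_assoc, ← Matrix.mulVec_mulVec, hw.2]
  obtain ⟨v, hv, hv0, μ, hμ⟩ := exists_eigenvector_of_mem_stab hbot hst
  rw [hW'] at hv
  refine ⟨v, hv.1, hv0, hv.2, ?_, μ, by rw [Matrix.mulVec_mulVec, hμ]⟩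
  rcases r with _ | r
  · rw [← hv.2, Matrix.mulVec_mulVec, lower_mul_dualIdem_zero, Matrix.zero_mulVec]
  · rw [← hv.2, Matrix.mulVec_mulVec, ← dualIdem_mul_lower, ← Matrix.mulVec_mulVec]
    exact hlt r (Nat.lt_succ_self r) _ (hW.1 _ hG.lower_mem v hv.1)

/-- In the relation for `L R R` applied to `R ^ k v`, the terms from `R L R` and `R R L` are
multiples of `R ^ (k + 1) v` by induction. The induction has to carry two consecutive cases. -/
theorem lower_raise_pow {v : V → ℂ} (h0 : lower G x *ᵥ v = 0) {μ : ℂ}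
    (h1 : lower G x *ᵥ (raise G x *ᵥ v) = μ • v) (k : ℕ) : ∃ ν : ℂ,
    lower G x *ᵥ (raise G x ^ (k + 1) *ᵥ v) = ν • (raise G x ^ k *ᵥ v) := by
  obtain ⟨c₁, c₂, c₃, c₄, hc, hrel⟩ := hG.lower_raise_raise
  have hstep : ∀ (u : V → ℂ) (μ ν : ℂ), lower G x *ᵥ (raise G x *ᵥ u) = μ • u →
      raise G x *ᵥ (raise G x *ᵥ (lower G x *ᵥ u)) = ν • (raise G x *ᵥ u) →
      ∃ μ' : ℂ, lower G x *ᵥ (raise G x *ᵥ (raise G x *ᵥ u)) = μ' • (raise G x *ᵥ u) := by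
    intro u μ ν h1 h2
    have h := congrArg (fun M => M *ᵥ u) hrel
    simp only [Matrix.add_mulVec, Matrix.smul_mulVec, ← Matrix.mulVec_mulVec, h1, h2,
      Matrix.mulVec_smul] at h
    refine ⟨c₁⁻¹ * (c₄ - c₂ * μ - c₃ * ν), ?_⟩
    rw [← smul_right_inj hc, smul_smul, ← mul_assoc, mul_inv_cancel₀ hc, one_mul,
      sub_smul, sub_smul, mul_smul, mul_smul, ← h]
    abel
  have hpow : ∀ k, raise G x ^ (k + 1) *ᵥ v = raise G x *ᵥ (raise G x ^ k *ᵥ v) := by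
    intro k
    rw [pow_succ', Matrix.mulVec_mulVec]
  suffices ∀ k, (∃ ν : ℂ, lower G x *ᵥ (raise G x ^ (k + 1) *ᵥ v) = ν • (raise G x ^ k *ᵥ v)) ∧
      ∃ ν : ℂ, lower G x *ᵥ (raise G x ^ (k + 2) *ᵥ v) = ν • (raise G x ^ (k + 1) *ᵥ v) from
    (this k).1
  intro k
  induction k with
  | zero =>
    refine ⟨⟨μ, by simpa using h1⟩, ?_⟩
    obtain ⟨μ', h⟩ := hstep v μ 0 h1 (by simp [h0])
    exact ⟨μ', by simpa [hpow] using h⟩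
  | succ k ih =>
    refine ⟨ih.2, ?_⟩
    obtain ⟨⟨ν, h2⟩, ⟨ν', h3⟩⟩ := ih
    obtain ⟨μ', h⟩ := hstep (raise G x ^ (k + 1) *ᵥ v) ν' ν (by rw [← hpow]; exact h3)
      (by rw [h2, Matrix.mulVec_smul, Matrix.mulVec_smul, ← hpow, ← hpow])
    exact ⟨μ', by rw [hpow (k + 2), hpow (k + 1)]; exact h⟩

end IsDualPolarGraph
end DualPolar

/-! ### Two spanning families of an irreducible module -/

namespace DualPolar

open Module

variable {V : Type*} [Fintype V] [DecidableEq V]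
  {W : Submodule ℂ (V → ℂ)} {G : SimpleGraph V} {x : V} {D b s : ℕ}

theorem raise_pow_succ_mulVec (v : V → ℂ) (k : ℕ) :
    raise G x ^ (k + 1) *ᵥ v = raise G x *ᵥ (raise G x ^ k *ᵥ v) := by
  rw [pow_succ', Matrix.mulVec_mulVec]

theorem dualIdem_mulVec_raise_pow {v : V → ℂ} {r : ℕ} (hv : dualIdem G x r *ᵥ v = v) (k : ℕ) :
    dualIdem G x (r + k) *ᵥ (raise G x ^ k *ᵥ v) = raise G x ^ k *ᵥ v := by
  induction k with
  | zero => simpa using hv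
  | succ k ih =>
    rw [raise_pow_succ_mulVec, ← add_assoc, Matrix.mulVec_mulVec, dualIdem_mul_raise,
      ← Matrix.mulVec_mulVec, ih]

theorem dualIdem_mulVec_raise_pow_ne {v : V → ℂ} {r : ℕ} (hv : dualIdem G x r *ᵥ v = v) {i k : ℕ}
    (h : i ≠ r + k) : dualIdem G x i *ᵥ (raise G x ^ k *ᵥ v) = 0 := by
  rw [← dualIdem_mulVec_raise_pow hv, Matrix.mulVec_mulVec, dualIdem_mul_ne h, Matrix.zero_mulVec]

namespace IsDualPolarGraph

variable (hG : IsDualPolarGraph G x D b s)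

include hG

/-- On the subconstituent at distance `i` the weight is the scalar `b ^ (-i)`, so there the flat
matrix is determined by the central element. -/
theorem flat_mulVec_of_weightedFlat {u : V → ℂ} {μ : ℂ} {i : ℕ} (hu : dualIdem G x i *ᵥ u = u)
    (h : weightedFlat G x b s *ᵥ u = μ • u) :
    flat G x *ᵥ u = (μ * (b : ℂ) ^ i - ((s : ℂ) - 1) / (b - 1)) • u := by
  have hb : (b : ℂ) ^ i ≠ 0 := pow_ne_zero _ hG.cast_ne_zero
  have h1 : weightedFlat G x b s *ᵥ u = ((b : ℂ) ^ i)⁻¹ • (shiftedFlat G x b s *ᵥ u) := by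
    conv_lhs => rw [← hu]
    rw [weightedFlat, Matrix.mulVec_mulVec, mul_assoc, ← hG.dualIdem_mul_shiftedFlat, ← mul_assoc,
      weight_mul_dualIdem, smul_mul_assoc, Matrix.smul_mulVec, hG.dualIdem_mul_shiftedFlat,
      ← Matrix.mulVec_mulVec, hu]
  have h2 : shiftedFlat G x b s *ᵥ u = (μ * (b : ℂ) ^ i) • u := by
    rw [mul_comm, mul_smul, ← h, h1, smul_smul, mul_inv_cancel₀ hb, one_smul]
  rw [sub_smul, ← h2, shiftedFlat, Matrix.add_mulVec, Matrix.smul_mulVec, Matrix.one_mulVec]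
  abel

/-- An irreducible module is spanned by the vectors obtained from an endpoint vector by
raising. -/
theorem span_raise_pow (hW : IsIrredTModule G x W) {v : V → ℂ} (hv : v ∈ W) (h0 : v ≠ 0) {r : ℕ}
    (hr : dualIdem G x r *ᵥ v = v) (hL : lower G x *ᵥ v = 0) {ν : ℂ}
    (hLR : lower G x *ᵥ (raise G x *ᵥ v) = ν • v) :
    Submodule.span ℂ (Set.range fun k : ℕ => raise G x ^ k *ᵥ v) = W := by
  have hmem : ∀ k, raise G x ^ k *ᵥ v ∈ W := fun k => hW.1 _ (pow_mem hG.raise_mem k) v hv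
  obtain ⟨μ, hμ⟩ := hG.exists_smul_of_mem_centerT hW hG.weightedFlat_mem
  have hin : ∀ k, raise G x ^ k *ᵥ v ∈
      Submodule.span ℂ (Set.range fun k : ℕ => raise G x ^ k *ᵥ v) :=
    fun k => Submodule.subset_span ⟨k, rfl⟩
  refine hW.eq_of_le (Submodule.span_le.2 (by rintro _ ⟨k, rfl⟩; exact hmem k)) ?_
    (v := v) (by simpa using hin 0) h0
  refine isTModule_iff_le.2 (hG.subconstAlg_le ?_ fun i => ?_)
  · refine mem_stab_span ?_
    rintro _ ⟨k, rfl⟩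
    rw [adj_eq (x := x), Matrix.add_mulVec, Matrix.add_mulVec]
    refine Submodule.add_mem _ (Submodule.add_mem _ ?_ ?_) ?_
    · simp only [← raise_pow_succ_mulVec]
      exact hin (k + 1)
    · rcases k with _ | k
      · simp [hL]
      · obtain ⟨ν', h⟩ := hG.lower_raise_pow hL hLR k
        simp only [h]
        exact Submodule.smul_mem _ _ (hin k)
    · simp only [hG.flat_mulVec_of_weightedFlat (dualIdem_mulVec_raise_pow hr k) (hμ _ (hmem k))]
      exact Submodule.smul_mem _ _ (hin k)
  · refine mem_stab_span ?_
    rintro _ ⟨k, rfl⟩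
    by_cases h : i = r + k
    · subst h
      simp only [dualIdem_mulVec_raise_pow hr]
      exact hin k
    · simp only [dualIdem_mulVec_raise_pow_ne hr h]
      exact Submodule.zero_mem _

/-- An irreducible module is generated by an endpoint vector under the adjacency algebra. -/
theorem span_idem_mulVec (hW : IsIrredTModule G x W) {v : V → ℂ} (hv : v ∈ W) (h0 : v ≠ 0) {r : ℕ}
    (hr : dualIdem G x r *ᵥ v = v) (hL : lower G x *ᵥ v = 0) {ν : ℂ}
    (hLR : lower G x *ᵥ (raise G x *ᵥ v) = ν • v) :
    Submodule.span ℂ ((fun i => idem G i *ᵥ v) '' {i | idem G i *ᵥ v ≠ 0}) = W := by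
  have hmem : ∀ k, raise G x ^ k *ᵥ v ∈ W := fun k => hW.1 _ (pow_mem hG.raise_mem k) v hv
  obtain ⟨μ, hμ⟩ := hG.exists_smul_of_mem_centerT hW hG.weightedFlat_mem
  have hA : adj G ∈ stab (Submodule.span ℂ ((fun i => idem G i *ᵥ v) ''
      {i | idem G i *ᵥ v ≠ 0})) := by
    refine mem_stab_span ?_
    rintro _ ⟨i, hi, rfl⟩
    have hiD : i ≤ D := by
      by_contra h
      exact hi (by rw [hG.spectral.eq_zero i (by omega), Matrix.zero_mulVec])
    simp only [Matrix.mulVec_mulVec, hG.spectral.mul_left i hiD, Matrix.smul_mulVec]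
    exact Submodule.smul_mem _ _ (Submodule.subset_span ⟨i, hi, rfl⟩)
  have hstep : ∀ k, raise G x ^ k *ᵥ v ∈ Submodule.span ℂ ((fun i => idem G i *ᵥ v) ''
      {i | idem G i *ᵥ v ≠ 0}) := by
    intro k
    induction k using Nat.strong_induction_on with
    | _ k ih =>
      rcases k with _ | k
      · rw [pow_zero, ← hG.spectral.sum, Matrix.sum_mulVec]
        refine Submodule.sum_mem _ fun i _ => ?_
        by_cases h : idem G i *ᵥ v = 0
        · rw [h]; exact Submodule.zero_mem _
        · exact Submodule.subset_span ⟨i, h, rfl⟩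
      -- The last two terms are multiples of earlier vectors of the string, so each `R ^ k v` is a
      -- polynomial in `A` applied to `v`.
      · have h1 : raise G x ^ (k + 1) *ᵥ v = adj G *ᵥ (raise G x ^ k *ᵥ v) -
            lower G x *ᵥ (raise G x ^ k *ᵥ v) - flat G x *ᵥ (raise G x ^ k *ᵥ v) := by
          rw [adj_eq (x := x), Matrix.add_mulVec, Matrix.add_mulVec, raise_pow_succ_mulVec]
          abel
        rw [h1, hG.flat_mulVec_of_weightedFlat (dualIdem_mulVec_raise_pow hr k) (hμ _ (hmem k))]
        refine Submodule.sub_mem _ (Submodule.sub_mem _ (hA _ (ih k (by omega))) ?_)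
          (Submodule.smul_mem _ _ (ih k (by omega)))
        rcases k with _ | k
        · simp [hL]
        · obtain ⟨ν', h⟩ := hG.lower_raise_pow hL hLR k
          rw [h]
          exact Submodule.smul_mem _ _ (ih k (by omega))
  refine le_antisymm (Submodule.span_le.2 ?_) ?_
  · rintro _ ⟨i, -, rfl⟩
    exact hW.1 _ (hG.idem_mem i) v hv
  · rw [← hG.span_raise_pow hW hv h0 hr hL hLR, Submodule.span_le]
    rintro _ ⟨k, rfl⟩
    exact hstep k

theorem idem_mul_ne {i j : ℕ} (h : i ≠ j) : idem G i * idem G j = 0 := by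
  by_cases hi : i ≤ D
  · by_cases hj : j ≤ D
    · have h1 : idem G i * adj G * idem G j = idem G i * (adj G * idem G j) := mul_assoc _ _ _
      rw [hG.spectral.mul_right i hi, hG.spectral.mul_left j hj, smul_mul_assoc, mul_smul_comm,
        ← sub_eq_zero, ← sub_smul] at h1
      refine (smul_eq_zero.1 h1).resolve_left fun h2 => h ?_
      exact hG.spectral.inj i hi j hj (by exact_mod_cast sub_eq_zero.1 h2)
    · rw [hG.spectral.eq_zero j (by omega), mul_zero]
  · rw [hG.spectral.eq_zero i (by omega), zero_mul]

theorem idem_mul_self (i : ℕ) : idem G i * idem G i = idem G i := by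
  by_cases hi : i ≤ D
  · conv_rhs => rw [← mul_one (idem G i), ← hG.spectral.sum, Finset.mul_sum]
    rw [Finset.sum_eq_single i]
    · intro j _ h
      exact hG.idem_mul_ne h.symm
    · intro h
      simp at h
      omega
  · rw [hG.spectral.eq_zero i (by omega), zero_mul]

/-- The eigenvalues of `A` on an irreducible module are consecutive. -/
theorem idem_mulVec_ne_zero_of_between (hW : IsIrredTModule G x W) {v : V → ℂ}
    (hspan : Submodule.span ℂ ((fun i => idem G i *ᵥ v) '' {i | idem G i *ᵥ v ≠ 0}) = W)
    {i j k : ℕ} (hij : i < j) (hjk : j < k) (hi : idem G i *ᵥ v ≠ 0) (hk : idem G k *ᵥ v ≠ 0) :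
    idem G j *ᵥ v ≠ 0 := by
  intro hj
  have hD : ∀ l, idem G l *ᵥ v ≠ 0 → l ≤ D := by
    intro l hl
    by_contra h
    exact hl (by rw [hG.spectral.eq_zero l (by omega), Matrix.zero_mulVec])
  have hin : ∀ l, idem G l *ᵥ v ≠ 0 → idem G l *ᵥ v ∈ W := fun l hl =>
    hspan ▸ Submodule.subset_span ⟨l, hl, rfl⟩
  have hEW : ∀ w ∈ W, ∀ l, ∃ c : ℂ, idem G l *ᵥ w = c • (idem G l *ᵥ v) := by
    intro w hw l
    rw [← hspan] at hw
    induction hw using Submodule.span_induction with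
    | mem w hw =>
      obtain ⟨m, -, rfl⟩ := hw
      by_cases h : l = m
      · subst h
        exact ⟨1, by rw [one_smul, Matrix.mulVec_mulVec, hG.idem_mul_self]⟩
      · exact ⟨0, by rw [zero_smul, Matrix.mulVec_mulVec, hG.idem_mul_ne h, Matrix.zero_mulVec]⟩
    | zero => exact ⟨0, by simp⟩
    | add u w _ _ hu hw =>
      obtain ⟨c, hc⟩ := hu
      obtain ⟨d, hd⟩ := hw
      exact ⟨c + d, by rw [Matrix.mulVec_add, hc, hd, add_smul]⟩
    | smul a w _ hw =>
      obtain ⟨c, hc⟩ := hw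
      exact ⟨a * c, by rw [Matrix.mulVec_smul, hc, mul_smul]⟩
  -- If `E_j v = 0`, tridiagonality prevents the weight from crossing the gap at `j`. The part below
  -- the gap is then a nonzero submodule, hence all of `W`, although `E_k` kills it and not `v`.
  let S := (fun l => idem G l *ᵥ v) '' {l | idem G l *ᵥ v ≠ 0 ∧ l < j}
  have hS : Submodule.span ℂ S = W := by
    refine hW.eq_of_le (Submodule.span_le.2 ?_) ?_ (v := idem G i *ᵥ v)
      (Submodule.subset_span ⟨i, ⟨hi, hij⟩, rfl⟩) hi
    · rintro _ ⟨l, hl, rfl⟩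
      exact hin l hl.1
    · refine hG.isTModule_of_weight (mem_stab_span ?_) (mem_stab_span ?_)
      · rintro _ ⟨l, hl, rfl⟩
        simp only [Matrix.mulVec_mulVec, hG.spectral.mul_left l (hD l hl.1), Matrix.smul_mulVec]
        exact Submodule.smul_mem _ _ (Submodule.subset_span ⟨l, hl, rfl⟩)
      · rintro _ ⟨l, hl, rfl⟩
        have h1 : weight b G x *ᵥ (idem G l *ᵥ v) = ∑ m ∈ Finset.range (D + 1),
            idem G m *ᵥ (weight b G x *ᵥ (idem G l *ᵥ v)) := by
          rw [← Matrix.sum_mulVec, hG.spectral.sum, Matrix.one_mulVec]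
        simp only
        rw [h1]
        refine Submodule.sum_mem _ fun m hm => ?_
        rw [Finset.mem_range] at hm
        by_cases hlm : l + 1 < m
        · rw [Matrix.mulVec_mulVec, Matrix.mulVec_mulVec, hG.spectral.tridiag m (by omega) l
            (hD l hl.1) (Or.inr hlm), Matrix.zero_mulVec]
          exact Submodule.zero_mem _
        · obtain ⟨c, hc⟩ := hEW _ (hW.1 _ hG.weight_mem _ (hin l hl.1)) m
          rw [hc]
          refine Submodule.smul_mem _ _ ?_
          by_cases hm0 : idem G m *ᵥ v = 0
          · rw [hm0]; exact Submodule.zero_mem _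
          · refine Submodule.subset_span ⟨m, ⟨hm0, ?_⟩, rfl⟩
            have := hl.2
            have : m ≠ j := fun h => hm0 (h ▸ hj)
            omega
  have hkill : ∀ w ∈ W, idem G k *ᵥ w = 0 := by
    intro w hw
    rw [← hS] at hw
    have : Submodule.span ℂ S ≤ LinearMap.ker (Matrix.mulVecLin (idem G k)) := by
      rw [Submodule.span_le]
      rintro _ ⟨l, hl, rfl⟩
      have := hl.2
      rw [SetLike.mem_coe, LinearMap.mem_ker, Matrix.mulVecLin_apply, Matrix.mulVec_mulVec,
        hG.idem_mul_ne (by omega), Matrix.zero_mulVec]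
    exact this hw
  apply hk
  rw [← hG.idem_mul_self, ← Matrix.mulVec_mulVec]
  exact hkill _ (hin k hk)

end IsDualPolarGraph
end DualPolar

/-! ### The scalar of `weightedFlat` on an irreducible module -/

namespace DualPolar

open Module

variable {V : Type*} [Fintype V] [DecidableEq V]
  {W : Submodule ℂ (V → ℂ)} {G : SimpleGraph V} {x : V} {D b s : ℕ}

theorem exists_eq_image_add_range {S : Set ℕ} (hne : S.Nonempty) {n : ℕ} (hn : ∀ i ∈ S, i ≤ n)
    (hS : ∀ i j k, i < j → j < k → i ∈ S → k ∈ S → j ∈ S) :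
    ∃ m, 0 < m ∧ S = (fun i => sInf S + i) '' (Finset.range m : Finset ℕ) := by
  have hmin := Nat.sInf_mem hne
  have hle : ∀ i ∈ S, sInf S ≤ i := fun i hi => Nat.sInf_le hi
  have hmax : sSup S ∈ S := Nat.sSup_mem hne ⟨n, hn⟩
  have hge : ∀ i ∈ S, i ≤ sSup S := fun i hi => le_csSup ⟨n, hn⟩ hi
  have h1 := hle _ hmax
  refine ⟨sSup S - sInf S + 1, by omega, ?_⟩
  ext j
  simp only [Finset.coe_range, Set.mem_image, Set.mem_Iio]
  constructor
  · intro hj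
    have h2 := hle j hj
    have h3 := hge j hj
    exact ⟨j - sInf S, by omega, by omega⟩
  · rintro ⟨i, hi, rfl⟩
    by_cases h2 : i = 0
    · rwa [h2, add_zero]
    · by_cases h3 : sInf S + i = sSup S
      · rwa [h3]
      · exact hS _ _ _ (by omega) (by omega) hmin hmax

namespace IsDualPolarGraph

variable (hG : IsDualPolarGraph G x D b s)

include hG

/-- The trace of `A` on `W` is computed twice. In the basis `R ^ k v` only the flat part has
diagonal entries, `μ b ^ (r + k) - (s - 1)/(b - 1)` with `μ` the unknown scalar. In the basis of
eigenvectors the diagonal entries are the consecutive eigenvalues from `θ_t` on. -/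
theorem weightedFlat_mulVec (hW : IsIrredTModule G x W) :
    dualEndpoint G W + moduleDiam G x W ≤ D ∧ ∀ w ∈ W, weightedFlat G x b s *ᵥ w =
      (((s : ℂ) * (b : ℂ) ^ (D - dualEndpoint G W - moduleDiam G x W) -
        (b : ℂ) ^ dualEndpoint G W) / ((b : ℂ) ^ endpoint G x W * (b - 1))) • w := by
  classical
  obtain ⟨v, hv, h0, hr, hL, ν, hLR⟩ := hG.exists_endpoint_vector hW
  obtain ⟨μ, hμ⟩ := hG.exists_smul_of_mem_centerT hW hG.weightedFlat_mem
  have hR := hG.span_raise_pow hW hv h0 hr hL hLR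
  have hE := hG.span_idem_mulVec hW hv h0 hr hL hLR
  have hRW : ∀ k, raise G x ^ k *ᵥ v ∈ W := fun k => hW.1 _ (pow_mem hG.raise_mem k) v hv
  have hEW : ∀ k, idem G k *ᵥ v ∈ W := fun k => hW.1 _ (hG.idem_mem k) v hv
  set r := endpoint G x W with hr_def
  -- the string of raised vectors
  have hex : ∃ k, raise G x ^ k *ᵥ v = 0 := by
    refine ⟨D + 1, ?_⟩
    rw [← dualIdem_mulVec_raise_pow hr, hG.dualIdem_eq_zero (by omega), Matrix.zero_mulVec]
  set N := Nat.find hex with hN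
  have hNzero : ∀ k, N ≤ k → raise G x ^ k *ᵥ v = 0 := by
    intro k hk
    obtain ⟨l, rfl⟩ := Nat.exists_eq_add_of_le' hk
    rw [pow_add, ← Matrix.mulVec_mulVec, hN, Nat.find_spec hex, Matrix.mulVec_zero]
  have hNne : ∀ k < N, raise G x ^ k *ᵥ v ≠ 0 := fun k hk => Nat.find_min hex hk
  have hNpos : 0 < N := (Nat.find_pos hex).2 (by simpa using h0)
  have hR' : Submodule.span ℂ ((fun k : ℕ => raise G x ^ k *ᵥ v) ''
      (Finset.range N : Finset ℕ)) = W := by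
    refine le_antisymm (Submodule.span_le.2 (by rintro _ ⟨k, -, rfl⟩; exact hRW k)) ?_
    rw [← hR, Submodule.span_le]
    rintro _ ⟨k, rfl⟩
    by_cases hk : k < N
    · exact Submodule.subset_span ⟨k, by simpa using hk, rfl⟩
    · simp only [hNzero k (by omega)]
      exact Submodule.zero_mem _
  have hset : {i : ℕ | ∃ w ∈ W, dualIdem G x i *ᵥ w ≠ 0} =
      (fun k => r + k) '' (Finset.range N : Finset ℕ) := by
    ext i
    constructor
    · rintro ⟨w, hw, hne⟩
      by_contra hi
      apply hne
      rw [← hR'] at hw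
      have : Submodule.span ℂ ((fun k : ℕ => raise G x ^ k *ᵥ v) ''
          (Finset.range N : Finset ℕ)) ≤ LinearMap.ker (Matrix.mulVecLin (dualIdem G x i)) := by
        rw [Submodule.span_le]
        rintro _ ⟨k, hk, rfl⟩
        exact dualIdem_mulVec_raise_pow_ne hr fun h => hi ⟨k, hk, h.symm⟩
      exact this hw
    · rintro ⟨k, hk, rfl⟩
      refine ⟨_, hRW k, ?_⟩
      rw [dualIdem_mulVec_raise_pow hr]
      exact hNne k (by simpa using hk)
  have hd : moduleDiam G x W + 1 = N := by
    rw [moduleDiam, hset, Set.ncard_image_of_injective _ (add_right_injective r),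
      Set.ncard_coe_finset, Finset.card_range]
    omega
  -- the string of eigenvectors
  have hset' : {i : ℕ | ∃ w ∈ W, idem G i *ᵥ w ≠ 0} = {i | idem G i *ᵥ v ≠ 0} := by
    ext i
    refine ⟨?_, fun h => ⟨v, hv, h⟩⟩
    rintro ⟨w, hw, hne⟩ hi
    apply hne
    rw [← hE] at hw
    have : Submodule.span ℂ ((fun i => idem G i *ᵥ v) '' {i | idem G i *ᵥ v ≠ 0}) ≤
        LinearMap.ker (Matrix.mulVecLin (idem G i)) := by
      rw [Submodule.span_le]
      rintro _ ⟨k, hk, rfl⟩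
      have : i ≠ k := fun h => hk (h ▸ hi)
      rw [SetLike.mem_coe, LinearMap.mem_ker, Matrix.mulVecLin_apply, Matrix.mulVec_mulVec,
        hG.idem_mul_ne this, Matrix.zero_mulVec]
    exact this hw
  have hD : ∀ l ∈ {i | idem G i *ᵥ v ≠ 0}, l ≤ D := by
    intro l hl
    by_contra h
    exact hl (by rw [hG.spectral.eq_zero l (by omega), Matrix.zero_mulVec])
  have hne : {i | idem G i *ᵥ v ≠ 0}.Nonempty := by
    by_contra! h
    rw [h, Set.image_empty, Submodule.span_empty] at hE
    exact hW.2.1 hE.symm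
  obtain ⟨m, hm, hJ⟩ := exists_eq_image_add_range hne hD fun i j k hij hjk hi hk =>
    hG.idem_mulVec_ne_zero_of_between hW hE hij hjk hi hk
  have ht : dualEndpoint G W = sInf {i | idem G i *ᵥ v ≠ 0} := by rw [dualEndpoint, hset']
  rw [← ht] at hJ
  set t := dualEndpoint G W with ht_def
  have hJne : ∀ i < m, idem G (t + i) *ᵥ v ≠ 0 := by
    intro i hi
    have : t + i ∈ (fun i => t + i) '' (Finset.range m : Finset ℕ) := ⟨i, by simpa using hi, rfl⟩
    rwa [← hJ] at this
  have hE' : Submodule.span ℂ ((fun i => idem G (t + i) *ᵥ v) ''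
      (Finset.range m : Finset ℕ)) = W := by
    rw [← hE, hJ, Set.image_image]
  -- compare traces
  have htrR : ∀ (M : Matrix V V ℂ) (hM : M ∈ stab W) (f : ℕ → ℂ), (∀ k < N,
      dualIdem G x (r + k) *ᵥ (M *ᵥ (raise G x ^ k *ᵥ v)) = f k • (raise G x ^ k *ᵥ v)) →
      LinearMap.trace ℂ W ((Matrix.mulVecLin M).restrict hM) = ∑ k ∈ Finset.range N, f k := by
    intro M hM f hf
    refine trace_restrict_eq_sum hM (fun k => raise G x ^ k *ᵥ v) (fun k => dualIdem G x (r + k)) f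
      hR' (fun k hk => hNne k (by simpa using hk)) (fun k _ => dualIdem_mulVec_raise_pow hr k)
      (fun k _ l _ hkl => dualIdem_mulVec_raise_pow_ne hr (by omega))
      (fun k hk => hf k (by simpa using hk))
  have htrE : ∀ (M : Matrix V V ℂ) (hM : M ∈ stab W) (f : ℕ → ℂ), (∀ i < m,
      M *ᵥ (idem G (t + i) *ᵥ v) = f i • (idem G (t + i) *ᵥ v)) →
      LinearMap.trace ℂ W ((Matrix.mulVecLin M).restrict hM) = ∑ k ∈ Finset.range m, f k := by
    intro M hM f hf
    refine trace_restrict_eq_sum hM (fun i => idem G (t + i) *ᵥ v) (fun i => idem G (t + i)) f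
      hE' (fun k hk => hJne k (by simpa using hk))
      (fun k _ => by rw [Matrix.mulVec_mulVec, hG.idem_mul_self])
      (fun k _ l _ hkl => by
        rw [Matrix.mulVec_mulVec, hG.idem_mul_ne (by omega), Matrix.zero_mulVec])
      (fun k hk => ?_)
    rw [hf k (by simpa using hk), Matrix.mulVec_smul, Matrix.mulVec_mulVec, hG.idem_mul_self]
  -- The trace of the identity shows that both bases have the same length.
  have hNm : N = m := by
    have h1 := htrR 1 (one_mem _) (fun _ => 1) fun k _ => by
      rw [Matrix.one_mulVec, dualIdem_mulVec_raise_pow hr, one_smul]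
    have h2 := htrE 1 (one_mem _) (fun _ => 1) fun k _ => by rw [Matrix.one_mulVec, one_smul]
    rw [h1] at h2
    simpa using h2
  subst hNm
  have htD : ∀ i < N, t + i ≤ D := fun i hi => hD _ (hJne i hi)
  have htd : t + moduleDiam G x W ≤ D := htD _ (by omega)
  refine ⟨htd, fun w hw => ?_⟩
  rw [hμ w hw]
  congr 1
  have hA : adj G ∈ stab W := hW.1 _ adj_mem
  have h1 := htrR (adj G) hA (fun k => μ * (b : ℂ) ^ (r + k) - ((s : ℂ) - 1) / (b - 1)) ?_
  · have h2 := htrE (adj G) hA (fun i => (dpEigenvalue b s D (t + i) : ℂ)) ?_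
    · rw [h1] at h2
      have hb1 : (b : ℂ) - 1 ≠ 0 := sub_ne_zero.2 hG.cast_ne_one
      have hb := hG.cast_ne_zero
      have h3 : ∑ k ∈ Finset.range N, μ * (b : ℂ) ^ (r + k) = ∑ k ∈ Finset.range N,
          ((s : ℂ) * (b : ℂ) ^ (D - (t + k)) - (b : ℂ) ^ (t + k)) / (b - 1) := by
        simp_rw [← hG.dpEigenvalue_add, Finset.sum_add_distrib, ← h2, Finset.sum_sub_distrib]
        ring
      -- Reversing the sum exposes the factor `1 + b + ... + b ^ (N - 1)` common to all terms of
      -- `h3`; it is nonzero and cancels.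
      have h4 : ∑ k ∈ Finset.range N, (b : ℂ) ^ (D - (t + k)) =
          (b : ℂ) ^ (D - t - moduleDiam G x W) * ∑ k ∈ Finset.range N, (b : ℂ) ^ k := by
        rw [Finset.mul_sum, ← Finset.sum_range_reflect]
        refine Finset.sum_congr rfl fun k hk => ?_
        rw [Finset.mem_range] at hk
        rw [← pow_add]
        congr 1
        omega
      have hsum : ∑ k ∈ Finset.range N, (b : ℂ) ^ k ≠ 0 := by
        have : 0 < ∑ k ∈ Finset.range N, b ^ k :=
          Finset.sum_pos (fun k _ => pow_pos (by have := hG.one_lt; omega) k) ⟨0, by simpa⟩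
        exact_mod_cast this.ne'
      rw [← Finset.sum_div, Finset.sum_sub_distrib, ← Finset.mul_sum, ← Finset.mul_sum, h4] at h3
      simp_rw [pow_add, ← Finset.mul_sum] at h3
      rw [eq_div_iff (mul_ne_zero (pow_ne_zero _ hb) hb1)]
      apply mul_right_cancel₀ hsum
      rw [eq_div_iff hb1] at h3
      linear_combination h3
    · intro i hi
      rw [Matrix.mulVec_mulVec, hG.spectral.mul_left _ (htD i hi), Matrix.smul_mulVec]
  · intro k _
    rw [adj_eq (x := x), Matrix.add_mulVec, Matrix.add_mulVec, Matrix.mulVec_add,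
      Matrix.mulVec_add,
      hG.flat_mulVec_of_weightedFlat (dualIdem_mulVec_raise_pow hr k) (hμ _ (hRW k)),
      Matrix.mulVec_smul, dualIdem_mulVec_raise_pow hr, ← raise_pow_succ_mulVec,
      dualIdem_mulVec_raise_pow_ne hr (by omega), zero_add]
    rcases k with _ | k
    · simp [hL]
    · obtain ⟨ν', h⟩ := hG.lower_raise_pow hL hLR k
      rw [h, Matrix.mulVec_smul, dualIdem_mulVec_raise_pow_ne hr (by omega), smul_zero, zero_add]

end IsDualPolarGraph
end DualPolar

/-! ### Central elements of the given shape -/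

namespace DualPolar

open Module

variable {V : Type*} [Fintype V] [DecidableEq V]
  {W : Submodule ℂ (V → ℂ)} {G : SimpleGraph V} {x : V} {D b s : ℕ}

theorem exists_isIrredTModule_le (n : ℕ) : ∀ W : Submodule ℂ (V → ℂ), finrank ℂ W ≤ n → W ≠ ⊥ →
    IsTModule G x W → ∃ W' ≤ W, IsIrredTModule G x W' := by
  induction n with
  | zero =>
    intro W hn hW _
    exact absurd (Submodule.finrank_eq_zero.1 (Nat.le_zero.1 hn)) hW
  | succ n ih =>
    intro W hn hW hT
    by_cases h : ∀ W' ≤ W, IsTModule G x W' → W' = ⊥ ∨ W' = W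
    · exact ⟨W, le_rfl, hT, hW, h⟩
    · push Not at h
      obtain ⟨W', hle, hT', h0, hne⟩ := h
      have := Submodule.finrank_lt_finrank_of_lt (lt_of_le_of_ne hle hne)
      obtain ⟨W'', h1, h2⟩ := ih W' (by omega) h0 hT'
      exact ⟨W'', h1.trans hle, h2⟩

theorem conjTranspose_adj : (adj G)ᴴ = adj G := by
  ext y z
  simp only [Matrix.conjTranspose_apply, adj, distMatrix, Matrix.of_apply, G.dist_comm (u := z)]
  split_ifs <;> simp

theorem conjTranspose_dualIdem (i : ℕ) : (dualIdem G x i)ᴴ = dualIdem G x i := by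
  rw [dualIdem, Matrix.diagonal_conjTranspose]
  congr 1
  funext y
  simp only [Pi.star_apply]
  split_ifs <;> simp

namespace IsDualPolarGraph

variable (hG : IsDualPolarGraph G x D b s)

include hG

theorem conjTranspose_mem {M : Matrix V V ℂ} (hM : M ∈ subconstAlg G x) :
    Mᴴ ∈ subconstAlg G x := by
  have h : subconstAlg G x ≤ star (subconstAlg G x) := by
    refine hG.subconstAlg_le ?_ fun i => ?_
    · rw [Subalgebra.mem_star_iff, Matrix.star_eq_conjTranspose, conjTranspose_adj]
      exact adj_mem
    · rw [Subalgebra.mem_star_iff, Matrix.star_eq_conjTranspose, conjTranspose_dualIdem]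
      exact dualIdem_mem i
  exact Subalgebra.mem_star_iff _ _ |>.1 (h hM)

open scoped ComplexOrder in
/-- A central element is determined by its action on the irreducible modules. -/
theorem eq_zero_of_mem_centerT {M : Matrix V V ℂ} (hM : M ∈ centerT G x)
    (h : ∀ W, IsIrredTModule G x W → ∀ w ∈ W, M *ᵥ w = 0) : M = 0 := by
  by_contra hne
  have hMT := (hG.mem_centerT_iff.1 hM).1
  have hMs := hG.conjTranspose_mem hMT
  have hbot : LinearMap.range (Matrix.mulVecLin M) ≠ ⊥ := by
    intro h0
    apply hne
    rw [LinearMap.range_eq_bot] at h0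
    apply Matrix.ext_of_mulVec_single
    intro i
    rw [Matrix.zero_mulVec, ← Matrix.mulVecLin_apply, h0, LinearMap.zero_apply]
  obtain ⟨W, hle, hW⟩ := exists_isIrredTModule_le (G := G) (x := x) _
    (LinearMap.range (Matrix.mulVecLin M)) le_rfl hbot (by
      rintro N hN _ ⟨v, rfl⟩
      refine ⟨N *ᵥ v, ?_⟩
      rw [Matrix.mulVecLin_apply, Matrix.mulVecLin_apply, Matrix.mulVec_mulVec,
        Matrix.mulVec_mulVec, hG.commute_of_mem_centerT hM hN])
  obtain ⟨w, hw, hw0⟩ := Submodule.exists_mem_ne_zero_of_ne_bot hW.2.1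
  obtain ⟨v, hv⟩ := hle hw
  rw [Matrix.mulVecLin_apply] at hv
  -- `W` lies in the range of `M`, which is a module as `M` is central. Since `Mᴴ w` is again in
  -- `W`, `M` kills it, so its norm vanishes; then `w = M v` is orthogonal to itself.
  have h1 : Mᴴ *ᵥ w = 0 := by
    rw [← dotProduct_star_self_eq_zero, Matrix.star_mulVec,
      Matrix.conjTranspose_conjTranspose, ← Matrix.dotProduct_mulVec,
      h W hW _ (hW.1 _ hMs w hw), dotProduct_zero]
  apply hw0
  rw [← dotProduct_star_self_eq_zero]
  nth_rewrite 1 [← hv]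
  rw [Matrix.star_mulVec, ← Matrix.dotProduct_mulVec, h1, dotProduct_zero]

theorem flat_mul_dualIdem_zero : flat G x * dualIdem G x 0 = 0 := by
  classical
  ext z y
  simp only [dualIdem, flat, Matrix.mul_diagonal, Matrix.of_apply, ite_mul_ite, Matrix.zero_apply]
  rw [if_neg]
  rintro ⟨⟨h1, h2⟩, h3⟩
  rw [h3] at h2
  rw [← (hG.connected.dist_eq_zero_iff).1 h3, ← (hG.connected.dist_eq_zero_iff).1 h2] at h1
  exact G.irrefl h1

theorem dualIdem_mul_adj_mul_dualIdem (i : ℕ) :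
    dualIdem G x i * adj G * dualIdem G x i = flat G x * dualIdem G x i := by
  have h1 : dualIdem G x i * dualIdem G x (i + 1) = 0 := dualIdem_mul_ne (by omega)
  have h2 : dualIdem G x (i + 1) * dualIdem G x i = 0 := dualIdem_mul_ne (by omega)
  have h3 : dualIdem G x i * raise G x * dualIdem G x i = 0 := by
    rw [mul_assoc, ← dualIdem_mul_raise, ← mul_assoc, h1, zero_mul]
  have h4 : dualIdem G x i * lower G x * dualIdem G x i = 0 := by
    rw [dualIdem_mul_lower, mul_assoc, h2, mul_zero]
  rw [adj_eq (x := x), mul_add, mul_add, add_mul, add_mul, h3, h4, zero_add, zero_add,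
    dualIdem_mul_flat, mul_assoc, dualIdem_mul_self]

/-- The value `α 0` does not matter, because the flat matrix vanishes at the base vertex. This
allows uniform diagonal factors. -/
theorem elemC_eq (α β : ℕ → ℂ) : elemC G x D α β =
    flat G x * Matrix.diagonal (fun y => α (G.dist x y)) +
      Matrix.diagonal (fun y => β (G.dist x y)) := by
  rw [elemC, ← hG.sum_dualIdem_smul, ← hG.sum_dualIdem_smul, Finset.mul_sum]
  congr 1
  rw [Finset.sum_range_succ', mul_smul_comm, hG.flat_mul_dualIdem_zero, smul_zero, add_zero,
    Finset.range_eq_Ico, Finset.sum_Ico_add' (fun i => flat G x * α i • dualIdem G x i) 0 D 1]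
  refine Finset.sum_congr rfl fun i _ => ?_
  rw [hG.dualIdem_mul_adj_mul_dualIdem, mul_smul_comm]

theorem elemC_mul_dualIdem (α β : ℕ → ℂ) (i : ℕ) : elemC G x D α β * dualIdem G x i =
    α i • (flat G x * dualIdem G x i) + β i • dualIdem G x i := by
  have h : ∀ f : ℕ → ℂ, Matrix.diagonal (fun y => f (G.dist x y)) * dualIdem G x i =
      f i • dualIdem G x i := by
    intro f
    rw [dualIdem, Matrix.diagonal_mul_diagonal, ← Matrix.diagonal_smul]
    congr 1
    funext y
    by_cases h : G.dist x y = i <;> simp [h]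
  rw [hG.elemC_eq, add_mul, mul_assoc, h, h, mul_smul_comm]

theorem dualIdem_mul_elemC (α β : ℕ → ℂ) (i : ℕ) :
    dualIdem G x i * elemC G x D α β = elemC G x D α β * dualIdem G x i := by
  rw [hG.elemC_eq, mul_add, add_mul, ← mul_assoc, dualIdem_mul_flat, mul_assoc, mul_assoc,
    dualIdem, Matrix.diagonal_mul_diagonal, Matrix.diagonal_mul_diagonal,
    Matrix.diagonal_mul_diagonal, Matrix.diagonal_mul_diagonal]
  simp_rw [mul_comm]

theorem ext_dualIdem {M N : Matrix V V ℂ}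
    (h : ∀ i ≤ D, M * dualIdem G x i = N * dualIdem G x i) : M = N := by
  rw [← mul_one M, ← mul_one N, ← hG.sum_dualIdem, Finset.mul_sum, Finset.mul_sum]
  exact Finset.sum_congr rfl fun i hi => h i (by rw [Finset.mem_range] at hi; omega)

theorem flat_mul_elemC (α β : ℕ → ℂ) :
    flat G x * elemC G x D α β = elemC G x D α β * flat G x := by
  refine hG.ext_dualIdem fun i _ => ?_
  rw [mul_assoc, hG.elemC_mul_dualIdem, mul_assoc, ← dualIdem_mul_flat, ← mul_assoc,
    hG.elemC_mul_dualIdem, mul_add, add_mul, mul_smul_comm, smul_mul_assoc, mul_smul_comm,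
    smul_mul_assoc, mul_assoc, dualIdem_mul_flat]

theorem transpose_elemC (α β : ℕ → ℂ) : (elemC G x D α β)ᵀ = elemC G x D α β := by
  have hd : ∀ i, (dualIdem G x i)ᵀ = dualIdem G x i := fun i => Matrix.diagonal_transpose _
  rw [elemC, Matrix.transpose_add, Matrix.transpose_sum, Matrix.transpose_sum]
  congr 1 <;> refine Finset.sum_congr rfl fun i _ => ?_
  · rw [Matrix.transpose_smul, Matrix.transpose_mul, Matrix.transpose_mul, hd, transpose_adj,
      mul_assoc]
  · rw [Matrix.transpose_smul, hd]

theorem elemC_mem (α β : ℕ → ℂ) : elemC G x D α β ∈ subconstAlg G x := by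
  refine add_mem (Subalgebra.sum_mem _ fun i _ => Subalgebra.smul_mem _ ?_ _)
    (Subalgebra.sum_mem _ fun i _ => Subalgebra.smul_mem _ (dualIdem_mem i) _)
  exact mul_mem (mul_mem (dualIdem_mem i) adj_mem) (dualIdem_mem i)

/-- The flat matrix and the dual idempotents commute with every element of this shape, and the
element is symmetric, so commuting with raising gives commuting with lowering by transposition. -/
theorem elemC_mem_centerT_iff_raise (α β : ℕ → ℂ) : elemC G x D α β ∈ centerT G x ↔
    elemC G x D α β * raise G x = raise G x * elemC G x D α β := by
  rw [hG.mem_centerT_iff]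
  constructor
  · rintro ⟨-, h, -⟩
    rw [hG.raise_eq, Finset.mul_sum, Finset.sum_mul]
    refine Finset.sum_congr rfl fun i _ => ?_
    rw [mul_assoc _ (dualIdem G x i), hG.dualIdem_mul_elemC, ← mul_assoc,
      mul_assoc (dualIdem G x (i + 1)), ← mul_assoc (adj G), h, ← mul_assoc, ← mul_assoc,
      ← mul_assoc,
      hG.dualIdem_mul_elemC]
  · intro h
    refine ⟨hG.elemC_mem α β, ?_, hG.dualIdem_mul_elemC α β⟩
    have h' := congrArg Matrix.transpose h
    rw [Matrix.transpose_mul, Matrix.transpose_mul, hG.transpose_elemC, transpose_raise] at h'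
    rw [adj_eq (x := x), add_mul, add_mul, mul_add, mul_add, h, h', hG.flat_mul_elemC]

/-- The `i`-th term is the commutator with the raising matrix restricted to distance `i`, with
`flat_raise` used to rewrite the product of flat and raising. At `i = D` there is no condition, as
nothing can be raised. -/
theorem elemC_mem_centerT_iff (α β : ℕ → ℂ) : elemC G x D α β ∈ centerT G x ↔
    ∀ i < D, ((b : ℂ) * α (i + 1) - α i) • (raise G x * flat G x * dualIdem G x i) +
      (α (i + 1) * ((s : ℂ) - 1) + β (i + 1) - β i) • (raise G x * dualIdem G x i) = 0 := by
  have hcol : ∀ i, (elemC G x D α β * raise G x) * dualIdem G x i -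
      (raise G x * elemC G x D α β) * dualIdem G x i =
      ((b : ℂ) * α (i + 1) - α i) • (raise G x * flat G x * dualIdem G x i) +
      (α (i + 1) * ((s : ℂ) - 1) + β (i + 1) - β i) • (raise G x * dualIdem G x i) := by
    intro i
    rw [mul_assoc, ← dualIdem_mul_raise, ← mul_assoc, hG.elemC_mul_dualIdem, add_mul,
      smul_mul_assoc, smul_mul_assoc, mul_assoc, dualIdem_mul_raise, ← mul_assoc, hG.flat_raise,
      mul_assoc (raise G x) (elemC G x D α β), hG.elemC_mul_dualIdem, mul_add, mul_smul_comm,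
      mul_smul_comm, add_mul, smul_mul_assoc, smul_mul_assoc, ← mul_assoc]
    module
  rw [hG.elemC_mem_centerT_iff_raise]
  constructor
  · intro h i _
    rw [← hcol, h, sub_self]
  · intro h
    refine hG.ext_dualIdem fun i hi => ?_
    rw [← sub_eq_zero, hcol]
    rcases hi.lt_or_eq with hi | rfl
    · exact h i hi
    · rw [mul_assoc, ← dualIdem_mul_flat, ← mul_assoc, ← dualIdem_mul_raise,
        hG.dualIdem_eq_zero (Nat.lt_succ_self _)]
      simp

/-- An edge from distance `i` to `i + 1` has zero entry in raise times flat and isolates the second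
coefficient; a nonadjacent pair from `exists_two` isolates the first. At `i = 0` the flat matrix is
zero, so the condition on `α` starts at `i = 1`. -/
theorem elemC_mem_centerT_iff_of_one_lt (hs : 1 < s) (α β : ℕ → ℂ) :
    elemC G x D α β ∈ centerT G x ↔ (∀ i, 1 ≤ i → i < D → (b : ℂ) * α (i + 1) = α i) ∧
      ∀ i < D, α (i + 1) * ((s : ℂ) - 1) + β (i + 1) = β i := by
  classical
  rw [hG.elemC_mem_centerT_iff]
  constructor
  · intro h
    have hent : ∀ i < D, ∀ y z, G.dist x y = i →
        ((b : ℂ) * α (i + 1) - α i) * (raise G x * flat G x) z y +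
          (α (i + 1) * ((s : ℂ) - 1) + β (i + 1) - β i) * raise G x z y = 0 := by
      intro i hi y z hy
      have := congrFun (congrFun (h i hi) z) y
      simpa only [dualIdem, Matrix.add_apply, Matrix.smul_apply, Matrix.mul_diagonal, hy, if_true,
        mul_one, smul_eq_mul, Matrix.zero_apply] using this
    constructor
    · intro i h1 hi
      obtain ⟨y, z, hadj, hy, hz, hne⟩ := hG.exists_two hs i h1 hi
      have h2 := hent i hi y z hy
      rw [show raise G x z y = 0 by simp [raise, hadj], mul_zero, add_zero] at h2
      exact sub_eq_zero.1 ((mul_eq_zero.1 h2).resolve_right hne)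
    · intro i hi
      obtain ⟨y, z, hadj, hy, hz⟩ := hG.exists_edge i hi
      have h2 := hent i hi y z hy
      rw [hG.raise_flat_adj y z hadj (by omega),
        show raise G x z y = 1 by simp [raise, hadj, hy, hz]] at h2
      linear_combination h2
  · rintro ⟨h1, h2⟩ i hi
    rw [h2 i hi, sub_self, zero_smul, add_zero]
    rcases Nat.eq_zero_or_pos i with rfl | h
    · rw [mul_assoc, hG.flat_mul_dualIdem_zero, mul_zero, smul_zero]
    · rw [h1 i h hi, sub_self, zero_smul]

theorem elemC_mem_centerT_iff_of_one (hs : s = 1) (α β : ℕ → ℂ) :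
    elemC G x D α β ∈ centerT G x ↔ ∀ i ≤ D, β i = β 0 := by
  classical
  have hfl := hG.flat_eq_zero hs
  rw [hG.elemC_mem_centerT_iff]
  have hiff : (∀ i ≤ D, β i = β 0) ↔ ∀ i < D, β (i + 1) = β i := by
    constructor
    · intro h i hi
      rw [h i hi.le, h (i + 1) hi]
    · intro h i
      induction i with
      | zero => intro _; rfl
      | succ i ih => intro hi; rw [h i hi, ih (by omega)]
  rw [hiff]
  refine forall₂_congr fun i hi => ?_
  rw [hfl, hs]
  constructor
  · intro h
    obtain ⟨y, z, hadj, hy, hz⟩ := hG.exists_edge i hi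
    have := congrFun (congrFun h z) y
    simp [dualIdem, raise, hadj, hy, hz] at this
    exact sub_eq_zero.1 this
  · intro h
    rw [h]
    simp

end IsDualPolarGraph
end DualPolar

/-! ### The element `Ω` -/

namespace DualPolar

open Module

variable {V : Type*} [Fintype V] [DecidableEq V]
  {W : Submodule ℂ (V → ℂ)} {G : SimpleGraph V} {x : V} {D b s : ℕ}

theorem smul_elemC (c : ℂ) (α β : ℕ → ℂ) :
    c • elemC G x D α β = elemC G x D (c • α) (c • β) := by
  simp only [elemC, smul_add, Finset.smul_sum, smul_smul, Pi.smul_apply, smul_eq_mul]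

theorem elemC_add_elemC (α β α' β' : ℕ → ℂ) :
    elemC G x D α β + elemC G x D α' β' = elemC G x D (α + α') (β + β') := by
  simp only [elemC, Pi.add_apply, add_smul, Finset.sum_add_distrib]
  abel

theorem elemC_congr {α β α' β' : ℕ → ℂ} (hα : ∀ i, 1 ≤ i → i ≤ D → α i = α' i)
    (hβ : ∀ i ≤ D, β i = β' i) : elemC G x D α β = elemC G x D α' β' := by
  rw [elemC, elemC]
  congr 1 <;> refine Finset.sum_congr rfl fun i hi => ?_
  · rw [Finset.mem_Icc] at hi
    rw [hα i hi.1 hi.2]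
  · rw [Finset.mem_range] at hi
    rw [hβ i (by omega)]

/-- `Ω` as a combination of the weighted flat matrix and the identity. -/
def omegaElt (G : SimpleGraph V) (x : V) (D b s : ℕ) (e : ℝ) : Matrix V V ℂ :=
  ((xi b e D * ((b : ℝ)⁻¹ - 1) * (b - 1) : ℝ) : ℂ) • weightedFlat G x b s -
    ((2 * gam b e * zeta b e D : ℝ) : ℂ) • 1

/-- Splitting off `b ^ e = s` leaves integer exponents, and `t + d ≤ D` makes the subtraction in `D
- t - d` genuine. -/
theorem omega_eq {b s D r t d : ℕ} (hb : 1 < b) {e : ℝ} (he : (s : ℝ) = (b : ℝ) ^ e)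
    (htd : t + d ≤ D) : omega b e D r t d = xi b e D * ((b : ℝ)⁻¹ - 1) * (b - 1) *
      (((s : ℝ) * (b : ℝ) ^ (D - t - d) - (b : ℝ) ^ t) / ((b : ℝ) ^ r * (b - 1))) -
      2 * gam b e * zeta b e D := by
  have hb0 : (0 : ℝ) < b := by exact_mod_cast (by omega : 0 < b)
  have hb1 : (b : ℝ) - 1 ≠ 0 := sub_ne_zero.2 (by exact_mod_cast hb.ne')
  have h1 : (b : ℝ) ^ (e + D - d - t - r) = s * (b : ℝ) ^ (D - t - d) / (b : ℝ) ^ r := by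
    have : (e + D - d - t - r : ℝ) = e + ((D - t - d : ℕ) : ℝ) - r := by
      rw [Nat.cast_sub (by omega), Nat.cast_sub (by omega)]
      ring
    rw [this, Real.rpow_sub hb0, Real.rpow_add hb0, Real.rpow_natCast, Real.rpow_natCast, he]
  have h2 : (b : ℝ) ^ ((t : ℝ) - r) = (b : ℝ) ^ t / (b : ℝ) ^ r := by
    rw [Real.rpow_sub hb0, Real.rpow_natCast, Real.rpow_natCast]
  have h3 : (b : ℝ) ^ r ≠ 0 := (pow_pos hb0 r).ne'
  rw [omega, h1, h2]
  field_simp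

theorem xi_ne_zero {b : ℕ} (hb : 1 < b) (e : ℝ) (D : ℕ) : xi b e D ≠ 0 := by
  have hb0 : (0 : ℝ) < b := by exact_mod_cast (by omega : 0 < b)
  have hb1 : (0 : ℝ) < b - 1 := sub_pos.2 (by exact_mod_cast hb)
  rw [xi]
  positivity

namespace IsDualPolarGraph

variable (hG : IsDualPolarGraph G x D b s)

include hG

theorem weightedFlat_eq_elemC : weightedFlat G x b s = elemC G x D (fun i => ((b : ℂ) ^ i)⁻¹)
    (fun i => ((s : ℂ) - 1) / (b - 1) * ((b : ℂ) ^ i)⁻¹) := by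
  refine hG.ext_dualIdem fun i _ => ?_
  rw [hG.elemC_mul_dualIdem, weightedFlat, mul_assoc, ← hG.dualIdem_mul_shiftedFlat, ← mul_assoc,
    weight_mul_dualIdem, smul_mul_assoc, hG.dualIdem_mul_shiftedFlat, shiftedFlat, add_mul,
    smul_mul_assoc, one_mul, smul_add, smul_smul, mul_comm (((s : ℂ) - 1) / _)]

theorem one_eq_elemC : (1 : Matrix V V ℂ) = elemC G x D 0 (fun _ => 1) := by
  refine hG.ext_dualIdem fun i _ => ?_
  rw [hG.elemC_mul_dualIdem, Pi.zero_apply, zero_smul, zero_add, one_smul, one_mul]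

theorem elemC_mem_centerT_iff_formula (hs : 1 < s) (α β : ℕ → ℂ) :
    elemC G x D α β ∈ centerT G x ↔
      (∀ i : ℕ, 1 ≤ i → i ≤ D → α i = (b : ℂ) ^ (1 - (i : ℤ)) * α 1) ∧
      (∀ i : ℕ, i ≤ D → β i = β 0 - ((s : ℂ) - 1) * (b : ℂ) ^ (1 - (i : ℤ)) *
        (((b : ℂ) ^ i - 1) / ((b : ℂ) - 1)) * α 1) := by
  have hb := hG.cast_ne_zero
  have hb1 : (b : ℂ) - 1 ≠ 0 := sub_ne_zero.2 hG.cast_ne_one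
  have hz : ∀ i : ℕ, (b : ℂ) ^ (1 - ((i + 1 : ℕ) : ℤ)) = ((b : ℂ) ^ i)⁻¹ := by
    intro i
    rw [show (1 - ((i + 1 : ℕ) : ℤ)) = -(i : ℤ) by push_cast; ring, zpow_neg, zpow_natCast]
  have hz' : ∀ i : ℕ, (b : ℂ) ^ (1 - (i : ℤ)) = b * ((b : ℂ) ^ i)⁻¹ := by
    intro i
    rw [zpow_sub₀ hb, zpow_one, zpow_natCast, div_eq_mul_inv]
  rw [hG.elemC_mem_centerT_iff_of_one_lt hs]
  constructor
  · rintro ⟨h1, h2⟩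
    have h3 : ∀ i : ℕ, 1 ≤ i → i ≤ D → α i = (b : ℂ) ^ (1 - (i : ℤ)) * α 1 := by
      intro i hi
      induction i, hi using Nat.le_induction with
      | base => intro _; simp
      | succ i hi ih =>
        intro hD
        have h4 := ih (by omega)
        rw [hz'] at h4
        apply mul_left_cancel₀ hb
        rw [h1 i hi hD, h4, hz]
        ring
    refine ⟨h3, fun i => ?_⟩
    induction i with
    | zero => intro _; simp
    | succ i ih =>
      intro hi
      have h4 := h2 i hi
      rw [ih (by omega), h3 (i + 1) (by omega) hi, hz, hz'] at h4
      rw [hz]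
      have hp : (b : ℂ) ^ i ≠ 0 := pow_ne_zero _ hb
      rw [← sub_eq_zero]
      rw [← sub_eq_zero] at h4
      rw [← h4]
      field_simp
      ring
  · rintro ⟨h1, h2⟩
    constructor
    · intro i hi hD
      rw [h1 i hi hD.le, h1 (i + 1) (by omega) hD, hz, hz']
      ring
    · intro i hi
      have hp : (b : ℂ) ^ i ≠ 0 := pow_ne_zero _ hb
      rw [h2 i hi.le, h2 (i + 1) hi, h1 (i + 1) (by omega) hi, hz, hz']
      field_simp
      ring

theorem isOmega_omegaElt {e : ℝ} (he : (s : ℝ) = (b : ℝ) ^ e) :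
    IsOmega G x b e D (omegaElt G x D b s e) := by
  refine ⟨sub_mem (Subalgebra.smul_mem _ hG.weightedFlat_mem _)
    (Subalgebra.smul_mem _ (one_mem _) _), ?_⟩
  intro W hW w hw
  obtain ⟨htd, h⟩ := hG.weightedFlat_mulVec hW
  rw [omegaElt, Matrix.sub_mulVec, Matrix.smul_mulVec, Matrix.smul_mulVec, h w hw,
    Matrix.one_mulVec, smul_smul, ← sub_smul, omega_eq hG.one_lt he htd]
  push_cast
  rfl

theorem eq_omegaElt {e : ℝ} (he : (s : ℝ) = (b : ℝ) ^ e) {Om : Matrix V V ℂ}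
    (h : IsOmega G x b e D Om) : Om = omegaElt G x D b s e := by
  have h' := hG.isOmega_omegaElt he
  rw [← sub_eq_zero]
  refine hG.eq_zero_of_mem_centerT (sub_mem h.1 h'.1) fun W hW w hw => ?_
  rw [Matrix.sub_mulVec, h.2 W hW w hw, h'.2 W hW w hw, sub_self]

theorem omega_coeff_ne_zero (e : ℝ) :
    ((xi b e D * ((b : ℝ)⁻¹ - 1) * (b - 1) : ℝ) : ℂ) ≠ 0 := by
  have hb1 : (b : ℝ) - 1 ≠ 0 := sub_ne_zero.2 (by exact_mod_cast hG.one_lt.ne')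
  have hb2 : (b : ℝ)⁻¹ - 1 ≠ 0 :=
    sub_ne_zero.2 fun h => hb1 (by rw [inv_eq_one.1 h, sub_self])
  exact_mod_cast mul_ne_zero (mul_ne_zero (xi_ne_zero hG.one_lt e D) hb2) hb1

/-- An edge inside the first subconstituent gives an off-diagonal entry, so `Ω` is not scalar; here
`s > 1` is essential. -/
theorem linearIndependent_omegaElt (hs : 1 < s) (hD : 1 ≤ D) (e : ℝ) :
    LinearIndependent ℂ ![omegaElt G x D b s e, 1] := by
  classical
  obtain ⟨y, z, hadj, hy, hz⟩ := hG.exists_flat hs hD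
  rw [LinearIndependent.pair_iff]
  intro a c h
  have hent := congrFun (congrFun h z) y
  have hone : (1 : Matrix V V ℂ) z y = 0 := Matrix.one_apply_ne hadj.ne'
  have hwf : weightedFlat G x b s z y = (b : ℂ)⁻¹ := by
    rw [weightedFlat, weight, Matrix.diagonal_mul, shiftedFlat, Matrix.add_apply,
      Matrix.smul_apply, hone]
    simp [flat, hadj, hy, hz]
  rw [omegaElt, Matrix.add_apply, Matrix.smul_apply, Matrix.sub_apply, Matrix.smul_apply,
    Matrix.smul_apply, Matrix.smul_apply, hone, hwf] at hent
  simp only [smul_eq_mul, mul_zero, sub_zero, add_zero, Matrix.zero_apply] at hent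
  have ha : a = 0 := (mul_eq_zero.1 hent).resolve_right
    (mul_ne_zero (hG.omega_coeff_ne_zero e) (inv_ne_zero hG.cast_ne_zero))
  refine ⟨ha, ?_⟩
  rw [ha, zero_smul, zero_add] at h
  have := congrFun (congrFun h x) x
  simpa using this

theorem span_omegaElt (hs : 1 < s) (e : ℝ) :
    (Submodule.span ℂ {omegaElt G x D b s e, 1} : Set (Matrix V V ℂ)) = centralShape G x D := by
  have hb := hG.cast_ne_zero
  have hb1 : (b : ℂ) - 1 ≠ 0 := sub_ne_zero.2 hG.cast_ne_one
  have hκ := hG.omega_coeff_ne_zero e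
  ext M
  rw [SetLike.mem_coe, Submodule.mem_span_pair]
  constructor
  · rintro ⟨a, c, rfl⟩
    have hZ := hG.weightedFlat_mem
    refine ⟨?_, ?_⟩
    · rw [omegaElt, hG.one_eq_elemC, hG.weightedFlat_eq_elemC, sub_eq_add_neg, ← neg_smul]
      simp only [smul_elemC, elemC_add_elemC]
      exact ⟨_, _, rfl⟩
    · exact add_mem (Subalgebra.smul_mem _ (sub_mem (Subalgebra.smul_mem _ hZ _)
        (Subalgebra.smul_mem _ (one_mem _) _)) _) (Subalgebra.smul_mem _ (one_mem _) _)
  · rintro ⟨⟨α, β, rfl⟩, hM⟩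
    obtain ⟨h1, h2⟩ := (hG.elemC_mem_centerT_iff_formula hs α β).1 hM
    -- The centrality conditions leave only `α 1` and `β 0` free. The coefficient of `weightedFlat`
    -- is fixed by `α 1`, and the identity makes up the rest of `β 0`. Since the multiplier of
    -- `weightedFlat` in `Ω` is nonzero, `Ω` can replace it.
    have hlin : elemC G x D α β = (b * α 1) • weightedFlat G x b s +
        (β 0 - ((s : ℂ) - 1) / (b - 1) * α 1 * b) • (1 : Matrix V V ℂ) := by
      rw [hG.weightedFlat_eq_elemC, hG.one_eq_elemC, smul_elemC, smul_elemC, elemC_add_elemC]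
      refine elemC_congr (fun i h3 h4 => ?_) fun i h3 => ?_
      · rw [h1 i h3 h4, zpow_sub₀ hb, zpow_one, zpow_natCast]
        simp only [Pi.add_apply, Pi.smul_apply, smul_eq_mul, Pi.zero_apply]
        ring
      · rw [h2 i h3, zpow_sub₀ hb, zpow_one, zpow_natCast]
        simp only [Pi.add_apply, Pi.smul_apply, smul_eq_mul]
        have hp : (b : ℂ) ^ i ≠ 0 := pow_ne_zero _ hb
        field_simp
        ring
    rw [hlin, omegaElt]
    generalize ((xi b e D * ((b : ℝ)⁻¹ - 1) * (b - 1) : ℝ) : ℂ) = κ at hκ ⊢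
    generalize ((2 * gam b e * zeta b e D : ℝ) : ℂ) = τ
    generalize β 0 - ((s : ℂ) - 1) / (b - 1) * α 1 * b = c
    refine ⟨b * α 1 * κ⁻¹, c + b * α 1 * κ⁻¹ * τ, ?_⟩
    rw [smul_sub, smul_smul, smul_smul, mul_assoc _ κ⁻¹ κ, inv_mul_cancel₀ hκ, mul_one, add_smul]
    abel

theorem span_one (hs : s = 1) :
    (Submodule.span ℂ {(1 : Matrix V V ℂ)} : Set (Matrix V V ℂ)) = centralShape G x D := by
  ext M
  rw [SetLike.mem_coe, Submodule.mem_span_singleton]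
  constructor
  · rintro ⟨a, rfl⟩
    refine ⟨⟨_, _, by rw [hG.one_eq_elemC, smul_elemC]⟩, Subalgebra.smul_mem _ (one_mem _) _⟩
  · rintro ⟨⟨α, β, rfl⟩, hM⟩
    have h := (hG.elemC_mem_centerT_iff_of_one hs α β).1 hM
    refine ⟨β 0, ?_⟩
    refine hG.ext_dualIdem fun i hi => ?_
    rw [hG.elemC_mul_dualIdem, hG.flat_eq_zero hs, zero_mul, smul_zero, zero_add, h i hi,
      smul_mul_assoc, one_mul]

end IsDualPolarGraph
end DualPolar

/-! ### Dual polar graphs fit the abstract setting; the theorem -/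

namespace DualPolar

open Module

namespace IsDualPolar

variable {F U : Type*} [Field F] [AddCommGroup U] [Module F U] {P : Form F U}
  [FiniteDimensional F U] {D s : ℕ} [Finite F] (hI : IsDualPolar P.IsIsotropic D s)
  [Fintype (Vertex P)] [DecidableEq (Vertex P)]

include hI

theorem flat_eq_zero (hs : s = 1) (x : Vertex P) : flat (graph P D) x = 0 := by
  classical
  ext z y
  simp only [flat, Matrix.of_apply, Matrix.zero_apply]
  rw [if_neg]
  rintro ⟨hadj, hd⟩
  have h1 := hI.card_neighbors_meetDim y x (meetDim y x)
  have h2 : nbCount (Nat.card F) s D (meetDim y x) (meetDim y x) = 0 := by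
    rw [nbCount, if_neg (by omega), if_pos rfl, hs]
    simp
  rw [h2, Finset.card_eq_zero, Finset.filter_eq_empty_iff] at h1
  exact h1 (Finset.mem_univ z) ⟨hadj, hI.dist_eq_iff.1 hd⟩

theorem isDualPolarGraph (hs : 0 < s) (x : Vertex P) :
    IsDualPolarGraph (graph P D) x D (Nat.card F) s where
  connected := hI.connected x
  dist_le := hI.dist_le x
  one_lt := Finite.one_lt_card
  spectral := hI.spectralData hs x
  distMatrix_mem := hI.distMatrix_mem
  flat_raise := hI.flat_mul_raise x hs
  raise_flat_adj _ _ h hd := hI.raise_mul_flat_apply_adj x h hd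
  exists_edge i hi := by
    obtain ⟨y, hy⟩ := hI.exists_dist_eq hs x i hi.le
    have h1 := hI.dist_add_meetDim x y
    rw [meetDim_comm] at h1
    obtain ⟨w, hw, hm⟩ := hI.exists_farther (y := y) (z := x) hs (by omega)
    refine ⟨y, w, hw, hy, ?_⟩
    rw [← hy]
    exact hI.dist_iff.2 hm.symm
  exists_two hs1 i h1i hi := by
    classical
    obtain ⟨y, hy⟩ := hI.exists_dist_eq hs x i hi.le
    have h1 := hI.dist_add_meetDim x y
    rw [meetDim_comm] at h1
    obtain ⟨w, z, hyw, hwz, hw, hm, hyz⟩ :=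
      hI.exists_farther_two (x := x) (y := y) hs1 (by omega) (by omega)
    have hd : (graph P D).dist x z = (graph P D).dist x y + 1 := hI.dist_iff.2 hm
    refine ⟨y, z, fun h => ?_, hy, by rw [hd, hy], ?_⟩
    · have := hI.adj_iff.1 h
      omega
    · rw [hI.raise_mul_flat_apply x z y hd, (hI.card_common_neighbors_two hyz hm).1]
      simp
  flat_eq_zero h := hI.flat_eq_zero h x
  exists_flat hs1 hD := by
    obtain ⟨y, hy⟩ := hI.exists_dist_eq hs x 1 hD
    have h1 := hI.dist_add_meetDim x y
    rw [meetDim_comm] at h1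
    obtain ⟨w, hw, hm⟩ := hI.exists_level (y := y) (z := x) hs1 (by omega)
    refine ⟨y, w, hw, hy, ?_⟩
    rw [← hy]
    exact hI.dist_eq_iff.2 hm

/-- All adjacent pairs have equally many common neighbours, and such pairs exist, so the infimum is
over a singleton. -/
theorem interNum_one (hs : 0 < s) (hD : 1 ≤ D) (x : Vertex P) :
    interNum (graph P D) 1 1 1 = s - 1 := by
  classical
  have h : {n : ℕ | ∃ y z : Vertex P, (graph P D).dist y z = 1 ∧
      n = {w : Vertex P | (graph P D).dist y w = 1 ∧ (graph P D).dist z w = 1}.ncard} =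
      {s - 1} := by
    have hcard : ∀ y z : Vertex P, (graph P D).dist y z = 1 →
        {w : Vertex P | (graph P D).dist y w = 1 ∧ (graph P D).dist z w = 1}.ncard = s - 1 := by
      intro y z h
      rw [SimpleGraph.dist_eq_one_iff_adj] at h
      rw [← hI.card_common_neighbors_adj h, ← Set.ncard_coe_finset]
      congr 1
      ext w
      simp [SimpleGraph.dist_eq_one_iff_adj, SimpleGraph.adj_comm]
    ext n
    rw [Set.mem_singleton_iff]
    constructor
    · rintro ⟨y, z, h, rfl⟩
      exact hcard y z h
    · rintro rfl
      obtain ⟨y, hy⟩ := hI.exists_dist_eq hs x 1 hD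
      exact ⟨x, y, hy, (hcard x y hy).symm⟩
  rw [interNum, h, csInf_singleton]

end IsDualPolar
end DualPolar

end

theorem mainTheorem9 {F U : Type*} [Field F] [Finite F] [AddCommGroup U] [Module F U]
    (D : ℕ) (hD : 3 ≤ D) (fam : DualPolar.Family) (P : DualPolar.Form F U)
    (hP : P.IsOfFamily fam D)
    [Fintype (DualPolar.Vertex P)] [DecidableEq (DualPolar.Vertex P)]
    (G : SimpleGraph (DualPolar.Vertex P)) (hG : G = DualPolar.graph P D)
    (b a₁ : ℕ) (hb : b = Nat.card F) (ha₁ : a₁ = DualPolar.interNum G 1 1 1)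
    (x : DualPolar.Vertex P) :
    (fam ≠ DualPolar.Family.D →
      (∀ α β : ℕ → ℂ, DualPolar.elemC G x D α β ∈ DualPolar.centerT G x ↔
        (∀ i : ℕ, 1 ≤ i → i ≤ D → α i = (b : ℂ) ^ (1 - (i : ℤ)) * α 1) ∧
        (∀ i : ℕ, i ≤ D → β i = β 0 -
          (a₁ : ℂ) * (b : ℂ) ^ (1 - (i : ℤ)) * (((b : ℂ) ^ i - 1) / ((b : ℂ) - 1)) * α 1)) ∧
      (∃! Om, DualPolar.IsOmega G x b fam.e D Om) ∧
      (∀ Om, DualPolar.IsOmega G x b fam.e D Om →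
        LinearIndependent ℂ ![Om, 1] ∧
        (Submodule.span ℂ {Om, 1} : Set _) =
          DualPolar.centralShape G x D)) ∧
    (fam = DualPolar.Family.D →
      (∀ α β : ℕ → ℂ, DualPolar.elemC G x D α β ∈ DualPolar.centerT G x ↔
        ∀ i : ℕ, i ≤ D → β i = β 0) ∧
      (Submodule.span ℂ {(1 : Matrix (DualPolar.Vertex P) (DualPolar.Vertex P) ℂ)} : Set _) =
        DualPolar.centralShape G x D) := by
  have := hP.finiteDimensional (by omega)
  obtain ⟨s, hs, hI⟩ := hP.isDualPolar (by omega)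
  have hb1 : (1 : ℝ) < (Nat.card F : ℝ) := by exact_mod_cast Finite.one_lt_card
  have hs0 : 0 < s := by
    have : (0 : ℝ) < s := hs ▸ Real.rpow_pos_of_pos (by linarith) _
    exact_mod_cast this
  have hGr := hI.isDualPolarGraph hs0 x
  have ha := hI.interNum_one hs0 (by omega) x
  rw [← hG] at hGr ha
  rw [← ha₁] at ha
  rw [← hb] at hGr hs
  refine ⟨fun hfam => ?_, fun hfam => ?_⟩
  -- Type `D` is the only family with `e = 0`; for the others `s = b ^ e` exceeds 1.
  · have hs1 : 1 < s := by
      have he : 0 < fam.e := by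
        cases fam <;> first | exact absurd rfl hfam | norm_num [DualPolar.Family.e]
      have : (1 : ℝ) < s := by
        rw [hs, hb]
        exact Real.one_lt_rpow hb1 he
      exact_mod_cast this
    have hac : (a₁ : ℂ) = (s : ℂ) - 1 := by
      rw [ha, Nat.cast_sub hs0, Nat.cast_one]
    rw [hac]
    refine ⟨hGr.elemC_mem_centerT_iff_formula hs1,
      ⟨_, hGr.isOmega_omegaElt hs, fun Om h => hGr.eq_omegaElt hs h⟩, fun Om h => ?_⟩
    rw [hGr.eq_omegaElt hs h]
    exact ⟨hGr.linearIndependent_omegaElt hs1 (by omega) _, hGr.span_omegaElt hs1 _⟩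
  · have hs1 : s = 1 := by
      rw [hfam, DualPolar.Family.e, Real.rpow_zero] at hs
      exact_mod_cast hs
    exact ⟨hGr.elemC_mem_centerT_iff_of_one hs1, hGr.span_one hs1⟩
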